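/- Fix a vocabulary $V$, a set of symbols $B$ and a sentence symbol $s\in B$. A dependency grammar $G$ is a set of rules of three shapes: (I) $(x,\,y_1\dots y_l\star y_{l+1}\dots y_m)$ with $x,y_i\in B$; (II) $(w,x)$ with $w\in V$, $x\in B$; (III) $(x,s)$ with $x\in B$. Assume that $s$ is reserved for rules of shape III: no rule $(w,s)$ of shape II and no rule $(s,s)$ of shape III belongs to $G$, and $s$ is not among the $y_i$ of any rule of shape I in $G$. A *dependency relation* for a string $u=w_1\dots w_n\in V^*$ consists of symbols $x_1,\dots,x_n\in B$ and a binary relation $d$ on the $n$ occurrences $x_1,\dots,x_n$ ($(x_i,x_j)\in d$ means that $x_i$ depends on the head $x_j$) such that 1. $(w_i,x_i)\in G$ for all $i$; 2. (acyclic) $(x_i,x_i)$ is never in the transitive closure of $d$; 3. (monogamous) if $(x_i,x_j),(x_i,x_k)\in d$ then $j=k$; 4. (planar) if $j$ lies between $i$ and $k$ ($i\le j\le k$ or $k\le j\le i$) and $(x_i,x_k)$ is in the reflexive transitive closure $RTC(d)$, then $(x_j,x_k)\in RTC(d)$; 5. (connected and rooted) there is exactly one occurrence $x_h$ that depends on no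 $x_j$, and $(x_h,s)\in G$; 6. for every $i$, $(x_i,\,y_1\dots y_l\star y_{l+1}\dots y_m)\in G$, where $y_1,\dots,y_l$ are the symbols that depend on $x_i$ from the left and $y_{l+1},\dots,y_m$ those that depend on $x_i$ from the right, each of the two lists being read from right to left in the string. For a pregroup grammar $P=(V,B,\Delta,I,s)$, with lexicon $\Delta\subseteq V\times P(B)$ and induced steps $I\subseteq B\times B$, let $\mathbf{RC}(P)=\mathbf{RC}(\Delta+I)$ be the free rigid category on the objects $B+V$ with a generating arrow $w\to t$ for each $(w,t)\in\Delta$ and $x\to y$ for each $(x,y)\in I$; the cups are $a\otimes a^r\to 1$ and $a^l\otimes a\to 1$. A *reduction* of $u=w_1\dots w_n$ is a morphism $w_1\otimes\dots\otimes w_n\to s$ in $\mathbf{RC}(P)$. $P$ is *operadic* if every lexical entry has the form $(w,\;y_1^r\dots y_l^r\,x\,z_1^l\dots z_m^l)$ with $x,y_i,z_i\in B$. Let $\Delta(G)$ be the set of all $(w,\;y_1^r\dots y_l^r\,x\,y_{l+1}^l\dots y_m^l)$ with $(w,x)\in G$ and $(x,\,y_1\dots y_l\star y_{l+1}\dots y_m)\in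 G$, and let $I(G)$ be the set of rules $(x,s)\in G$ of shape III. **Proposition.** Every dependency grammar $G$ as above is structurally equivalent to the operadic pregroup $\tilde G=(V,B,\Delta(G),I(G),s)$. That is, $\tilde G$ is operadic, and for every string $u$ the dependency relations for $u$ are in bijection with the reductions $u\to s$ in $\mathbf{RC}(\tilde G)$. The bijection sends a dependency relation to the reduction that it draws: apply to each $w_i$ the lexical entry given by $x_i$ and its dependents (conditions 1 and 6), connect by cups each non-root $x_i$ with the corresponding $x_i^r$ or $x_i^l$ in the lexical entry of its head, until only $x_h$ is left, then apply the induced step $x_h\to s$. (This morphism does not depend on the order in which the cups are applied.) -/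

import Mathlib

open CategoryTheory MonoidalCategory

universe u v w

/-- The pregroup types `P(X)` over a set `X` of basic types, together with the unit type (the empty
tensor product). -/
inductive PType (X : Type u) : Type u
  | atom : X → PType X
  | unit : PType X
  | tensor : PType X → PType X → PType X
  | ladj : PType X → PType X
  | radj : PType X → PType X

namespace PType

/-- The map `P(X) → P(Y)` induced by `X → Y`. -/
def map {X : Type u} {Y : Type v} (f : X → Y) : PType X → PType Y
  | atom x => atom (f x)
  | unit => unit
  | tensor a b => tensor (map f a) (map f b)
  | ladj a => ladj (map f a)
  | radj a => radj (map f a)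

/-- The tensor product `t₁ ⊗ (t₂ ⊗ (… ⊗ (tₖ ⊗ 1)))` of a list of types. -/
def tensorList {X : Type u} : List (PType X) → PType X
  | [] => unit
  | a :: l => tensor a (tensorList l)

/-- The operadic type `y₁ʳ … yₗʳ x z₁ˡ … zₘˡ`. -/
def operadic {B : Type u} (x : B) (y z : List B) : PType B :=
  tensorList (y.map (fun b => radj (atom b)) ++ atom x :: z.map (fun b => ladj (atom b)))

end PType

/-- A rigid signature: a graph whose vertices are the pregroup types over `X`. -/
structure RigidSignature (X : Type u) where
  /-- The generating arrows. -/
  Edge : Type w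
  dom : Edge → PType X
  cod : Edge → PType X

/-! ### The free rigid category on a rigid signature -/

/-- The objects of the free rigid category `RC(S)`. -/
def RC {X : Type u} (_S : RigidSignature.{u, w} X) : Type u := PType X

namespace RC

open PType

variable {X : Type u}

/-- Formal morphisms of the free rigid category: composites and tensor products of generators,
identities, structural isomorphisms of monoidal categories, cups and caps. -/
inductive Hom (S : RigidSignature.{u, w} X) : PType X → PType X → Type (max u w)
  | gen (e : S.Edge) : Hom S (S.dom e) (S.cod e)
  | id (a : PType X) : Hom S a a
  | comp {a b c : PType X} (f : Hom S a b) (g : Hom S b c) : Hom S a c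
  | tensor {a b c d : PType X} (f : Hom S a b) (g : Hom S c d) : Hom S (a.tensor c) (b.tensor d)
  | α_hom (a b c : PType X) : Hom S ((a.tensor b).tensor c) (a.tensor (b.tensor c))
  | α_inv (a b c : PType X) : Hom S (a.tensor (b.tensor c)) ((a.tensor b).tensor c)
  | l_hom (a : PType X) : Hom S (unit.tensor a) a
  | l_inv (a : PType X) : Hom S a (unit.tensor a)
  | ρ_hom (a : PType X) : Hom S (a.tensor unit) a
  | ρ_inv (a : PType X) : Hom S a (a.tensor unit)
  | cupL (a : PType X) : Hom S (a.ladj.tensor a) unit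
  | capL (a : PType X) : Hom S unit (a.tensor a.ladj)
  | cupR (a : PType X) : Hom S (a.tensor a.radj) unit
  | capR (a : PType X) : Hom S unit (a.radj.tensor a)

/-- The congruence on formal morphisms generated by the axioms of monoidal categories and the
snake equations. -/
inductive HomEquiv (S : RigidSignature.{u, w} X) :
    ∀ {a b : PType X}, Hom S a b → Hom S a b → Prop
  | refl {a b : PType X} (f : Hom S a b) : HomEquiv S f f
  | symm {a b : PType X} {f g : Hom S a b} : HomEquiv S f g → HomEquiv S g f
  | trans {a b : PType X} {f g h : Hom S a b} : HomEquiv S f g → HomEquiv S g h → HomEquiv S f h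
  | comp {a b c : PType X} {f f' : Hom S a b} {g g' : Hom S b c} :
      HomEquiv S f f' → HomEquiv S g g' → HomEquiv S (f.comp g) (f'.comp g')
  | tensor {a b c d : PType X} {f f' : Hom S a b} {g g' : Hom S c d} :
      HomEquiv S f f' → HomEquiv S g g' → HomEquiv S (f.tensor g) (f'.tensor g')
  -- axioms of a category
  | comp_id {a b : PType X} (f : Hom S a b) : HomEquiv S (f.comp (.id b)) f
  | id_comp {a b : PType X} (f : Hom S a b) : HomEquiv S ((Hom.id a).comp f) f
  | assoc {a b c d : PType X} (f : Hom S a b) (g : Hom S b c) (h : Hom S c d) :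
      HomEquiv S ((f.comp g).comp h) (f.comp (g.comp h))
  -- axioms of a monoidal category
  | tensor_id {a b : PType X} : HomEquiv S ((Hom.id a).tensor (Hom.id b)) (.id (a.tensor b))
  | tensor_comp {a₁ b₁ c₁ a₂ b₂ c₂ : PType X} (f₁ : Hom S a₁ b₁) (f₂ : Hom S a₂ b₂)
      (g₁ : Hom S b₁ c₁) (g₂ : Hom S b₂ c₂) :
      HomEquiv S ((f₁.tensor f₂).comp (g₁.tensor g₂)) ((f₁.comp g₁).tensor (f₂.comp g₂))
  | α_hom_inv {a b c : PType X} : HomEquiv S ((Hom.α_hom a b c).comp (.α_inv a b c)) (.id _)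
  | α_inv_hom {a b c : PType X} : HomEquiv S ((Hom.α_inv a b c).comp (.α_hom a b c)) (.id _)
  | α_naturality {a₁ a₂ a₃ b₁ b₂ b₃ : PType X} (f₁ : Hom S a₁ b₁) (f₂ : Hom S a₂ b₂) (f₃ : Hom S a₃ b₃) :
      HomEquiv S (((f₁.tensor f₂).tensor f₃).comp (.α_hom b₁ b₂ b₃))
        ((Hom.α_hom a₁ a₂ a₃).comp (f₁.tensor (f₂.tensor f₃)))
  | l_hom_inv {a : PType X} : HomEquiv S ((Hom.l_hom a).comp (.l_inv a)) (.id _)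
  | l_inv_hom {a : PType X} : HomEquiv S ((Hom.l_inv a).comp (.l_hom a)) (.id _)
  | l_naturality {a b : PType X} (f : Hom S a b) :
      HomEquiv S (((Hom.id unit).tensor f).comp (.l_hom b)) ((Hom.l_hom a).comp f)
  | ρ_hom_inv {a : PType X} : HomEquiv S ((Hom.ρ_hom a).comp (.ρ_inv a)) (.id _)
  | ρ_inv_hom {a : PType X} : HomEquiv S ((Hom.ρ_inv a).comp (.ρ_hom a)) (.id _)
  | ρ_naturality {a b : PType X} (f : Hom S a b) :
      HomEquiv S ((f.tensor (Hom.id unit)).comp (.ρ_hom b)) ((Hom.ρ_hom a).comp f)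
  | pentagon {a b c d : PType X} :
      HomEquiv S
        (((Hom.α_hom a b c).tensor (.id d)).comp
          ((Hom.α_hom a (b.tensor c) d).comp ((Hom.id a).tensor (.α_hom b c d))))
        ((Hom.α_hom (a.tensor b) c d).comp (.α_hom a b (c.tensor d)))
  | triangle {a b : PType X} :
      HomEquiv S ((Hom.α_hom a unit b).comp ((Hom.id a).tensor (.l_hom b)))
        ((Hom.ρ_hom a).tensor (.id b))
  -- snake equations
  | snakeL₁ (a : PType X) :
      HomEquiv S (((Hom.id a.ladj).tensor (.capL a)).comp
          ((Hom.α_inv a.ladj a a.ladj).comp ((Hom.cupL a).tensor (.id a.ladj))))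
        ((Hom.ρ_hom a.ladj).comp (.l_inv a.ladj))
  | snakeL₂ (a : PType X) :
      HomEquiv S (((Hom.capL a).tensor (.id a)).comp
          ((Hom.α_hom a a.ladj a).comp ((Hom.id a).tensor (.cupL a))))
        ((Hom.l_hom a).comp (.ρ_inv a))
  | snakeR₁ (a : PType X) :
      HomEquiv S (((Hom.id a).tensor (.capR a)).comp
          ((Hom.α_inv a a.radj a).comp ((Hom.cupR a).tensor (.id a))))
        ((Hom.ρ_hom a).comp (.l_inv a))
  | snakeR₂ (a : PType X) :
      HomEquiv S (((Hom.capR a).tensor (.id a.radj)).comp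
          ((Hom.α_hom a.radj a a.radj).comp ((Hom.id a.radj).tensor (.cupR a))))
        ((Hom.l_hom a.radj).comp (.ρ_inv a.radj))

/-- Formal morphisms up to the axioms of rigid categories. -/
instance homSetoid (S : RigidSignature.{u, w} X) (a b : PType X) : Setoid (Hom S a b) :=
  ⟨HomEquiv S, ⟨.refl, .symm, .trans⟩⟩

variable {S : RigidSignature.{u, w} X}

instance : Category.{max u w} (RC S) where
  Hom a b := Quotient (homSetoid S a b)
  id a := ⟦Hom.id a⟧
  comp := Quotient.map₂ Hom.comp (fun _ _ hf _ _ hg => HomEquiv.comp hf hg)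
  id_comp := by
    rintro a b ⟨f⟩
    exact Quotient.sound (HomEquiv.id_comp f)
  comp_id := by
    rintro a b ⟨f⟩
    exact Quotient.sound (HomEquiv.comp_id f)
  assoc := by
    rintro a b c d ⟨f⟩ ⟨g⟩ ⟨h⟩
    exact Quotient.sound (HomEquiv.assoc f g h)

/-- The morphism of `RC(S)` represented by a formal morphism. -/
def homMk {a b : RC S} (f : Hom S a b) : a ⟶ b := Quotient.mk (homSetoid S a b) f

/-- The tensor product of morphisms. -/
def tensorMor {a b c d : RC S} (f : a ⟶ b) (g : c ⟶ d) :
    (show RC S from PType.tensor a c) ⟶ (show RC S from PType.tensor b d) :=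
  Quotient.map₂ (Hom.tensor (S := S) (a := a) (b := b) (c := c) (d := d))
    (fun _ _ hf _ _ hg => HomEquiv.tensor hf hg) f g

instance : MonoidalCategoryStruct (RC S) where
  tensorObj a b := PType.tensor a b
  tensorUnit := PType.unit
  tensorHom := tensorMor
  whiskerLeft a _ _ f := tensorMor (𝟙 a) f
  whiskerRight f b := tensorMor f (𝟙 b)
  associator a b c :=
    ⟨⟦Hom.α_hom a b c⟧, ⟦Hom.α_inv a b c⟧,
      Quotient.sound HomEquiv.α_hom_inv, Quotient.sound HomEquiv.α_inv_hom⟩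
  leftUnitor a :=
    ⟨⟦Hom.l_hom a⟧, ⟦Hom.l_inv a⟧, Quotient.sound HomEquiv.l_hom_inv, Quotient.sound HomEquiv.l_inv_hom⟩
  rightUnitor a :=
    ⟨⟦Hom.ρ_hom a⟧, ⟦Hom.ρ_inv a⟧, Quotient.sound HomEquiv.ρ_hom_inv, Quotient.sound HomEquiv.ρ_inv_hom⟩

instance : MonoidalCategory (RC S) := MonoidalCategory.ofTensorHom
  (id_tensorHom_id := fun _ _ => Quotient.sound HomEquiv.tensor_id)
  (id_tensorHom := fun _ _ _ _ => rfl)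
  (tensorHom_id := fun _ _ => rfl)
  (tensorHom_comp_tensorHom := by
    rintro _ _ _ _ _ _ ⟨f₁⟩ ⟨f₂⟩ ⟨g₁⟩ ⟨g₂⟩
    exact Quotient.sound (HomEquiv.tensor_comp f₁ f₂ g₁ g₂))
  (associator_naturality := by
    rintro _ _ _ _ _ _ ⟨f₁⟩ ⟨f₂⟩ ⟨f₃⟩
    exact Quotient.sound (HomEquiv.α_naturality f₁ f₂ f₃))
  (leftUnitor_naturality := by
    rintro _ _ ⟨f⟩
    exact Quotient.sound (HomEquiv.l_naturality f))
  (rightUnitor_naturality := by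
    rintro _ _ ⟨f⟩
    exact Quotient.sound (HomEquiv.ρ_naturality f))
  (pentagon := fun _ _ _ _ => Quotient.sound HomEquiv.pentagon)
  (triangle := fun _ _ => Quotient.sound HomEquiv.triangle)

/-- The left adjoint `aˡ`. -/
def ladj (a : RC S) : RC S := PType.ladj a

/-- The right adjoint `aʳ`. -/
def radj (a : RC S) : RC S := PType.radj a

/-- The cup `aˡ ⊗ a ⟶ 1` and the cap `1 ⟶ a ⊗ aˡ`. (Mathlib calls `aˡ` the right dual.) -/
instance exactPairingLadj (a : RC S) : ExactPairing a a.ladj where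
  coevaluation' := homMk (.capL a)
  evaluation' := homMk (.cupL a)
  coevaluation_evaluation' := Quotient.sound (HomEquiv.snakeL₁ a)
  evaluation_coevaluation' := Quotient.sound (HomEquiv.snakeL₂ a)

/-- The cup `a ⊗ aʳ ⟶ 1` and the cap `1 ⟶ aʳ ⊗ a`. (Mathlib calls `aʳ` the left dual.) -/
instance exactPairingRadj (a : RC S) : ExactPairing a.radj a where
  coevaluation' := homMk (.capR a)
  evaluation' := homMk (.cupR a)
  coevaluation_evaluation' := Quotient.sound (HomEquiv.snakeR₁ a)
  evaluation_coevaluation' := Quotient.sound (HomEquiv.snakeR₂ a)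

instance : RigidCategory (RC S) where
  rightDual a := ⟨a.ladj⟩
  leftDual a := ⟨a.radj⟩

/-- The contraction `a (aʳ c) ⟶ c`. -/
def contractR (a c : RC S) : a ⊗ (a.radj ⊗ c) ⟶ c :=
  (α_ a a.radj c).inv ≫ homMk (.cupR a) ▷ c ≫ (λ_ c).hom

/-- The contraction `aˡ (a c) ⟶ c`. -/
def contractL (a c : RC S) : a.ladj ⊗ (a ⊗ c) ⟶ c :=
  (α_ a.ladj a c).inv ≫ homMk (.cupL a) ▷ c ≫ (λ_ c).hom

end RC

/-! ### Pregroup grammars -/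

/-- A pregroup grammar `(V, B, Δ, I, s)`. -/
structure PregroupGrammar (V : Type u) (B : Type v) where
  /-- The lexicon `Δ`. -/
  lexicon : Set (V × PType B)
  /-- The induced steps `I`. -/
  induced : Set (B × B)
  /-- The sentence type `s`. -/
  sentence : B

namespace PregroupGrammar

variable {V : Type u} {B : Type v}

/-- The rigid signature `Δ + I` over `B + V`: an arrow `w ⟶ t` for every `(w, t) ∈ Δ` and an
arrow `x ⟶ y` for every `(x, y) ∈ I`. -/
def signature (P : PregroupGrammar V B) : RigidSignature.{max u v, max u v} (B ⊕ V) where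
  Edge := P.lexicon ⊕ P.induced
  dom
    | .inl e => .atom (.inr e.1.1)
    | .inr e => .atom (.inl e.1.1)
  cod
    | .inl e => e.1.2.map .inl
    | .inr e => .atom (.inl e.1.2)

/-- The category `RC(Δ + I)`. -/
abbrev Cat (P : PregroupGrammar V B) : Type (max u v) := RC P.signature

/-- A pregroup type over `B` as an object of `RC(Δ + I)`. -/
def ofType (P : PregroupGrammar V B) (t : PType B) : P.Cat := t.map .inl

/-- The object `w₁ ⊗ … ⊗ wₙ` of `RC(Δ + I)` given by the words of `w` at a list of positions. -/
def wordsObj (P : PregroupGrammar V B) {n : ℕ} (w : Fin n → V) (js : List (Fin n)) : P.Cat :=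
  PType.tensorList (js.map fun j => .atom (.inr (w j)))

/-- The reductions `w₁ … wₙ ⟶ s`: the morphisms from the string `w₁ … wₙ` to the sentence type in
the free rigid category. -/
def Reduction (P : PregroupGrammar V B) {n : ℕ} (w : Fin n → V) : Type (max u v) :=
  P.wordsObj w (List.finRange n) ⟶ P.ofType (.atom P.sentence)

/-- A lexical entry `w ⟶ t`, as a morphism. -/
def lexStep (P : PregroupGrammar V B) (a : V) (t : PType B) (h : (a, t) ∈ P.lexicon) :
    (show P.Cat from PType.atom (.inr a)) ⟶ P.ofType t :=
  RC.homMk (.gen (S := P.signature) (.inl ⟨(a, t), h⟩))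

/-- An induced step `x ⟶ y`, as a morphism. -/
def inducedStep (P : PregroupGrammar V B) (x y : B) (h : (x, y) ∈ P.induced) :
    P.ofType (.atom x) ⟶ P.ofType (.atom y) :=
  RC.homMk (.gen (S := P.signature) (.inr ⟨(x, y), h⟩))

/-- An operadic pregroup: all lexical entries are of the form `(w, yʳ x zˡ)`. -/
def IsOperadic (P : PregroupGrammar V B) : Prop :=
  ∀ e ∈ P.lexicon, ∃ (x : B) (y z : List B), e.2 = PType.operadic x y z

end PregroupGrammar

/-! ### Wires and cups -/

/-- Simple types labelled by occurrences of symbols: `base i`, `right i` and `left i` stand for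
`xᵢ`, `xᵢʳ` and `xᵢˡ`. -/
inductive Wire (ι : Type)
  | base : ι → Wire ι
  | right : ι → Wire ι
  | left : ι → Wire ι

namespace Wire

variable {V : Type u} {B : Type v} {ι : Type}

/-- The type of a wire, given the symbols `xᵢ`. -/
def type (x : ι → B) : Wire ι → PType B
  | base i => .atom (x i)
  | right i => .radj (.atom (x i))
  | left i => .ladj (.atom (x i))

/-- The type of a sequence of wires. -/
def listType (x : ι → B) (W : List (Wire ι)) : PType B := PType.tensorList (W.map (type x))

/-- The object of `RC(Δ + I)` given by a sequence of wires. -/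
def obj (P : PregroupGrammar V B) (x : ι → B) (W : List (Wire ι)) : P.Cat :=
  P.ofType (listType x W)

/-- The canonical isomorphism from the tensor product of two sequences of wires to their
concatenation. -/
def append (P : PregroupGrammar V B) (x : ι → B) :
    ∀ W W' : List (Wire ι), obj P x W ⊗ obj P x W' ≅ obj P x (W ++ W')
  | [], W' => λ_ (obj P x W')
  | a :: W, W' =>
      α_ (P.ofType (a.type x)) (obj P x W) (obj P x W') ≪≫
        whiskerLeftIso (P.ofType (a.type x)) (append P x W W')

/-- `Cup P x W W' f`: the morphism `f` is a single cup, applied to two adjacent wires of `W` that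
carry the same label, tensored with the identity on the other wires; these form `W'`. -/
inductive Cup (P : PregroupGrammar V B) (x : ι → B) :
    ∀ W W' : List (Wire ι), (obj P x W ⟶ obj P x W') → Prop
  | right (i : ι) (W : List (Wire ι)) :
      Cup P x (.base i :: .right i :: W) W
        (RC.contractR (P.ofType (.atom (x i))) (obj P x W))
  | left (i : ι) (W : List (Wire ι)) :
      Cup P x (.left i :: .base i :: W) W
        (RC.contractL (P.ofType (.atom (x i))) (obj P x W))
  | cons (a : Wire ι) {W W' : List (Wire ι)} {f : obj P x W ⟶ obj P x W'} :
      Cup P x W W' f → Cup P x (a :: W) (a :: W') (P.ofType (a.type x) ◁ f)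

/-- `Cups P x W W' f`: the morphism `f` is a composite of cups, each of which links two wires with
the same label. -/
inductive Cups (P : PregroupGrammar V B) (x : ι → B) :
    ∀ W W' : List (Wire ι), (obj P x W ⟶ obj P x W') → Prop
  | id (W : List (Wire ι)) : Cups P x W W (𝟙 _)
  | comp {W W' W'' : List (Wire ι)} {f : obj P x W ⟶ obj P x W'} {g : obj P x W' ⟶ obj P x W''} :
      Cup P x W W' f → Cups P x W' W'' g → Cups P x W W'' (f ≫ g)

end Wire

/-! ### Dependency grammars -/

/-- A dependency grammar with vocabulary `V` and set of symbols `B`. -/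
structure DependencyGrammar (V : Type u) (B : Type v) where
  /-- The sentence symbol `s`. -/
  sentence : B
  /-- `rule x y z`: the rule `(x, y₁ … yₗ ⋆ z₁ … zₘ)` of shape I belongs to the grammar. -/
  rule : B → List B → List B → Prop
  /-- `typing w x`: the rule `(w, x)` of shape II belongs to the grammar. -/
  typing : V → B → Prop
  /-- `governs x`: the rule `(x, s)` of shape III belongs to the grammar. -/
  governs : B → Prop

namespace DependencyGrammar

variable {V : Type u} {B : Type v}

/-- The sentence symbol is only used as the right-hand side of rules `(x, s)` of shape III
(it may in addition have rules of shape I, which are then never used). -/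
structure SentenceReserved (G : DependencyGrammar V B) : Prop where
  not_typing : ∀ a, ¬ G.typing a G.sentence
  not_dependent : ∀ x y z, G.rule x y z → G.sentence ∉ y ∧ G.sentence ∉ z
  not_governs : ¬ G.governs G.sentence

/-- The pregroup grammar `(V, B, Δ(G), I(G), s)`. -/
def toPregroup (G : DependencyGrammar V B) : PregroupGrammar V B where
  lexicon := {e | ∃ x y z, G.typing e.1 x ∧ G.rule x y z ∧ e.2 = PType.operadic x y z}
  induced := {e | G.governs e.1 ∧ e.2 = G.sentence}
  sentence := G.sentence

open Classical in
/-- The positions depending on `i` from the left, from right to left. -/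
noncomputable def leftDeps {n : ℕ} (d : Fin n → Fin n → Prop) (i : Fin n) : List (Fin n) :=
  (List.finRange n).reverse.filter fun j => d j i ∧ j < i

open Classical in
/-- The positions depending on `i` from the right, from right to left. -/
noncomputable def rightDeps {n : ℕ} (d : Fin n → Fin n → Prop) (i : Fin n) : List (Fin n) :=
  (List.finRange n).reverse.filter fun j => d j i ∧ i < j

/-- A dependency relation for the string `w₁ … wₙ`: symbols `x₁, …, xₙ` and a binary relation `d`
on their occurrences, where `d i j` means that `xᵢ` depends on the head `xⱼ`. -/
@[ext]
structure DependencyRelation (G : DependencyGrammar V B) {n : ℕ} (w : Fin n → V) where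
  x : Fin n → B
  d : Fin n → Fin n → Prop
  typing : ∀ i, G.typing (w i) (x i)
  acyclic : ∀ i, ¬ Relation.TransGen d i i
  monogamous : ∀ i j k, d i j → d i k → j = k
  planar : ∀ i j k, (i ≤ j ∧ j ≤ k) ∨ (k ≤ j ∧ j ≤ i) →
    Relation.ReflTransGen d i k → Relation.ReflTransGen d j k
  rooted : ∃ h, (∀ j, ¬ d h j) ∧ G.governs (x h) ∧ ∀ h', (∀ j, ¬ d h' j) → h' = h
  allowed : ∀ i, G.rule (x i) ((leftDeps d i).map x) ((rightDeps d i).map x)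

namespace DependencyRelation

variable {G : DependencyGrammar V B} {n : ℕ} {w : Fin n → V}

/-- The labelled wires `y₁ʳ … yₗʳ xᵢ yₗ₊₁ˡ … yₘˡ` of the lexical entry assigned to `wᵢ`, where
`y₁, …, yₗ` and `yₗ₊₁, …, yₘ` depend on `xᵢ` from the left and from the right. -/
noncomputable def wires (D : DependencyRelation G w) (i : Fin n) : List (Wire (Fin n)) :=
  (leftDeps D.d i).map .right ++ .base i :: (rightDeps D.d i).map .left

theorem mem_lexicon (D : DependencyRelation G w) (i : Fin n) :
    (w i, Wire.listType D.x (D.wires i)) ∈ G.toPregroup.lexicon := by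
  refine ⟨D.x i, (leftDeps D.d i).map D.x, (rightDeps D.d i).map D.x, D.typing i, D.allowed i, ?_⟩
  simp [Wire.listType, wires, PType.operadic, Wire.type, Function.comp_def]

/-- The tensor product of the lexical entries assigned to the words at a list of positions. -/
noncomputable def lexical (D : DependencyRelation G w) : ∀ js : List (Fin n),
    G.toPregroup.wordsObj w js ⟶ Wire.obj G.toPregroup D.x (js.flatMap D.wires)
  | [] => 𝟙 (𝟙_ G.toPregroup.Cat)
  | j :: js =>
      (G.toPregroup.lexStep (w j) _ (D.mem_lexicon j) ⊗ₘ D.lexical js) ≫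
        (Wire.append G.toPregroup D.x (D.wires j) (js.flatMap D.wires)).hom

/-- The reduction `g : w₁ … wₙ ⟶ s` is the diagram drawn by `D`: apply to each word the lexical
entry given by its symbol and its dependents, then connect by cups each `xᵢ` with the occurrence of
`xᵢʳ` or `xᵢˡ` in the lexical entry of the head of `xᵢ`, until only the root `xₕ` is left, and
apply the induced step `xₕ ⟶ s`. -/
def Draws (D : DependencyRelation G w) (g : G.toPregroup.Reduction w) : Prop :=
  ∃ (h : Fin n) (hg : G.governs (D.x h))
    (c : Wire.obj G.toPregroup D.x ((List.finRange n).flatMap D.wires) ⟶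
      Wire.obj G.toPregroup D.x [.base h]),
    (∀ j, ¬ D.d h j) ∧ Wire.Cups G.toPregroup D.x _ _ c ∧
      g = D.lexical (List.finRange n) ≫ c ≫
        (ρ_ (G.toPregroup.ofType (.atom (D.x h)))).hom ≫
          G.toPregroup.inducedStep (D.x h) G.sentence ⟨hg, rfl⟩

end DependencyRelation

end DependencyGrammar

/-!
A reduction `g` is a morphism of a category given by generators and relations. The theorem needs
three facts: every `g` is drawn by some dependency relation (`DependencyGrammar.exists_draws`),
every dependency relation draws exactly one reduction (`exists_draws_reduction`, `Draws.unique`),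
and `g` determines the dependency relation (`eq_of_draws`).

*Surjectivity.* Tensoring on the left with a type `t` is naturally isomorphic to putting a sequence
of simple types `a⁽ᶻ⁾` (atoms with iterated adjoints) in front of a sequence; for adjoint types this
is the uniqueness of adjoint functors (`RC.Strand.flat`). Along these isomorphisms every morphism is
a composite of elementary steps: a cup `a⁽ᶻ⁾ ⊗ a⁽ᶻ⁺¹⁾ ⟶ 1`, a cap, or a generating arrow, applied at
some position (`RC.Strand.decomposes`).

The steps are then brought into a normal form, as in Lambek's switching lemma. A generating arrow
can be slid around a cap or a cup, where it becomes one of its mates. A lexical entry is treated as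
an emission, which moves to the front; an induced step is treated as a collapse, which moves to the
back. A cap followed by a cup is an identity or can be interchanged with it. What remains is:
emissions, cups, caps, collapses (`RC.Strand.NormalForm.comp_path`). This requires that the types of
the lexical entries and the sources of the induced steps do not contain the sentence symbol, which
holds because it is reserved. Since the target of a reduction is a single simple type, there are no
caps, and since it is the sentence type, there is exactly one induced step, the last one
(`PregroupGrammar.exists_entries`).

In an operadic entry each cup joins the symbol of one word with a dependent's wire in the entry of
another word, so the cups label the dependents (`PregroupGrammar.exists_cups_label`). A planar
matching of all wires but one is the same as nested arcs (`Wire.nested`), and nested arcs give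
conditions 2 to 6 of a dependency relation (`Nested.acyclic`, `Nested.planar`, `Wire.leftDeps_eq`).

*Existence and uniqueness of the drawing.* Conversely, planarity implies that the arcs of a
dependency relation are nested, so the cups can be applied from the shortest arc to the longest one
(`DependencyRelation.contracts`). Different cups commute (`Wire.Cup.diamond`), so their order does
not matter.

*Injectivity.* Relations between sets form a rigid category in which each object is its own adjoint
and cups and caps are equality. In this model (`RC.rel`) let the symbols take positions in the
string as values, and let the value of a word be the wires of the entry assigned to it by `D`. The
diagram drawn by `D` relates the words to its root. If `D'` draws the same morphism, then its
diagram does so as well, and since labels are constant along cups, the wires of `D'` and `D` agree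
(`eq_of_draws`).
-/

/-! ### Dual pairs and sequences of simple types -/

section Pairing

variable {C : Type*} [Category C] [MonoidalCategory C]

/-- The evaluation of a dual pair, applied to the two leftmost factors. -/
def contract (a b : C) [ExactPairing a b] (c : C) : b ⊗ (a ⊗ c) ⟶ c :=
  (α_ b a c).inv ≫ ε_ a b ▷ c ≫ (λ_ c).hom

/-- The coevaluation of a dual pair, inserted on the left. -/
def expand (a b : C) [ExactPairing a b] (c : C) : c ⟶ a ⊗ (b ⊗ c) :=
  (λ_ c).inv ≫ η_ a b ▷ c ≫ (α_ a b c).hom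

theorem contract_naturality (a b : C) [ExactPairing a b] {c c' : C} (f : c ⟶ c') :
    b ◁ a ◁ f ≫ contract a b c' = contract a b c ≫ f := by
  simp only [contract, Category.assoc]
  rw [← leftUnitor_naturality, ← whisker_exchange_assoc, associator_inv_naturality_right_assoc]

theorem expand_naturality (a b : C) [ExactPairing a b] {c c' : C} (f : c ⟶ c') :
    f ≫ expand a b c' = expand a b c ≫ a ◁ b ◁ f := by
  simp only [expand, Category.assoc]
  rw [← associator_naturality_right, ← whisker_exchange_assoc, leftUnitor_inv_naturality_assoc]

theorem expand_contract (a b : C) [ExactPairing a b] (c : C) :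
    b ◁ expand a b c ≫ contract a b (b ⊗ c) = 𝟙 _ := by
  calc
    _ = 𝟙 _ ⊗≫ (b ◁ η_ a b ⊗≫ ε_ a b ▷ b) ▷ c ⊗≫ 𝟙 _ := by
      simp only [expand, contract]; monoidal
    _ = 𝟙 _ := by rw [ExactPairing.coevaluation_evaluation'']; monoidal

theorem contract_expand (a b : C) [ExactPairing a b] (c : C) :
    expand a b (a ⊗ c) ≫ a ◁ contract a b c = 𝟙 _ := by
  calc
    _ = 𝟙 _ ⊗≫ (η_ a b ▷ a ⊗≫ a ◁ ε_ a b) ▷ c ⊗≫ 𝟙 _ := by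
      simp only [expand, contract]; monoidal
    _ = 𝟙 _ := by rw [ExactPairing.evaluation_coevaluation'']; monoidal

end Pairing

namespace RC

variable {X : Type u}

/-- The iterated right adjoints of an atom. -/
def rpow (a : X) : ℕ → PType X
  | 0 => .atom a
  | n + 1 => .radj (rpow a n)

/-- The iterated left adjoints of an atom, starting with the first one. -/
def lpow (a : X) : ℕ → PType X
  | 0 => .ladj (.atom a)
  | n + 1 => .ladj (lpow a n)

/-- The simple type `a⁽ᶻ⁾`: the atom `a` with `z` right adjoints, or with `-z` left adjoints. -/
def simple (a : X) : ℤ → PType X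
  | .ofNat n => rpow a n
  | .negSucc n => lpow a n

/-- A pregroup type as an object of the free rigid category. -/
abbrev of (S : RigidSignature.{u, w} X) (t : PType X) : RC S := t

variable {S : RigidSignature.{u, w} X}

/-- The cup `a⁽ᶻ⁾ ⊗ a⁽ᶻ⁺¹⁾ ⟶ 1` and the cap `1 ⟶ a⁽ᶻ⁺¹⁾ ⊗ a⁽ᶻ⁾`. -/
@[reducible] def simplePairing (a : X) :
    (z : ℤ) → ExactPairing (of S (simple a (z + 1))) (of S (simple a z))
  | .ofNat n => exactPairingRadj (of S (rpow a n))
  | .negSucc 0 => exactPairingLadj (of S (.atom a))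
  | .negSucc (n + 1) => exactPairingLadj (of S (lpow a n))

variable (S) in
/-- A sequence of simple types, followed by an arbitrary object of `RC S`. -/
inductive Strand : Type u
  | tail (A : RC S) : Strand
  | cons (σ : X × ℤ) (Y : Strand) : Strand

namespace Strand

/-- The tensor product of a sequence. -/
def ob : Strand S → RC S
  | tail A => A
  | cons σ Y => (of S (simple σ.1 σ.2)) ⊗ ob Y

instance : Category (Strand S) where
  Hom Y Z := ob Y ⟶ ob Z
  id Y := 𝟙 (ob Y)
  comp f g := CategoryStruct.comp (obj := RC S) f g
  id_comp f := Category.id_comp (obj := RC S) f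
  comp_id f := Category.comp_id (obj := RC S) f
  assoc f g h := Category.assoc (obj := RC S) f g h

variable (S) in
/-- The functor that puts a simple type in front of a sequence. -/
def consF (σ : X × ℤ) : Strand S ⥤ Strand S where
  obj Y := cons σ Y
  map {Y Z} f := (of S (simple σ.1 σ.2)) ◁ (show ob Y ⟶ ob Z from f)
  map_id Y := MonoidalCategory.whiskerLeft_id _ (ob Y)
  map_comp {Y Z W} f g := MonoidalCategory.whiskerLeft_comp (of S (simple σ.1 σ.2))
    (show ob Y ⟶ ob Z from f) (show ob Z ⟶ ob W from g)

/-- The functor that tensors a sequence with an arbitrary object on the left. -/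
def tensorF (A : RC S) : Strand S ⥤ Strand S where
  obj Y := tail (A ⊗ ob Y)
  map {Y Z} f := A ◁ (show ob Y ⟶ ob Z from f)
  map_id Y := MonoidalCategory.whiskerLeft_id _ (ob Y)
  map_comp {Y Z W} f g := MonoidalCategory.whiskerLeft_comp A
    (show ob Y ⟶ ob Z from f) (show ob Z ⟶ ob W from g)

/-- The functors `tensorF` of a dual pair are adjoint. -/
def tensorAdj (A B : RC S) [ExactPairing A B] : tensorF B ⊣ tensorF A :=
  Adjunction.mkOfUnitCounit
    { unit :=
        { app := fun Y => expand A B (ob Y)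
          naturality := fun Y Z f => expand_naturality A B (show ob Y ⟶ ob Z from f) }
      counit :=
        { app := fun Y => contract A B (ob Y)
          naturality := fun Y Z f => contract_naturality A B (show ob Y ⟶ ob Z from f) }
      left_triangle := by
        ext Y
        exact (congrArg (fun f => _ ≫ f) (Category.id_comp (obj := RC S) _)).trans
          (expand_contract A B (ob Y))
      right_triangle := by
        ext Y
        exact (congrArg (fun f => _ ≫ f) (Category.id_comp (obj := RC S) _)).trans
          (contract_expand A B (ob Y)) }

/-- A dual pair of simple types gives adjoint functors `consF`. -/
def consAdj' (a : X) (z z' : ℤ)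
    (p : ExactPairing (of S (simple a z')) (of S (simple a z))) :
    consF S (a, z) ⊣ consF S (a, z') :=
  Adjunction.mkOfUnitCounit
    { unit :=
        { app := fun Y => expand (of S (simple a z')) (of S (simple a z)) (ob Y)
          naturality := fun Y Z f => expand_naturality _ _ (show ob Y ⟶ ob Z from f) }
      counit :=
        { app := fun Y => contract (of S (simple a z')) (of S (simple a z)) (ob Y)
          naturality := fun Y Z f => contract_naturality _ _ (show ob Y ⟶ ob Z from f) }
      left_triangle := by
        ext Y
        exact (congrArg (fun f => _ ≫ f) (Category.id_comp (obj := RC S) _)).trans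
          (expand_contract _ _ (ob Y))
      right_triangle := by
        ext Y
        exact (congrArg (fun f => _ ≫ f) (Category.id_comp (obj := RC S) _)).trans
          (contract_expand _ _ (ob Y)) }

variable (S) in
/-- The functors `consF` of simple types of consecutive degrees are adjoint. -/
def consAdj (a : X) (z z' : ℤ) (h : z' = z + 1) : consF S (a, z) ⊣ consF S (a, z') :=
  consAdj' a z z' (h ▸ simplePairing a z)

end Strand

/-! ### Adjoint sequences -/

/-- An endofunctor with all its iterated adjoints `… ⊣ E 0 ⊣ O 0 ⊣ E 1 ⊣ O 1 ⊣ …`. The functors of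
even and of odd degree are kept apart because the adjoints of odd degree reverse the order of
composition; the indices are linked by equations, to avoid transports. -/
structure AdjSeq (A : Type*) [Category A] where
  E : ℤ → A ⥤ A
  O : ℤ → A ⥤ A
  EO (j k : ℤ) (h : j = k) : E j ⊣ O k
  OE (j k : ℤ) (h : k = j + 1) : O j ⊣ E k

namespace AdjSeq

variable {A : Type*} [Category A]

variable (A) in
/-- The identity functor with its adjoints. -/
def one : AdjSeq A where
  E _ := 𝟭 A
  O _ := 𝟭 A
  EO _ _ _ := Adjunction.id
  OE _ _ _ := Adjunction.id

/-- The composite of two functors with their adjoints; `F` is applied last in even degrees. -/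
def mul (F G : AdjSeq A) : AdjSeq A where
  E k := G.E k ⋙ F.E k
  O k := F.O k ⋙ G.O k
  EO j k h := (G.EO j k h).comp (F.EO j k h)
  OE j k h := (F.OE j k h).comp (G.OE j k h)

/-- The sequence of adjoints, started at the right adjoint. -/
def right (F : AdjSeq A) : AdjSeq A where
  E k := F.O k
  O k := F.E (k + 1)
  EO j k h := F.OE j (k + 1) (h ▸ rfl)
  OE j k h := F.EO (j + 1) k h.symm

/-- The sequence of adjoints, started at the left adjoint. -/
def left (F : AdjSeq A) : AdjSeq A where
  E k := F.O (k - 1)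
  O k := F.E k
  EO j k h := F.OE (j - 1) k (by omega)
  OE j k h := F.EO j (k - 1) (by omega)

end AdjSeq

namespace Strand

variable (S) in
/-- The functors `consF` of the simple types `a⁽ᶜ⁾, a⁽ᶜ⁺¹⁾, …`. -/
def atomSeq (a : X) (c : ℤ) : AdjSeq (Strand S) where
  E k := consF S (a, 2 * k + c)
  O k := consF S (a, 2 * k + c + 1)
  EO j k h := consAdj S a _ _ (by omega)
  OE j k h := consAdj S a _ _ (by omega)

variable (S) in
/-- The functor that puts the simple types of a pregroup type in front of a sequence, with its
iterated adjoints. -/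
def typeSeq : PType X → AdjSeq (Strand S)
  | .atom a => atomSeq S a 0
  | .unit => .one _
  | .tensor t u => (typeSeq t).mul (typeSeq u)
  | .ladj t => (typeSeq t).left
  | .radj t => (typeSeq t).right

/-- Reassociation, as an isomorphism of functors. -/
def tensorFTensor (A B : RC S) : tensorF (A ⊗ B) ≅ tensorF B ⋙ tensorF A where
  hom :=
    { app := fun Y => (α_ A B (ob Y)).hom
      naturality := fun Y Z f => associator_naturality_right A B (show ob Y ⟶ ob Z from f) }
  inv :=
    { app := fun Y => (α_ A B (ob Y)).inv
      naturality := fun Y Z f => (associator_inv_naturality_right A B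
        (show ob Y ⟶ ob Z from f)) }
  hom_inv_id := by ext Y; exact (α_ A B (ob Y)).hom_inv_id
  inv_hom_id := by ext Y; exact (α_ A B (ob Y)).inv_hom_id

variable (S) in
/-- Removal of the unit, as an isomorphism of functors. -/
def tensorFUnit : tensorF (𝟙_ (RC S)) ≅ 𝟭 (Strand S) where
  hom :=
    { app := fun Y => (λ_ (ob Y)).hom
      naturality := fun Y Z f => leftUnitor_naturality (show ob Y ⟶ ob Z from f) }
  inv :=
    { app := fun Y => (λ_ (ob Y)).inv
      naturality := fun Y Z f => leftUnitor_inv_naturality (show ob Y ⟶ ob Z from f) }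
  hom_inv_id := by ext Y; exact (λ_ (ob Y)).hom_inv_id
  inv_hom_id := by ext Y; exact (λ_ (ob Y)).inv_hom_id

variable (S) in
/-- An atom as a tensor factor and as an element of a sequence. -/
def tensorFAtom (a : X) : tensorF (of S (.atom a)) ≅ consF S (a, 2 * 0 + 0) where
  hom :=
    { app := fun Y => 𝟙 ((of S (.atom a)) ⊗ ob Y)
      naturality := fun Y Z f => (Category.comp_id (obj := RC S) _).trans
        (Category.id_comp (obj := RC S) _).symm }
  inv :=
    { app := fun Y => 𝟙 ((of S (.atom a)) ⊗ ob Y)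
      naturality := fun Y Z f => (Category.comp_id (obj := RC S) _).trans
        (Category.id_comp (obj := RC S) _).symm }
  hom_inv_id := by ext Y; exact Category.id_comp (obj := RC S) _
  inv_hom_id := by ext Y; exact Category.id_comp (obj := RC S) _

variable (S) in
/-- Every type is naturally isomorphic to its sequence of simple types. For adjoints this is the
uniqueness of adjoint functors. -/
def flat : (t : PType X) → (tensorF (of S t) ≅ (typeSeq S t).E 0)
  | .atom a => tensorFAtom S a
  | .unit => tensorFUnit S
  | .tensor t u => tensorFTensor t u ≪≫ Functor.isoWhiskerRight (flat u) (tensorF (of S t)) ≪≫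
      Functor.isoWhiskerLeft ((typeSeq S u).E 0) (flat t)
  | .ladj t => Adjunction.leftAdjointUniq
      ((tensorAdj (of S t) (RC.ladj (S := S) t)).ofNatIsoRight (flat t))
      ((typeSeq S t).OE (0 - 1) 0 (by omega))
  | .radj t => Adjunction.rightAdjointUniq
      ((@tensorAdj X S (RC.radj (S := S) t) t (exactPairingRadj (S := S) t)).ofNatIsoLeft (flat t))
      ((typeSeq S t).EO 0 0 rfl)

/-- The functors `consF` on morphisms. -/
def consMap (σ : X × ℤ) {Y Z : Strand S} (f : Y ⟶ Z) : cons σ Y ⟶ cons σ Z := (consF S σ).map f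

theorem consMap_id (σ : X × ℤ) (Y : Strand S) : consMap σ (𝟙 Y) = 𝟙 (cons σ Y) :=
  (consF S σ).map_id Y

theorem consMap_comp (σ : X × ℤ) {Y Z W : Strand S} (f : Y ⟶ Z) (g : Z ⟶ W) :
    consMap σ (f ≫ g) = consMap σ f ≫ consMap σ g := (consF S σ).map_comp f g

/-- The cup of two adjoint simple types at the beginning of a sequence. -/
def cup (a : X) (z z' : ℤ) (h : z' = z + 1) (Y : Strand S) : cons (a, z) (cons (a, z') Y) ⟶ Y :=
  (consAdj S a z z' h).counit.app Y

/-- The cap of two adjoint simple types at the beginning of a sequence. -/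
def cap (a : X) (z z' : ℤ) (h : z' = z + 1) (Y : Strand S) : Y ⟶ cons (a, z') (cons (a, z) Y) :=
  (consAdj S a z z' h).unit.app Y

section

variable (a : X) (z z' : ℤ) (h : z' = z + 1)

theorem cup_naturality {Y Z : Strand S} (f : Y ⟶ Z) :
    consMap (a, z) (consMap (a, z') f) ≫ cup a z z' h Z = cup a z z' h Y ≫ f :=
  (consAdj S a z z' h).counit.naturality f

theorem cap_naturality {Y Z : Strand S} (f : Y ⟶ Z) :
    f ≫ cap a z z' h Z = cap a z z' h Y ≫ consMap (a, z') (consMap (a, z) f) :=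
  (consAdj S a z z' h).unit.naturality f

theorem cap_comp_consMap_cup (Y : Strand S) :
    cap a z z' h (cons (a, z') Y) ≫ consMap (a, z') (cup a z z' h Y) = 𝟙 _ :=
  (consAdj S a z z' h).right_triangle_components Y

theorem consMap_cap_comp_cup (Y : Strand S) :
    consMap (a, z) (cap a z z' h Y) ≫ cup a z z' h (cons (a, z) Y) = 𝟙 _ :=
  (consAdj S a z z' h).left_triangle_components Y

end

/-! ### Elementary steps -/

/-- A single cup, applied at any position to adjacent simple types whose atom satisfies `P`. The
degrees are linked by an equation, so that the sources of cups can be matched against sequences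
whose degrees are syntactically different. -/
inductive Cup (P : X → Prop) : ∀ {Y Z : Strand S}, (Y ⟶ Z) → Prop
  | head (a : X) (z z' : ℤ) (h : z' = z + 1) (Y : Strand S) : P a → Cup P (cup a z z' h Y)
  | cons (σ : X × ℤ) {Y Z : Strand S} {f : Y ⟶ Z} : Cup P f → Cup P (consMap σ f)

/-- A single cap, inserted at any position. -/
inductive Cap : ∀ {Y Z : Strand S}, (Y ⟶ Z) → Prop
  | head (a : X) (z z' : ℤ) (h : z' = z + 1) (Y : Strand S) : Cap (cap a z z' h Y)
  | cons (σ : X × ℤ) {Y Z : Strand S} {f : Y ⟶ Z} : Cap f → Cap (consMap σ f)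

/-- A generating arrow between sequences of simple types. -/
def genMor (e : S.Edge) (Y : Strand S) :
    ((typeSeq S (S.dom e)).E 0).obj Y ⟶ ((typeSeq S (S.cod e)).E 0).obj Y :=
  (flat S (S.dom e)).inv.app Y ≫
    (show (tensorF (of S (S.dom e))).obj Y ⟶ (tensorF (of S (S.cod e))).obj Y
      from homMk (.gen e) ▷ ob Y) ≫ (flat S (S.cod e)).hom.app Y

/-- The elementary steps: cups, caps and generating arrows, applied at any position. -/
inductive Step : ∀ {Y Z : Strand S}, (Y ⟶ Z) → Prop
  | cup {Y Z : Strand S} {f : Y ⟶ Z} : Cup (fun _ => True) f → Step f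
  | cap {Y Z : Strand S} {f : Y ⟶ Z} : Cap f → Step f
  | gen (e : S.Edge) (Y : Strand S) : Step (genMor e Y)
  | cons (σ : X × ℤ) {Y Z : Strand S} {f : Y ⟶ Z} : Step f → Step (consMap σ f)

/-- Composites of morphisms of a given class. -/
inductive Path (Q : ∀ {Y Z : Strand S}, (Y ⟶ Z) → Prop) : ∀ {Y Z : Strand S}, (Y ⟶ Z) → Prop
  | id (Y : Strand S) : Path Q (𝟙 Y)
  | step {Y Z W : Strand S} {f : Y ⟶ Z} {g : Z ⟶ W} : Q f → Path Q g → Path Q (f ≫ g)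

section Path

variable {Q : ∀ {Y Z : Strand S}, (Y ⟶ Z) → Prop}

theorem Path.single {Y Z : Strand S} {f : Y ⟶ Z} (h : Q f) : Path Q f := by
  simpa using Path.step h (Path.id Z)

theorem Path.comp {Y Z W : Strand S} {f : Y ⟶ Z} {g : Z ⟶ W} (hf : Path Q f) (hg : Path Q g) :
    Path Q (f ≫ g) := by
  induction hf with
  | id => simpa using hg
  | step h _ ih => simpa using Path.step h (ih hg)

theorem Path.mono {Q' : ∀ {Y Z : Strand S}, (Y ⟶ Z) → Prop}
    (h : ∀ {Y Z : Strand S} {f : Y ⟶ Z}, Q f → Q' f) {Y Z : Strand S} {f : Y ⟶ Z}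
    (hf : Path Q f) : Path Q' f := by
  induction hf with
  | id => exact .id _
  | step h' _ ih => exact .step (h h') ih

theorem Path.map (F : Strand S ⥤ Strand S)
    (h : ∀ {Y Z : Strand S} {f : Y ⟶ Z}, Q f → Q (F.map f)) {Y Z : Strand S} {f : Y ⟶ Z}
    (hf : Path Q f) : Path Q (F.map f) := by
  induction hf with
  | id => simpa using Path.id _
  | step h' _ ih => simpa using Path.step (h h') ih

/-- A class of morphisms that is stable under adding a simple type on the left is stable under the
functors of every pregroup type. -/
theorem typeSeq_map (hQ : ∀ σ {Y Z : Strand S} {f : Y ⟶ Z}, Q f → Q ((consF S σ).map f))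
    (t : PType X) (k : ℤ) :
    (∀ {Y Z : Strand S} {f : Y ⟶ Z}, Q f → Q (((typeSeq S t).E k).map f)) ∧
      ∀ {Y Z : Strand S} {f : Y ⟶ Z}, Q f → Q (((typeSeq S t).O k).map f) := by
  induction t generalizing k with
  | atom a => exact ⟨hQ _, hQ _⟩
  | unit => exact ⟨id, id⟩
  | tensor t u iht ihu => exact ⟨fun h => (iht k).1 ((ihu k).1 h), fun h => (ihu k).2 ((iht k).2 h)⟩
  | ladj t ih => exact ⟨(ih (k - 1)).2, (ih k).1⟩
  | radj t ih => exact ⟨(ih k).2, (ih (k + 1)).1⟩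

end Path

end Strand

/-- All atoms of a type satisfy `P`. -/
def _root_.PType.AllAtoms (P : X → Prop) : PType X → Prop
  | .atom a => P a
  | .unit => True
  | .tensor t u => t.AllAtoms P ∧ u.AllAtoms P
  | .ladj t => t.AllAtoms P
  | .radj t => t.AllAtoms P

namespace Strand

/-- The units of the adjunctions of a type are composites of caps. -/
theorem path_cap_unit (t : PType X) (j k : ℤ) :
    (∀ h Y, Path Cap (((typeSeq S t).EO j k h).unit.app Y)) ∧
      ∀ h Y, Path Cap (((typeSeq S t).OE j k h).unit.app Y) := by
  have hc : ∀ σ {Y Z : Strand S} {f : Y ⟶ Z}, Path Cap f → Path Cap ((consF S σ).map f) :=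
    fun σ _ _ _ h => Path.map (Q := @Cap X S) _ (Cap.cons σ) h
  induction t generalizing j k with
  | atom a => exact ⟨fun h Y => .single (.head a _ _ (by omega) _),
      fun h Y => .single (.head a _ _ (by omega) _)⟩
  | unit => exact ⟨fun h Y => .id _, fun h Y => .id _⟩
  | tensor t u iht ihu =>
    refine ⟨fun h Y => ?_, fun h Y => ?_⟩
    · rw [show ((typeSeq S (t.tensor u)).EO j k h).unit.app Y = _ from
        Adjunction.comp_unit_app _ _ _]
      exact ((ihu j k).1 h Y).comp ((typeSeq_map hc u k).2 ((iht j k).1 h _))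
    · rw [show ((typeSeq S (t.tensor u)).OE j k h).unit.app Y = _ from
        Adjunction.comp_unit_app _ _ _]
      exact ((iht j k).2 h Y).comp ((typeSeq_map hc t k).1 ((ihu j k).2 h _))
  | ladj t ih => exact ⟨fun h Y => (ih _ _).2 _ Y, fun h Y => (ih _ _).1 _ Y⟩
  | radj t ih => exact ⟨fun h Y => (ih _ _).2 _ Y, fun h Y => (ih _ _).1 _ Y⟩

/-- The counits of the adjunctions of a type are composites of cups. -/
theorem path_cup_counit {P : X → Prop} (t : PType X) (ht : t.AllAtoms P) (j k : ℤ) :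
    (∀ h Y, Path (Cup P) (((typeSeq S t).EO j k h).counit.app Y)) ∧
      ∀ h Y, Path (Cup P) (((typeSeq S t).OE j k h).counit.app Y) := by
  have hc : ∀ σ {Y Z : Strand S} {f : Y ⟶ Z}, Path (Cup P) f → Path (Cup P) ((consF S σ).map f) :=
    fun σ _ _ _ h => Path.map (Q := @Cup X S P) _ (Cup.cons σ) h
  induction t generalizing j k with
  | atom a => exact ⟨fun h Y => .single (.head a _ _ (by omega) _ ht),
      fun h Y => .single (.head a _ _ (by omega) _ ht)⟩
  | unit => exact ⟨fun h Y => .id _, fun h Y => .id _⟩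
  | tensor t u iht ihu =>
    refine ⟨fun h Y => ?_, fun h Y => ?_⟩
    · rw [show ((typeSeq S (t.tensor u)).EO j k h).counit.app Y = _ from
        Adjunction.comp_counit_app _ _ _]
      exact ((typeSeq_map hc t j).1 ((ihu ht.2 j k).1 h _)).comp ((iht ht.1 j k).1 h Y)
    · rw [show ((typeSeq S (t.tensor u)).OE j k h).counit.app Y = _ from
        Adjunction.comp_counit_app _ _ _]
      exact ((typeSeq_map hc u j).2 ((iht ht.1 j k).2 h _)).comp ((ihu ht.2 j k).2 h Y)
  | ladj t ih => exact ⟨fun h Y => (ih ht _ _).2 _ Y, fun h Y => (ih ht _ _).1 _ Y⟩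
  | radj t ih => exact ⟨fun h Y => (ih ht _ _).2 _ Y, fun h Y => (ih ht _ _).1 _ Y⟩

/-! ### Decomposition of morphisms into elementary steps -/

/-- A morphism tensored with the sequences. -/
def whisk {A B : RC S} (f : A ⟶ B) : tensorF A ⟶ tensorF B where
  app Y := f ▷ ob Y
  naturality Y Z g := whisker_exchange f (show ob Y ⟶ ob Z from g)

/-- After its source and target are replaced by sequences of simple types, the morphism is a
composite of elementary steps. -/
def Decomposes {t t' : PType X} (f : of S t ⟶ of S t') : Prop :=
  ∀ Y : Strand S, ∃ s : ((typeSeq S t).E 0).obj Y ⟶ ((typeSeq S t').E 0).obj Y,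
    Path Step s ∧ (flat S t).hom.app Y ≫ s = (whisk f).app Y ≫ (flat S t').hom.app Y

theorem decomposes_comp {t t' t'' : PType X} {f : of S t ⟶ of S t'}
    {g : of S t' ⟶ of S t''} (hf : Decomposes f) (hg : Decomposes g) :
    Decomposes (f ≫ g) := by
  intro Y
  obtain ⟨s, hs, es⟩ := hf Y
  obtain ⟨s', hs', es'⟩ := hg Y
  refine ⟨s ≫ s', hs.comp hs', ?_⟩
  rw [reassoc_of% es, es', ← Category.assoc]
  congr 1
  exact (comp_whiskerRight f g (ob Y)).symm

theorem decomposes_tensor {t t' u u' : PType X} {f : of S t ⟶ of S t'}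
    {g : of S u ⟶ of S u'} (hf : Decomposes f) (hg : Decomposes g) :
    Decomposes (t := t.tensor u) (t' := t'.tensor u') (f ⊗ₘ g) := by
  intro Y
  obtain ⟨s, hs, es⟩ := hg Y
  obtain ⟨s', hs', es'⟩ := hf (((typeSeq S u').E 0).obj Y)
  have hc : ∀ σ {Y Z : Strand S} {f : Y ⟶ Z}, Path Step f → Path Step ((consF S σ).map f) :=
    fun σ _ _ _ h => Path.map (Q := @Step X S) _ (Step.cons σ) h
  refine ⟨((typeSeq S t).E 0).map s ≫ s', ((typeSeq_map hc t 0).1 hs).comp hs', ?_⟩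
  have e : (whisk (f ⊗ₘ g)).app Y ≫ (tensorFTensor (of S t') (of S u')).hom.app Y =
      (tensorFTensor (of S t) (of S u)).hom.app Y ≫
        (tensorF (of S t)).map ((whisk g).app Y) ≫ (whisk f).app _ := by
    change (f ⊗ₘ g) ▷ ob Y ≫ (α_ _ _ _).hom = (α_ _ _ _).hom ≫ _ ◁ (g ▷ ob Y) ≫ f ▷ _
    rw [tensorHom_def']
    monoidal
  have e' := (whisk f).naturality ((flat S u').hom.app Y)
  have key : ((tensorFTensor (of S t) (of S u)).hom.app Y ≫
        (tensorF (of S t)).map ((flat S u).hom.app Y) ≫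
          (flat S t).hom.app (((typeSeq S u).E 0).obj Y)) ≫ ((typeSeq S t).E 0).map s ≫ s' =
      (whisk (f ⊗ₘ g)).app Y ≫ (tensorFTensor (of S t') (of S u')).hom.app Y ≫
        (tensorF (of S t')).map ((flat S u').hom.app Y) ≫
          (flat S t').hom.app (((typeSeq S u').E 0).obj Y) := by
    rw [reassoc_of% e, ← reassoc_of% e']
    simp only [Category.assoc]
    rw [← NatTrans.naturality_assoc, es', ← Functor.map_comp_assoc, es, Functor.map_comp_assoc]
  exact key

/-- The structural isomorphisms become identities on sequences of simple types. -/
theorem decomposes_assoc (t u v : PType X) :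
    Decomposes (t := (t.tensor u).tensor v) (t' := t.tensor (u.tensor v)) (α_ (of S t) u v).hom ∧
    Decomposes (t' := (t.tensor u).tensor v) (t := t.tensor (u.tensor v))
      (α_ (of S t) u v).inv := by
  have key (Y : Strand S) : ((tensorFTensor (of S t ⊗ of S u) (of S v)).hom.app Y ≫
        (tensorF (of S t ⊗ of S u)).map ((flat S v).hom.app Y) ≫
          (tensorFTensor (of S t) (of S u)).hom.app _ ≫
        (tensorF (of S t)).map ((flat S u).hom.app _) ≫
          (flat S t).hom.app _) =
      (whisk (α_ (of S t) u v).hom).app Y ≫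
      (tensorFTensor (of S t) (of S u ⊗ of S v)).hom.app Y ≫
        (tensorF (of S t)).map (
      (tensorFTensor (of S u) (of S v)).hom.app Y ≫
        (tensorF (of S u)).map ((flat S v).hom.app Y) ≫ (flat S u).hom.app _) ≫
          (flat S t).hom.app _ := by
    have e : (whisk (α_ (of S t) u v).hom).app Y ≫
        (tensorFTensor (of S t) (of S u ⊗ of S v)).hom.app Y ≫
        (tensorF (of S t)).map ((tensorFTensor (of S u) (of S v)).hom.app Y) =
        (tensorFTensor (of S t ⊗ of S u) (of S v)).hom.app Y ≫
         (tensorFTensor (of S t) (of S u)).hom.app ((tensorF (of S v)).obj Y) :=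
      MonoidalCategory.pentagon (of S t) u v (ob Y)
    rw [Functor.map_comp, Functor.map_comp, Category.assoc, Category.assoc, reassoc_of% e]
    have e' := (tensorFTensor (of S t) (of S u)).hom.naturality ((flat S v).hom.app Y)
    rw [reassoc_of% e']
  refine ⟨fun Y => ⟨𝟙 _, .id _, (Category.comp_id _).trans (key Y)⟩,
    fun Y => ⟨𝟙 _, .id _, (Category.comp_id _).trans ?_⟩⟩
  have e : (whisk (α_ (of S t) u v).inv).app Y ≫ (whisk (α_ (of S t) u v).hom).app Y = 𝟙 _ :=
    inv_hom_whiskerRight (α_ (of S t) u v) (ob Y)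
  exact ((congrArg (fun x => _ ≫ x) (key Y)).trans (by rw [reassoc_of% e]; rfl)).symm

theorem decomposes_leftUnitor (t : PType X) :
    Decomposes (t := PType.unit.tensor t) (λ_ (of S t)).hom ∧
    Decomposes (t' := PType.unit.tensor t) (λ_ (of S t)).inv := by
  have key (Y : Strand S) : (tensorFTensor (𝟙_ (RC S)) (of S t)).hom.app Y ≫
        (tensorF (𝟙_ (RC S))).map ((flat S t).hom.app Y) ≫
          (tensorFUnit S).hom.app _ = (whisk (λ_ (of S t)).hom).app Y ≫ (flat S t).hom.app Y := by
    have e : (tensorFTensor (𝟙_ (RC S)) (of S t)).hom.app Y ≫ (tensorFUnit S).hom.app _ =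
        (whisk (λ_ (of S t)).hom).app Y :=
      (leftUnitor_whiskerRight (of S t) (ob Y) ▸ by simp :
        (α_ (𝟙_ (RC S)) (of S t) (ob Y)).hom ≫ (λ_ (of S t ⊗ ob Y)).hom =
        (λ_ (of S t)).hom ▷ ob Y)
    rw [(tensorFUnit S).hom.naturality, reassoc_of% e]
    rfl
  refine ⟨fun Y => ⟨𝟙 _, .id _, (Category.comp_id _).trans (key Y)⟩,
    fun Y => ⟨𝟙 _, .id _, (Category.comp_id _).trans ?_⟩⟩
  have e : (whisk (λ_ (of S t)).inv).app Y ≫ (whisk (λ_ (of S t)).hom).app Y = 𝟙 _ :=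
    inv_hom_whiskerRight (λ_ (of S t)) (ob Y)
  exact ((congrArg (fun x => _ ≫ x) (key Y)).trans (by rw [reassoc_of% e])).symm

theorem decomposes_rightUnitor (t : PType X) :
    Decomposes (t := t.tensor .unit) (ρ_ (of S t)).hom ∧
    Decomposes (t' := t.tensor .unit) (ρ_ (of S t)).inv := by
  have key (Y : Strand S) : (tensorFTensor (of S t) (𝟙_ (RC S))).hom.app Y ≫
        (tensorF (of S t)).map ((tensorFUnit S).hom.app Y) ≫ (flat S t).hom.app Y =
          (whisk (ρ_ (of S t)).hom).app Y ≫ (flat S t).hom.app Y := by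
    have e : (tensorFTensor (of S t) (𝟙_ (RC S))).hom.app Y ≫
        (tensorF (of S t)).map ((tensorFUnit S).hom.app Y) =
        (whisk (ρ_ (of S t)).hom).app Y :=
      MonoidalCategory.triangle (of S t) (ob Y)
    rw [reassoc_of% e]
  refine ⟨fun Y => ⟨𝟙 _, .id _, (Category.comp_id _).trans (key Y)⟩,
    fun Y => ⟨𝟙 _, .id _, (Category.comp_id _).trans ?_⟩⟩
  have e : (whisk (ρ_ (of S t)).inv).app Y ≫ (whisk (ρ_ (of S t)).hom).app Y = 𝟙 _ :=
    inv_hom_whiskerRight (ρ_ (of S t)) (ob Y)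
  exact ((congrArg (fun x => _ ≫ x) (key Y)).trans (by rw [reassoc_of% e])).symm

theorem allAtoms_true (t : PType X) : t.AllAtoms (fun _ => True) := by
  induction t with
  | atom | unit => trivial
  | tensor _ _ h h' => exact ⟨h, h'⟩
  | ladj _ h => exact h
  | radj _ h => exact h

/-- The counit of the adjunction of the functors `tensorF` is the cup. -/
theorem tensorAdj_counit (A B : RC S) [ExactPairing A B] (Y : Strand S) :
    (tensorFTensor B A).hom.app Y ≫ (tensorAdj A B).counit.app Y =
      (whisk (ε_ A B)).app Y ≫ (tensorFUnit S).hom.app Y := by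
  change (α_ B A (ob Y)).hom ≫ (α_ B A (ob Y)).inv ≫ _ = _
  rw [Iso.hom_inv_id_assoc]
  rfl

/-- The unit of the adjunction of the functors `tensorF` is the cap. -/
theorem tensorAdj_unit (A B : RC S) [ExactPairing A B] (Y : Strand S) :
    (tensorFUnit S).hom.app Y ≫ (tensorAdj A B).unit.app Y =
      (whisk (η_ A B)).app Y ≫ (tensorFTensor A B).hom.app Y := by
  exact Iso.hom_inv_id_assoc (λ_ (ob Y)) (η_ A B ▷ ob Y ≫ (α_ A B (ob Y)).hom)

/-- The cup of a type becomes a counit of the adjunctions of its sequence of simple types, since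
`flat` is defined on adjoints by the uniqueness of adjoint functors. -/
theorem decomposes_cupL (t : PType X) :
    Decomposes (t := t.ladj.tensor t) (t' := .unit) (homMk (S := S) (.cupL t)) := by
  intro Y
  refine ⟨((typeSeq S t).OE (0 - 1) 0 (by omega)).counit.app Y,
    ((path_cup_counit t (allAtoms_true t) _ _).2 _ Y).mono .cup, ?_⟩
  have h := Adjunction.leftAdjointUniq_hom_app_counit
    ((tensorAdj (of S t) (RC.ladj (S := S) t)).ofNatIsoRight (flat S t))
    ((typeSeq S t).OE (0 - 1) 0 (by omega)) Y
  have e := tensorAdj_counit (of S t) (RC.ladj (S := S) t) Y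
  refine Eq.trans ?_ e
  refine (Category.assoc _ _ _).trans (congrArg (fun x => _ ≫ x) ?_)
  refine (Category.assoc _ _ _).trans ((congrArg (fun x => _ ≫ x) h).trans ?_)
  have h' : (tensorF (RC.ladj (S := S) t)).map ((flat S t).hom.app Y) ≫
      ((tensorAdj (of S t) (RC.ladj (S := S) t)).ofNatIsoRight (flat S t)).counit.app Y =
        (tensorAdj (of S t) (RC.ladj (S := S) t)).counit.app Y := by
    simp [← Functor.map_comp_assoc]
  exact h'

theorem decomposes_capL (t : PType X) :
    Decomposes (t := .unit) (t' := t.tensor t.ladj) (homMk (S := S) (.capL t)) := by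
  intro Y
  refine ⟨((typeSeq S t).OE (0 - 1) 0 (by omega)).unit.app Y,
    ((path_cap_unit t _ _).2 _ Y).mono .cap, ?_⟩
  have h := Adjunction.unit_leftAdjointUniq_hom_app
    ((tensorAdj (of S t) (RC.ladj (S := S) t)).ofNatIsoRight (flat S t))
    ((typeSeq S t).OE (0 - 1) 0 (by omega)) Y
  have e := tensorAdj_unit (of S t) (RC.ladj (S := S) t) Y
  have key : (tensorFUnit S).hom.app Y ≫ ((typeSeq S t).OE (0 - 1) 0 (by omega)).unit.app Y =
      (whisk (η_ (of S t) (RC.ladj (S := S) t))).app Y ≫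
        (tensorFTensor (of S t) (RC.ladj (S := S) t)).hom.app Y ≫
          (tensorF (of S t)).map ((flat S t.ladj).hom.app Y) ≫ (flat S t).hom.app _ := by
    rw [← h, ← reassoc_of% e]
    simp only [Adjunction.ofNatIsoRight_unit, NatTrans.comp_app, Functor.whiskerLeft_app,
      Category.assoc]
    congr 2
    exact ((flat S t).hom.naturality _).symm
  exact key

theorem decomposes_cupR (t : PType X) :
    Decomposes (t := t.tensor t.radj) (t' := .unit) (homMk (S := S) (.cupR t)) := by
  intro Y
  refine ⟨((typeSeq S t).EO 0 0 rfl).counit.app Y,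
    ((path_cup_counit t (allAtoms_true t) _ _).1 _ Y).mono .cup, ?_⟩
  let p := exactPairingRadj (S := S) t
  have h := Adjunction.rightAdjointUniq_hom_app_counit
    ((@tensorAdj X S (RC.radj (S := S) t) t p).ofNatIsoLeft (flat S t))
    ((typeSeq S t).EO 0 0 rfl) Y
  have e := @tensorAdj_counit X S (RC.radj (S := S) t) (of S t) p Y
  have key : ((tensorFTensor (of S t) (RC.radj (S := S) t)).hom.app Y ≫
        (tensorF (of S t)).map ((flat S t.radj).hom.app Y) ≫ (flat S t).hom.app _) ≫
        ((typeSeq S t).EO 0 0 rfl).counit.app Y =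
      (whisk (@ExactPairing.evaluation _ _ _ (RC.radj (S := S) t) (of S t) p)).app Y ≫
        (tensorFUnit S).hom.app Y := by
    have e' := (flat S t).hom.naturality ((flat S t.radj).hom.app Y)
    have h' : (flat S t).hom.app ((tensorF (RC.radj (S := S) t)).obj Y) ≫
        (flat S t).inv.app ((tensorF (RC.radj (S := S) t)).obj Y) ≫
          (@tensorAdj X S (RC.radj (S := S) t) t p).counit.app Y =
        (@tensorAdj X S (RC.radj (S := S) t) t p).counit.app Y := by
      rw [← Category.assoc, Iso.hom_inv_id_app, Category.id_comp]
    refine (Category.assoc _ _ _).trans (Eq.trans (congrArg (fun x => _ ≫ x) ?_) e)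
    exact (congrArg (fun x => x ≫ ((typeSeq S t).EO 0 0 rfl).counit.app Y) e').trans
      ((Category.assoc _ _ _).trans ((congrArg (fun x => _ ≫ x) h).trans h'))
  exact key

theorem decomposes_capR (t : PType X) :
    Decomposes (t := .unit) (t' := t.radj.tensor t) (homMk (S := S) (.capR t)) := by
  intro Y
  refine ⟨((typeSeq S t).EO 0 0 rfl).unit.app Y, ((path_cap_unit t _ _).1 _ Y).mono .cap, ?_⟩
  let p := exactPairingRadj (S := S) t
  have h := Adjunction.unit_rightAdjointUniq_hom_app
    ((@tensorAdj X S (RC.radj (S := S) t) t p).ofNatIsoLeft (flat S t))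
    ((typeSeq S t).EO 0 0 rfl) Y
  have e := @tensorAdj_unit X S (RC.radj (S := S) t) (of S t) p Y
  have key : (tensorFUnit S).hom.app Y ≫ ((typeSeq S t).EO 0 0 rfl).unit.app Y =
      (whisk (@ExactPairing.coevaluation _ _ _ (RC.radj (S := S) t) (of S t) p)).app Y ≫
        (tensorFTensor (RC.radj (S := S) t) (of S t)).hom.app Y ≫
          (tensorF (RC.radj (S := S) t)).map ((flat S t).hom.app Y) ≫
            (flat S t.radj).hom.app _ := by
    rw [← h, ← reassoc_of% e]
    simp only [Adjunction.ofNatIsoLeft_unit, NatTrans.comp_app, Functor.whiskerRight_app,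
      Category.assoc]
    rfl
  exact key

theorem decomposes_gen (e : S.Edge) : Decomposes (homMk (S := S) (.gen e)) := by
  intro Y
  refine ⟨genMor e Y, .single (.gen e Y), ?_⟩
  have h : (flat S (S.dom e)).hom.app Y ≫ (flat S (S.dom e)).inv.app Y = 𝟙 _ := by simp
  exact (reassoc_of% h) _

/-- Every morphism is a composite of elementary steps, once its source and target are replaced by
sequences of simple types. -/
theorem decomposes {t t' : PType X} (f : Hom S t t') : Decomposes (homMk f) := by
  induction f with
  | gen e => exact decomposes_gen e
  | id t =>
    refine fun Y => ⟨𝟙 _, .id _, ?_⟩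
    have h : (whisk (𝟙 (of S t))).app Y = 𝟙 _ := id_whiskerRight (of S t) (ob Y)
    exact (Category.comp_id _).trans
      ((congrArg (fun x => x ≫ (flat S t).hom.app Y) h).trans (Category.id_comp _)).symm
  | comp f g hf hg => exact decomposes_comp hf hg
  | tensor f g hf hg => exact decomposes_tensor hf hg
  | α_hom t u v => exact (decomposes_assoc t u v).1
  | α_inv t u v => exact (decomposes_assoc t u v).2
  | l_hom t => exact (decomposes_leftUnitor t).1
  | l_inv t => exact (decomposes_leftUnitor t).2
  | ρ_hom t => exact (decomposes_rightUnitor t).1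
  | ρ_inv t => exact (decomposes_rightUnitor t).2
  | cupL t => exact decomposes_cupL t
  | capL t => exact decomposes_capL t
  | cupR t => exact decomposes_cupR t
  | capR t => exact decomposes_capR t

end Strand

/-! ### Mates -/

/-- A transformation between two functors with all its iterated mates. It is covariant in even
degrees and contravariant in odd degrees. In string diagrams, a mate is the transformation with its
inputs and outputs bent around by caps and cups. -/
structure Mates {A : Type*} [Category A] (F G : AdjSeq A) where
  φ (k : ℤ) : F.E k ⟶ G.E k
  ψ (k : ℤ) : G.O k ⟶ F.O k
  EO (j k : ℤ) (h : j = k) : conjugateEquiv (G.EO j k h) (F.EO j k h) (φ j) = ψ k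
  OE (j k : ℤ) (h : k = j + 1) : conjugateEquiv (F.OE j k h) (G.OE j k h) (ψ j) = φ k

namespace Mates

variable {A : Type*} [Category A] {F G : AdjSeq A}

/-- The iterated mates in the degrees `2 * n`, for a transformation given in degree `0`. -/
def evenNat (α : F.E 0 ⟶ G.E 0) : (n : ℕ) → (F.E n ⟶ G.E n)
  | 0 => α
  | n + 1 =>
      conjugateEquiv (F.OE n (n + 1 : ℕ) rfl) (G.OE n (n + 1 : ℕ) rfl)
        (conjugateEquiv (G.EO n n rfl) (F.EO n n rfl) (evenNat α n))

/-- The iterated mates in the degrees `-2 * (n + 1)`. -/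
def evenNeg (α : F.E 0 ⟶ G.E 0) : (n : ℕ) → (F.E (.negSucc n) ⟶ G.E (.negSucc n))
  | 0 =>
      (conjugateEquiv (G.EO (.negSucc 0) (.negSucc 0) rfl)
        (F.EO (.negSucc 0) (.negSucc 0) rfl)).symm
        ((conjugateEquiv (F.OE (.negSucc 0) 0 rfl) (G.OE (.negSucc 0) 0 rfl)).symm α)
  | n + 1 =>
      (conjugateEquiv (G.EO (.negSucc (n + 1)) (.negSucc (n + 1)) rfl)
        (F.EO (.negSucc (n + 1)) (.negSucc (n + 1)) rfl)).symm
        ((conjugateEquiv (F.OE (.negSucc (n + 1)) (.negSucc n) rfl)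
          (G.OE (.negSucc (n + 1)) (.negSucc n) rfl)).symm (evenNeg α n))

/-- The iterated mates in even degrees. -/
def even (α : F.E 0 ⟶ G.E 0) : (k : ℤ) → (F.E k ⟶ G.E k)
  | .ofNat n => evenNat α n
  | .negSucc n => evenNeg α n

/-- All iterated mates of a transformation. -/
def ofEven (α : F.E 0 ⟶ G.E 0) : Mates F G where
  φ := even α
  ψ k := conjugateEquiv (G.EO k k rfl) (F.EO k k rfl) (even α k)
  EO j k h := by subst h; rfl
  OE j k h := by
    subst h
    match j with
    | .ofNat n => rfl
    | .negSucc 0 =>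
      exact (congrArg (conjugateEquiv (F.OE (.negSucc 0) 0 rfl) (G.OE (.negSucc 0) 0 rfl))
        (Equiv.apply_symm_apply _ _)).trans (Equiv.apply_symm_apply _ _)
    | .negSucc (n + 1) =>
      exact (congrArg (conjugateEquiv (F.OE (.negSucc (n + 1)) (.negSucc n) rfl)
        (G.OE (.negSucc (n + 1)) (.negSucc n) rfl))
        (Equiv.apply_symm_apply _ _)).trans (Equiv.apply_symm_apply _ _)

/-- All iterated mates of a transformation given in degree `1`. -/
def ofOdd (β : G.O 0 ⟶ F.O 0) : Mates F G :=
  ofEven ((conjugateEquiv (G.EO 0 0 rfl) (F.EO 0 0 rfl)).symm β)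

theorem ofOdd_ψ (β : G.O 0 ⟶ F.O 0) : (ofOdd β).ψ 0 = β :=
  Equiv.apply_symm_apply _ _

variable (M : Mates F G)

theorem unit_EO (j k : ℤ) (h : j = k) (Y : A) :
    (F.EO j k h).unit.app Y ≫ (F.O k).map ((M.φ j).app Y) =
      (G.EO j k h).unit.app Y ≫ (M.ψ k).app ((G.E j).obj Y) := by
  rw [← M.EO j k h]
  exact (unit_conjugateEquiv _ _ _ _).symm

theorem counit_EO (j k : ℤ) (h : j = k) (Y : A) :
    (F.E j).map ((M.ψ k).app Y) ≫ (F.EO j k h).counit.app Y =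
      (M.φ j).app ((G.O k).obj Y) ≫ (G.EO j k h).counit.app Y := by
  rw [← M.EO j k h]
  exact conjugateEquiv_counit _ _ _ _

theorem unit_OE (j k : ℤ) (h : k = j + 1) (Y : A) :
    (F.OE j k h).unit.app Y ≫ (M.φ k).app ((F.O j).obj Y) =
      (G.OE j k h).unit.app Y ≫ (G.E k).map ((M.ψ j).app Y) := by
  rw [← M.OE j k h]
  exact unit_conjugateEquiv _ _ _ _

theorem counit_OE (j k : ℤ) (h : k = j + 1) (Y : A) :
    (M.ψ j).app ((F.E k).obj Y) ≫ (F.OE j k h).counit.app Y =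
      (G.O j).map ((M.φ k).app Y) ≫ (G.OE j k h).counit.app Y := by
  rw [← M.OE j k h]
  exact (conjugateEquiv_counit _ _ _ _).symm

end Mates

variable (S) in
/-- A rule `aᶜ ⟶ t` in the free rigid category, with its mates: it emits the simple types of the
adjoints of `t` from `aᶜ, aᶜ⁺², …`, and collapses them to `aᶜ⁺¹, aᶜ⁺³, …`. -/
structure Rule where
  a : X
  c : ℤ
  t : PType X
  mates : Mates (Strand.atomSeq S a c) (Strand.typeSeq S t)

namespace Strand

/-- The identity morphisms. -/
inductive IsId : ∀ {Y Z : Strand S}, (Y ⟶ Z) → Prop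
  | mk (Y : Strand S) : IsId (𝟙 Y)

theorem IsId.map {Y Z : Strand S} {f : Y ⟶ Z} (h : IsId f) (F : Strand S ⥤ Strand S) :
    IsId (F.map f) := by
  cases h
  simpa using IsId.mk _

variable {R : Type*} (ρ : R → Rule S)

/-- The emission `a⁽²ᵏ⁺ᶜ⁾ ⟶ t⁽²ᵏ⁾` at the beginning of a sequence. -/
def _root_.RC.Rule.emit (r : Rule S) (k : ℤ) (Y : Strand S) :
    cons (r.a, 2 * k + r.c) Y ⟶ ((typeSeq S r.t).E k).obj Y := (r.mates.φ k).app Y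

/-- The collapse `t⁽²ᵏ⁺¹⁾ ⟶ a⁽²ᵏ⁺ᶜ⁺¹⁾` at the beginning of a sequence. -/
def _root_.RC.Rule.col (r : Rule S) (k : ℤ) (Y : Strand S) :
    ((typeSeq S r.t).O k).obj Y ⟶ cons (r.a, 2 * k + r.c + 1) Y := (r.mates.ψ k).app Y

/-- A single emission, applied at any position. -/
inductive Emit : ∀ {Y Z : Strand S}, (Y ⟶ Z) → Prop
  | head (r : R) (k : ℤ) (Y : Strand S) : Emit ((ρ r).emit k Y)
  | cons (σ : X × ℤ) {Y Z : Strand S} {f : Y ⟶ Z} : Emit f → Emit (consMap σ f)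

/-- A single collapse, applied at any position. -/
inductive Col : ∀ {Y Z : Strand S}, (Y ⟶ Z) → Prop
  | head (r : R) (k : ℤ) (Y : Strand S) : Col ((ρ r).col k Y)
  | cons (σ : X × ℤ) {Y Z : Strand S} {f : Y ⟶ Z} : Col f → Col (consMap σ f)

section

variable (r : Rule S)

theorem _root_.RC.Rule.emit_naturality (k : ℤ) {Y Z : Strand S} (f : Y ⟶ Z) :
    consMap (r.a, 2 * k + r.c) f ≫ r.emit k Z = r.emit k Y ≫ ((typeSeq S r.t).E k).map f :=
  (r.mates.φ k).naturality f

theorem _root_.RC.Rule.col_naturality (k : ℤ) {Y Z : Strand S} (f : Y ⟶ Z) :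
    ((typeSeq S r.t).O k).map f ≫ r.col k Z = r.col k Y ≫ consMap (r.a, 2 * k + r.c + 1) f :=
  (r.mates.ψ k).naturality f

/-- An emission at the right end of a cap slides to a collapse at its left end. -/
theorem _root_.RC.Rule.cap_emit_right (k : ℤ) (h : 2 * k + r.c + 1 = 2 * k + r.c + 1)
    (Y : Strand S) :
    cap r.a _ _ h Y ≫ consMap (r.a, 2 * k + r.c + 1) (r.emit k Y) =
      ((typeSeq S r.t).EO k k rfl).unit.app Y ≫ r.col k _ :=
  r.mates.unit_EO k k rfl Y

/-- A collapse at the right end of a cup slides to an emission at its left end. -/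
theorem _root_.RC.Rule.cup_col_right (k : ℤ) (h : 2 * k + r.c + 1 = 2 * k + r.c + 1)
    (Y : Strand S) :
    consMap (r.a, 2 * k + r.c) (r.col k Y) ≫ cup r.a _ _ h Y =
      r.emit k _ ≫ ((typeSeq S r.t).EO k k rfl).counit.app Y :=
  r.mates.counit_EO k k rfl Y

/-- An emission at the left end of a cap slides to a collapse at its right end. -/
theorem _root_.RC.Rule.cap_emit_left (k : ℤ) (h : 2 * (k + 1) + r.c = 2 * k + r.c + 1 + 1)
    (Y : Strand S) :
    cap r.a _ _ h Y ≫ r.emit (k + 1) _ =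
      ((typeSeq S r.t).OE k (k + 1) rfl).unit.app Y ≫
        ((typeSeq S r.t).E (k + 1)).map (r.col k Y) :=
  r.mates.unit_OE k (k + 1) rfl Y

/-- A collapse at the left end of a cup slides to an emission at its right end. -/
theorem _root_.RC.Rule.cup_col_left (k : ℤ) (h : 2 * (k + 1) + r.c = 2 * k + r.c + 1 + 1)
    (Y : Strand S) :
    r.col k _ ≫ cup r.a _ _ h Y =
      ((typeSeq S r.t).O k).map (r.emit (k + 1) Y) ≫
        ((typeSeq S r.t).OE k (k + 1) rfl).counit.app Y :=
  r.mates.counit_OE k (k + 1) rfl Y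

end

/-! ### Interchange of elementary steps -/

variable {P : X → Prop}

/-- A cap followed by a cup is an identity, by a snake equation, or they can be interchanged. -/
theorem cap_cup {Y Y' Z : Strand S} {c : Y ⟶ Y'} {u : Y' ⟶ Z} (hc : Cap c) (hu : Cup P u) :
    IsId (c ≫ u) ∨ ∃ (W : Strand S) (u' : Y ⟶ W) (c' : W ⟶ Z), Cup P u' ∧ Cap c' ∧
      c ≫ u = u' ≫ c' := by
  induction hc generalizing Z with
  | head a z z' h Y =>
    cases hu with
    | head _ _ _ h' => omega
    | @cons _ _ Z f hu =>
      cases hu with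
      | head _ _ z'' h' _ _ =>
        obtain rfl : z'' = z' := h'.trans h.symm
        rw [cap_comp_consMap_cup]
        exact .inl (.mk _)
      | @cons _ _ Z f hu =>
        exact .inr ⟨_, f, _, hu, .head a z z' h Z, (cap_naturality a z z' h f).symm⟩
  | @cons σ Y Y' c hc ih =>
    cases hu with
    | head a z z' h Y' ha =>
      cases hc with
      | head _ z'' _ h' Y' =>
        obtain rfl : z'' = z := by omega
        rw [consMap_cap_comp_cup]
        exact .inl (.mk _)
      | @cons _ Y' _ c hc =>
        exact .inr ⟨_, _, c, .head a z z' h _ ha, hc, cup_naturality a z z' h c⟩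
    | @cons _ _ Z u hu =>
      rw [← consMap_comp]
      obtain h | ⟨W, u', c', hu', hc', e⟩ := ih hu
      · exact .inl (h.map _)
      · exact .inr ⟨_, _, _, hu'.cons σ, hc'.cons σ, by rw [e, consMap_comp]⟩

/-- A cup followed by an emission can be interchanged. -/
theorem cup_emit {Y Y' Z : Strand S} {u : Y ⟶ Y'} {e : Y' ⟶ Z} (hu : Cup P u) (he : Emit ρ e) :
    ∃ (W : Strand S) (e' : Y ⟶ W) (u' : W ⟶ Z), Emit ρ e' ∧ Cup P u' ∧ u ≫ e = e' ≫ u' := by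
  induction hu generalizing Z with
  | head a z z' h Y ha =>
    exact ⟨_, _, _, (he.cons _).cons _, .head a z z' h _ ha, (cup_naturality a z z' h e).symm⟩
  | @cons σ Y Y' u hu ih =>
    cases he with
    | head r k =>
      exact ⟨_, _, _, .head r k _, (typeSeq_map (Q := @Cup X S P) Cup.cons _ k).1 hu,
        (ρ r).emit_naturality k u⟩
    | @cons _ _ Z e he =>
      obtain ⟨W, e', u', he', hu', h⟩ := ih he
      exact ⟨_, _, _, he'.cons σ, hu'.cons σ, by rw [← consMap_comp, h, consMap_comp]⟩

/-- A collapse followed by a cap can be interchanged. -/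
theorem col_cap {Y Y' Z : Strand S} {k : Y ⟶ Y'} {c : Y' ⟶ Z} (hk : Col ρ k) (hc : Cap c) :
    ∃ (W : Strand S) (c' : Y ⟶ W) (k' : W ⟶ Z), Cap c' ∧ Col ρ k' ∧ k ≫ c = c' ≫ k' := by
  induction hk generalizing Z with
  | head r k Y =>
    cases hc with
    | head a z z' h => exact ⟨_, _, _, .head a z z' h _, (Col.head r k Y).cons _ |>.cons _,
        cap_naturality a z z' h _⟩
    | @cons _ _ Z c hc =>
      exact ⟨_, _, _, (typeSeq_map (Q := @Cap X S) Cap.cons _ k).2 hc, .head r k _,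
        ((ρ r).col_naturality k c).symm⟩
  | @cons σ Y Y' k hk ih =>
    cases hc with
    | head a z z' h => exact ⟨_, _, _, .head a z z' h _, ((hk.cons σ).cons _).cons _,
        cap_naturality a z z' h _⟩
    | @cons _ _ Z c hc =>
      obtain ⟨W, c', k', hc', hk', h⟩ := ih hc
      exact ⟨_, _, _, hc'.cons σ, hk'.cons σ, by rw [← consMap_comp, h, consMap_comp]⟩

/-- The parity of the simple types that a rule emits from depends on the atom only. -/
def Coherent : Prop := ∀ r r', (ρ r).a = (ρ r').a → (ρ r).c = (ρ r').c

variable {ρ}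

/-- An emission that is not possible in the first place is applied further to the right. The
conclusion is an elimination principle, because the target of the emission is not known. -/
theorem Emit.of_ne {σ : X × ℤ} {Y Z : Strand S} {e : Strand.cons σ Y ⟶ Z} (he : Emit ρ e)
    (h : ∀ r k, σ ≠ ((ρ r).a, 2 * k + (ρ r).c)) {Q : ∀ {Z : Strand S}, (Strand.cons σ Y ⟶ Z) → Prop}
    (hQ : ∀ {Z : Strand S} (e : Y ⟶ Z), Emit ρ e → Q (Strand.consMap σ e)) : Q e := by
  cases he with
  | head r k => exact absurd rfl (h r k)
  | cons _ he => exact hQ _ he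

/-- A collapse followed by an emission can be interchanged. -/
theorem col_emit (hρ : Coherent ρ) {Y Y' Z : Strand S} {k : Y ⟶ Y'} {e : Y' ⟶ Z} (hk : Col ρ k)
    (he : Emit ρ e) :
    ∃ (W : Strand S) (e' : Y ⟶ W) (k' : W ⟶ Z), Emit ρ e' ∧ Col ρ k' ∧ k ≫ e = e' ≫ k' := by
  induction hk generalizing Z with
  | head r k Y =>
    refine he.of_ne (Q := fun {Z} e => ∃ (W : Strand S) (e' : ((typeSeq S (ρ r).t).O k).obj Y ⟶ W)
      (k' : W ⟶ Z), Emit ρ e' ∧ Col ρ k' ∧ (ρ r).col k Y ≫ e = e' ≫ k')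
      (fun r' k' h => ?_) (fun e he => ?_)
    -- The collapsed simple type has the parity of `c + 1`, the emitting one has the parity of `c`.
    · obtain ⟨ha, hz⟩ := Prod.mk.inj h
      have := hρ _ _ ha
      omega
    · exact ⟨_, _, _, (typeSeq_map (Q := @Emit X S R ρ) Emit.cons _ k).2 he, .head r k _,
        ((ρ r).col_naturality k e).symm⟩
  | @cons σ Y Y' k hk ih =>
    cases he with
    | head r j =>
      exact ⟨_, _, _, .head r j _, (typeSeq_map (Q := @Col X S R ρ) Col.cons _ j).1 hk,
        (ρ r).emit_naturality j k⟩
    | @cons _ _ Z e he =>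
      obtain ⟨W, c', k', hc', hk', h⟩ := ih he
      exact ⟨_, _, _, hc'.cons σ, hk'.cons σ, by rw [← consMap_comp, h, consMap_comp]⟩

theorem Path.consMap {Q : ∀ {Y Z : Strand S}, (Y ⟶ Z) → Prop}
    (hQ : ∀ σ {Y Z : Strand S} {f : Y ⟶ Z}, Q f → Q (Strand.consMap σ f)) (σ : X × ℤ)
    {Y Z : Strand S} {f : Y ⟶ Z} (hf : Path Q f) : Path Q (Strand.consMap σ f) :=
  Path.map (Q := @Q) (consF S σ) (hQ σ) hf

variable (ρ) in
/-- A cap followed by an emission can be interchanged, unless the emission takes place at one of the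
two ends of the cap; then it can be moved to a collapse at the other end. -/
theorem cap_emit {Y Y' Z : Strand S} {c : Y ⟶ Y'} {e : Y' ⟶ Z} (hc : Cap c) (he : Emit ρ e) :
    (∃ (W : Strand S) (e' : Y ⟶ W) (c' : W ⟶ Z), Emit ρ e' ∧ Cap c' ∧ c ≫ e = e' ≫ c') ∨
      ∃ (W : Strand S) (c' : Y ⟶ W) (k : W ⟶ Z), Path Cap c' ∧ Col ρ k ∧ c ≫ e = c' ≫ k := by
  induction hc generalizing Z with
  | head a z z' h Y =>
    cases he with
    | head r k =>
      obtain ⟨j, rfl⟩ : ∃ j, k = j + 1 := ⟨k - 1, by omega⟩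
      obtain rfl : z = 2 * j + (ρ r).c + 1 := by omega
      exact .inr ⟨_, _, _, (path_cap_unit _ j (j + 1)).2 rfl _,
        (typeSeq_map (Q := @Col X S R ρ) Col.cons _ (j + 1)).1 (.head r j _),
        (ρ r).cap_emit_left j h Y⟩
    | @cons _ _ Z e he =>
      cases he with
      | head r k =>
        subst h
        exact .inr ⟨_, _, _, (path_cap_unit _ k k).1 rfl _, .head r k _,
          (ρ r).cap_emit_right k rfl Y⟩
      | @cons _ _ Z e he =>
        exact .inl ⟨_, _, _, he, .head a z z' h _, (cap_naturality a z z' h e).symm⟩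
  | @cons σ Y Y' c hc ih =>
    cases he with
    | head r k =>
      exact .inl ⟨_, _, _, .head r k _, (typeSeq_map (Q := @Cap X S) Cap.cons _ k).1 hc,
        (ρ r).emit_naturality k c⟩
    | @cons _ _ Z e he =>
      rw [← Strand.consMap_comp]
      obtain ⟨W, e', c', he', hc', h⟩ | ⟨W, c', k, hc', hk, h⟩ := ih he
      · exact .inl ⟨_, _, _, he'.cons σ, hc'.cons σ, by rw [h, consMap_comp]⟩
      · exact .inr ⟨_, _, _, Path.consMap (Q := @Cap X S) Cap.cons σ hc', hk.cons σ,
          by rw [h, consMap_comp]⟩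

variable (ρ) in
/-- An ordinary atom: no rule emits from it or collapses to it. -/
def Ordinary (a : X) : Prop := ∀ r, a ≠ (ρ r).a

/-- A collapse followed by a cup can be interchanged, unless the cup takes place at the collapsed
simple type; then it can be replaced by an emission at the other end and ordinary cups. -/
theorem col_cup (hO : ∀ r, (ρ r).t.AllAtoms (Ordinary ρ)) {Y Y' Z : Strand S} {k : Y ⟶ Y'}
    {u : Y' ⟶ Z} (hk : Col ρ k) (hu : Cup P u) :
    (∃ (W : Strand S) (u' : Y ⟶ W) (k' : W ⟶ Z), Cup P u' ∧ Col ρ k' ∧ k ≫ u = u' ≫ k') ∨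
      (∃ r, P (ρ r).a) ∧ ∃ (W : Strand S) (e : Y ⟶ W) (u' : W ⟶ Z), Emit ρ e ∧
        Path (Cup (Ordinary ρ)) u' ∧ k ≫ u = e ≫ u' := by
  induction hk generalizing Z with
  | head r k Y =>
    cases hu with
    | head _ _ z' h _ ha =>
      obtain rfl : z' = 2 * (k + 1) + (ρ r).c := by omega
      exact .inr ⟨⟨r, ha⟩, _, _, _, (typeSeq_map (Q := @Emit X S R ρ) Emit.cons _ k).2
        (.head r (k + 1) _), (path_cup_counit _ (hO r) k (k + 1)).2 rfl _,
        (ρ r).cup_col_left k h _⟩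
    | @cons _ _ Z u hu =>
      exact .inl ⟨_, _, _, (typeSeq_map (Q := @Cup X S P) Cup.cons _ k).2 hu, .head r k _,
        ((ρ r).col_naturality k u).symm⟩
  | @cons σ Y Y' k hk ih =>
    cases hu with
    | head a z z' h Y' ha =>
      cases hk with
      | head r k =>
        obtain rfl : z = 2 * k + (ρ r).c := by omega
        exact .inr ⟨⟨r, ha⟩, _, _, _, .head r k _, (path_cup_counit _ (hO r) k k).1 rfl _,
          (ρ r).cup_col_right k h _⟩
      | @cons _ Y' _ k hk =>
        exact .inl ⟨_, _, _, .head a z z' h _ ha, hk, cup_naturality a z z' h k⟩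
    | @cons _ _ Z u hu =>
      rw [← Strand.consMap_comp]
      obtain ⟨W, u', k', hu', hk', h⟩ | ⟨hr, W, e, u', he, hu', h⟩ := ih hu
      · exact .inl ⟨_, _, _, hu'.cons σ, hk'.cons σ, by rw [h, consMap_comp]⟩
      · exact .inr ⟨hr, _, _, _, he.cons σ,
          Path.consMap (Q := @Cup X S (Ordinary ρ)) Cup.cons σ hu', by rw [h, consMap_comp]⟩

/-! ### Normal forms -/

variable {A : Strand S}

/-- The morphisms that consist of a morphism in `D`, followed by caps. -/
inductive CapForm (D : ∀ {Y : Strand S}, (A ⟶ Y) → Prop) : ∀ {Y : Strand S}, (A ⟶ Y) → Prop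
  | base {Y : Strand S} {g : A ⟶ Y} : D g → CapForm D g
  | cap {Y Z : Strand S} {g : A ⟶ Y} {c : Y ⟶ Z} : CapForm D g → Cap c → CapForm D (g ≫ c)

variable (ρ) in
/-- The morphisms that consist of a morphism in `D`, followed by caps, followed by collapses. -/
inductive NormalForm (D : ∀ {Y : Strand S}, (A ⟶ Y) → Prop) : ∀ {Y : Strand S}, (A ⟶ Y) → Prop
  | base {Y : Strand S} {g : A ⟶ Y} : CapForm D g → NormalForm D g
  | col {Y Z : Strand S} {g : A ⟶ Y} {k : Y ⟶ Z} : NormalForm D g → Col ρ k → NormalForm D (g ≫ k)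

variable {D : ∀ {Y : Strand S}, (A ⟶ Y) → Prop}

theorem CapForm.comp_isId {Y Z : Strand S} {g : A ⟶ Y} {f : Y ⟶ Z} (hg : CapForm D g)
    (hf : IsId f) : CapForm D (g ≫ f) := by
  cases hf
  simpa using hg

theorem CapForm.comp_path_cap {Y Z : Strand S} {g : A ⟶ Y} {c : Y ⟶ Z} (hg : CapForm D g)
    (hc : Path Cap c) : CapForm D (g ≫ c) := by
  induction hc with
  | id => simpa using hg
  | step h _ ih => simpa using ih (hg.cap h)

theorem CapForm.comp_cup
    (hD : ∀ {Y Z : Strand S} {g : A ⟶ Y} {u : Y ⟶ Z}, D g → Cup P u → D (g ≫ u))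
    {Y Z : Strand S} {g : A ⟶ Y} {u : Y ⟶ Z} (hg : CapForm D g) (hu : Cup P u) :
    CapForm D (g ≫ u) := by
  induction hg generalizing Z with
  | base hg => exact .base (hD hg hu)
  | cap hg hc ih =>
    rw [Category.assoc]
    obtain h | ⟨W, u', c', hu', hc', e⟩ := cap_cup hc hu
    · exact hg.comp_isId h
    · rw [e, ← Category.assoc]
      exact (ih hu').cap hc'

theorem NormalForm.comp_cap {Y Z : Strand S} {g : A ⟶ Y} {c : Y ⟶ Z} (hg : NormalForm ρ D g)
    (hc : Cap c) : NormalForm ρ D (g ≫ c) := by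
  induction hg generalizing Z with
  | base hg => exact .base (hg.cap hc)
  | col hg hk ih =>
    obtain ⟨W, c', k', hc', hk', e⟩ := col_cap ρ hk hc
    rw [Category.assoc, e, ← Category.assoc]
    exact (ih hc').col hk'

theorem CapForm.comp_emit
    (hD : ∀ {Y Z : Strand S} {g : A ⟶ Y} {e : Y ⟶ Z}, D g → Emit ρ e → D (g ≫ e))
    {Y Z : Strand S} {g : A ⟶ Y} {e : Y ⟶ Z} (hg : CapForm D g) (he : Emit ρ e) :
    NormalForm ρ D (g ≫ e) := by
  induction hg generalizing Z with
  | base hg => exact .base (.base (hD hg he))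
  | cap hg hc ih =>
    rw [Category.assoc]
    obtain ⟨W, e', c', he', hc', h⟩ | ⟨W, c', k, hc', hk, h⟩ := cap_emit ρ hc he
    · rw [h, ← Category.assoc]
      exact (ih he').comp_cap hc'
    · rw [h, ← Category.assoc]
      exact .col (.base (hg.comp_path_cap hc')) hk

theorem NormalForm.comp_emit (hρ : Coherent ρ)
    (hD : ∀ {Y Z : Strand S} {g : A ⟶ Y} {e : Y ⟶ Z}, D g → Emit ρ e → D (g ≫ e))
    {Y Z : Strand S} {g : A ⟶ Y} {e : Y ⟶ Z} (hg : NormalForm ρ D g) (he : Emit ρ e) :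
    NormalForm ρ D (g ≫ e) := by
  induction hg generalizing Z with
  | base hg => exact hg.comp_emit hD he
  | col hg hk ih =>
    obtain ⟨W, e', k', he', hk', h⟩ := col_emit hρ hk he
    rw [Category.assoc, h, ← Category.assoc]
    exact (ih he').col hk'

theorem Cup.mono {P' : X → Prop} (h : ∀ a, P a → P' a) {Y Z : Strand S} {u : Y ⟶ Z}
    (hu : Cup P u) : Cup P' u := by
  induction hu with
  | head a z z' h' Y ha => exact .head a z z' h' Y (h a ha)
  | cons σ _ ih => exact ih.cons σ

/-- Ordinary cups never meet a collapsed simple type, so they can be moved in front of all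
collapses, and then in front of the caps, unless they cancel with them. -/
theorem NormalForm.comp_path_cup_ordinary (hO : ∀ r, (ρ r).t.AllAtoms (Ordinary ρ))
    (hD : ∀ {Y Z : Strand S} {g : A ⟶ Y} {u : Y ⟶ Z}, D g → Cup (fun _ => True) u → D (g ≫ u))
    {Y Z : Strand S} {g : A ⟶ Y} {u : Y ⟶ Z} (hg : NormalForm ρ D g)
    (hu : Path (Cup (Ordinary ρ)) u) : NormalForm ρ D (g ≫ u) := by
  have key {Y Z : Strand S} {g : A ⟶ Y} {u : Y ⟶ Z} (hg : NormalForm ρ D g)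
      (hu : Cup (Ordinary ρ) u) : NormalForm ρ D (g ≫ u) := by
    induction hg generalizing Z with
    | base hg =>
      exact .base (hg.comp_cup (P := Ordinary ρ)
        (fun h h' => hD h (h'.mono fun _ _ => trivial)) hu)
    | col hg hk ih =>
      obtain ⟨W, u', k', hu', hk', h⟩ | ⟨⟨r, hr⟩, -⟩ := col_cup hO hk hu
      · rw [Category.assoc, h, ← Category.assoc]
        exact (ih hu').col hk'
      · exact absurd rfl (hr r)
  induction hu with
  | id => simpa using hg
  | step h _ ih => simpa using ih (key hg h)

/-- A cup at a collapsed simple type turns the collapse into an emission followed by ordinary cups;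
both are absorbed by the normal form in front of the collapse. This is why the atoms that occur in
the rules' types must be ordinary. -/
theorem NormalForm.comp_cup (hρ : Coherent ρ) (hO : ∀ r, (ρ r).t.AllAtoms (Ordinary ρ))
    (hE : ∀ {Y Z : Strand S} {g : A ⟶ Y} {e : Y ⟶ Z}, D g → Emit ρ e → D (g ≫ e))
    (hD : ∀ {Y Z : Strand S} {g : A ⟶ Y} {u : Y ⟶ Z}, D g → Cup (fun _ => True) u → D (g ≫ u))
    {Y Z : Strand S} {g : A ⟶ Y} {u : Y ⟶ Z} (hg : NormalForm ρ D g)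
    (hu : Cup (fun _ => True) u) : NormalForm ρ D (g ≫ u) := by
  induction hg generalizing Z with
  | base hg => exact .base (hg.comp_cup hD hu)
  | col hg hk ih =>
    obtain ⟨W, u', k', hu', hk', h⟩ | ⟨-, W, e, u', he, hu', h⟩ := col_cup hO hk hu
    · rw [Category.assoc, h, ← Category.assoc]
      exact (ih hu').col hk'
    · rw [Category.assoc, h, ← Category.assoc]
      exact (hg.comp_emit hρ hE he).comp_path_cup_ordinary hO hD hu'

/-- Every composite of elementary steps has a normal form, if every generating arrow is an emission
or a collapse. -/
theorem NormalForm.comp_path (hρ : Coherent ρ) (hO : ∀ r, (ρ r).t.AllAtoms (Ordinary ρ))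
    (hS : ∀ (e : S.Edge) (Y : Strand S), Emit ρ (genMor e Y) ∨ Col ρ (genMor e Y))
    (hE : ∀ {Y Z : Strand S} {g : A ⟶ Y} {e : Y ⟶ Z}, D g → Emit ρ e → D (g ≫ e))
    (hD : ∀ {Y Z : Strand S} {g : A ⟶ Y} {u : Y ⟶ Z}, D g → Cup (fun _ => True) u → D (g ≫ u))
    {Y Z : Strand S} {g : A ⟶ Y} {f : Y ⟶ Z} (hg : NormalForm ρ D g) (hf : Path Step f) :
    NormalForm ρ D (g ≫ f) := by
  have hstep {Y Z : Strand S} {f : Y ⟶ Z} (hf : Step f) :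
      Cup (fun _ => True) f ∨ Cap f ∨ Emit ρ f ∨ Col ρ f := by
    induction hf with
    | cup h => exact .inl h
    | cap h => exact .inr (.inl h)
    | gen e Y => exact .inr (.inr (hS e Y))
    | cons σ _ ih => exact ih.imp (·.cons σ) (Or.imp (·.cons σ) (Or.imp (·.cons σ) (·.cons σ)))
  induction hf with
  | id => simpa using hg
  | step h _ ih =>
    rw [← Category.assoc]
    obtain h | h | h | h := hstep h
    · exact ih (hg.comp_cup hρ hO hE hD h)
    · exact ih (hg.comp_cap h)
    · exact ih (hg.comp_emit hρ hE h)
    · exact ih (hg.col h)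

end Strand
end RC

/-! ### Pregroup grammars as systems of rules -/

namespace RC.Strand

variable {X : Type u} {S : RigidSignature.{u, w} X}

/-- A generating arrow, as a natural transformation. -/
def genTrans (e : S.Edge) : (typeSeq S (S.dom e)).E 0 ⟶ (typeSeq S (S.cod e)).E 0 :=
  (flat S (S.dom e)).inv ≫ whisk (homMk (.gen e)) ≫ (flat S (S.cod e)).hom

/-- A transformation of `a⁽⁰⁾`, regarded as the right adjoint of `aˡ`. -/
def oddTrans {a b : X} (f : (typeSeq S (.atom a)).E 0 ⟶ (typeSeq S (.atom b)).E 0) :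
    (typeSeq S (.ladj (.atom a))).O 0 ⟶ (atomSeq S b (-1)).O 0 := f

theorem Path.cup_emit {R : Type*} {ρ : R → Rule S} {P : X → Prop} {Y Y' Z : Strand S} {u : Y ⟶ Y'}
    {e : Y' ⟶ Z} (hu : Path (Cup P) u) (he : Emit ρ e) :
    ∃ (W : Strand S) (e' : Y ⟶ W) (u' : W ⟶ Z), Emit ρ e' ∧ Path (Cup P) u' ∧
      u ≫ e = e' ≫ u' := by
  induction hu with
  | id => exact ⟨_, e, 𝟙 _, he, .id _, by simp⟩
  | step h _ ih =>
    obtain ⟨W, e', u', he', hu', h'⟩ := ih he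
    obtain ⟨W', e'', u'', he'', hu'', h''⟩ := Strand.cup_emit ρ h he'
    exact ⟨W', e'', u'' ≫ u', he'', .step hu'' hu',
      by rw [Category.assoc, h', ← Category.assoc, h'', Category.assoc]⟩

/-- An emission in a sequence that begins with the simple types of a type with ordinary atoms takes
place further to the right. As in `Emit.of_ne`, this is stated as an elimination principle. -/
theorem Emit.typeSeq_inv {R : Type*} {ρ : R → Rule S} (t : PType X)
    (ht : t.AllAtoms (Ordinary ρ)) (k : ℤ) (Y : Strand S) :
    (∀ Q : (∀ {Z : Strand S}, (((typeSeq S t).E k).obj Y ⟶ Z) → Prop),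
      (∀ {Z : Strand S} (e : Y ⟶ Z), Emit ρ e → Q (((typeSeq S t).E k).map e)) →
        ∀ {Z : Strand S} {e : ((typeSeq S t).E k).obj Y ⟶ Z}, Emit ρ e → Q e) ∧
    (∀ Q : (∀ {Z : Strand S}, (((typeSeq S t).O k).obj Y ⟶ Z) → Prop),
      (∀ {Z : Strand S} (e : Y ⟶ Z), Emit ρ e → Q (((typeSeq S t).O k).map e)) →
        ∀ {Z : Strand S} {e : ((typeSeq S t).O k).obj Y ⟶ Z}, Emit ρ e → Q e) := by
  induction t generalizing k Y with
  | atom a =>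
    exact ⟨fun Q hQ _ e he => he.of_ne (Q := @Q) (fun r j h => ht r (congrArg Prod.fst h)) hQ,
      fun Q hQ _ e he => he.of_ne (Q := @Q) (fun r j h => ht r (congrArg Prod.fst h)) hQ⟩
  | unit => exact ⟨fun Q hQ _ e he => hQ e he, fun Q hQ _ e he => hQ e he⟩
  | tensor t u iht ihu =>
    refine ⟨fun Q hQ _ e he => ?_, fun Q hQ _ e he => ?_⟩
    · exact (iht ht.1 k _).1 @Q (fun e he => (ihu ht.2 k _).1
        (fun e => Q (((typeSeq S t).E k).map e)) hQ he) he
    · exact (ihu ht.2 k _).2 @Q (fun e he => (iht ht.1 k _).2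
        (fun e => Q (((typeSeq S u).O k).map e)) hQ he) he
  | ladj t ih => exact ⟨(ih ht _ _).2, (ih ht _ _).1⟩
  | radj t ih => exact ⟨(ih ht _ _).2, (ih ht _ _).1⟩

/-- The simple types of a sequence. -/
def list : Strand S → List (X × ℤ)
  | tail _ => []
  | cons σ Y => σ :: list Y

theorem Cup.list {P : X → Prop} {Y Z : Strand S} {u : Y ⟶ Z} (hu : Cup P u) :
    ∃ l l' a z, Y.list = l ++ (a, z) :: (a, z + 1) :: l' ∧ Z.list = l ++ l' := by
  induction hu with
  | head a z z' h Y => exact ⟨[], Y.list, a, z, by simp [Strand.list, h], rfl⟩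
  | cons σ _ ih =>
    obtain ⟨l, l', a, z, h, h'⟩ := ih
    exact ⟨σ :: l, l', a, z, by simp [Strand.list, h], by simp [Strand.list, h']⟩

theorem mem_list_typeSeq {P : X → Prop} (t : PType X) (ht : t.AllAtoms P) (k : ℤ) (Y : Strand S)
    (σ : X × ℤ) :
    (σ ∈ (((typeSeq S t).E k).obj Y).list → P σ.1 ∨ σ ∈ Y.list) ∧
      (σ ∈ (((typeSeq S t).O k).obj Y).list → P σ.1 ∨ σ ∈ Y.list) := by
  induction t generalizing k Y with
  | atom a =>
    constructor <;> intro h <;> obtain rfl | h := List.mem_cons.1 h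
    exacts [.inl ht, .inr h, .inl ht, .inr h]
  | unit => exact ⟨.inr, .inr⟩
  | tensor t u iht ihu =>
    exact ⟨fun h => ((iht ht.1 _ _).1 h).elim .inl (ihu ht.2 _ _).1,
      fun h => ((ihu ht.2 _ _).2 h).elim .inl (iht ht.1 _ _).2⟩
  | ladj t ih => exact ⟨(ih ht _ _).2, (ih ht _ _).1⟩
  | radj t ih => exact ⟨(ih ht _ _).2, (ih ht _ _).1⟩

theorem list_subset_typeSeq (t : PType X) (k : ℤ) (Y : Strand S) :
    Y.list ⊆ (((typeSeq S t).E k).obj Y).list ∧ Y.list ⊆ (((typeSeq S t).O k).obj Y).list := by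
  induction t generalizing k Y with
  | atom a => exact ⟨List.subset_cons_self _ _, List.subset_cons_self _ _⟩
  | unit => exact ⟨List.Subset.refl _, List.Subset.refl _⟩
  | tensor t u iht ihu =>
    exact ⟨List.Subset.trans (ihu k Y).1 (iht k _).1, List.Subset.trans (iht k Y).2 (ihu k _).2⟩
  | ladj t ih => exact ⟨(ih _ _).2, (ih _ _).1⟩
  | radj t ih => exact ⟨(ih _ _).2, (ih _ _).1⟩

end RC.Strand

namespace PregroupGrammar

open RC RC.Strand

variable {V : Type u} {B : Type v} (P : PregroupGrammar V B)

/-- The lexical entries and the induced steps as rules. An induced step `x ⟶ y` is a collapse of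
`x`, regarded as the right adjoint of `xˡ`, so that its emissions take place in odd degrees. -/
def rules : P.lexicon ⊕ P.induced → Rule P.signature
  | .inl e => ⟨.inr e.1.1, 0, e.1.2.map .inl, .ofEven (genTrans (S := P.signature) (.inl e))⟩
  | .inr e => ⟨.inl e.1.2, -1, .ladj (.atom (.inl e.1.1)),
      .ofOdd (oddTrans (genTrans (S := P.signature) (.inr e)))⟩

theorem rules_col (e : P.induced) (Y : Strand P.signature) :
    (P.rules (.inr e)).col 0 Y = genMor (S := P.signature) (.inr e) Y :=
  congrArg (fun f => NatTrans.app f Y)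
    (Mates.ofOdd_ψ (oddTrans (genTrans (S := P.signature) (.inr e))))

/-- The sentence type is not used in the lexicon, and all induced steps end in it. It follows that
all atoms in the lexicon and all sources of induced steps are ordinary. -/
structure Terminal : Prop where
  lexicon : ∀ e ∈ P.lexicon, e.2.AllAtoms (· ≠ P.sentence)
  induced : ∀ e ∈ P.induced, e.1 ≠ P.sentence ∧ e.2 = P.sentence

theorem _root_.PType.allAtoms_map {X Y : Type*} {p : X → Prop} {q : Y → Prop} {f : X → Y}
    (h : ∀ a, p a → q (f a)) (t : PType X) (ht : t.AllAtoms p) : (t.map f).AllAtoms q := by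
  induction t with
  | atom a => exact h a ht
  | unit => exact trivial
  | tensor t u iht ihu => exact ⟨iht ht.1, ihu ht.2⟩
  | ladj t ih => exact ih ht
  | radj t ih => exact ih ht

theorem rules_coherent : Coherent P.rules := by
  rintro (e | e) (e' | e') h
  · rfl
  · exact absurd h (by simp [rules])
  · exact absurd h (by simp [rules])
  · rfl

variable {P}

theorem Terminal.ordinary_inl (hP : P.Terminal) (b : B) (hb : b ≠ P.sentence) :
    Ordinary P.rules (.inl b) := by
  rintro (e | e)
  · simp [rules]
  · have := (hP.induced _ e.2).2
    simpa [rules, this] using hb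

theorem Terminal.allAtoms_lexicon (hP : P.Terminal) (e : P.lexicon) :
    (e.1.2.map (Sum.inl (β := V))).AllAtoms (Ordinary P.rules) :=
  PType.allAtoms_map hP.ordinary_inl _ (hP.lexicon _ e.2)

theorem Terminal.allAtoms (hP : P.Terminal) (r : P.lexicon ⊕ P.induced) :
    (P.rules r).t.AllAtoms (Ordinary P.rules) := by
  obtain e | e := r
  · exact hP.allAtoms_lexicon e
  · exact hP.ordinary_inl _ (hP.induced _ e.2).1

theorem genMor_emit_or_col (e : P.signature.Edge) (Y : Strand P.signature) :
    Emit P.rules (genMor e Y) ∨ Col P.rules (genMor e Y) := by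
  obtain e | e := e
  · exact .inl (Emit.head (ρ := P.rules) (.inl e) 0 Y)
  · refine .inr ?_
    rw [← rules_col]
    exact Col.head (ρ := P.rules) (.inr e) 0 Y

/-! ### Reductions in normal form -/

variable (P) in
/-- The application of lexical entries to some of the words of a string, from right to left. -/
inductive PartialLex : ∀ {Y Z : Strand P.signature}, (Y ⟶ Z) → Prop
  | nil (A : P.Cat) : PartialLex (𝟙 (tail A))
  -- The equation for `σ` avoids dependent elimination on the degree.
  | word (a : V) (σ : (B ⊕ V) × ℤ) (hσ : σ = (.inr a, 0)) {Y Z : Strand P.signature} {f : Y ⟶ Z} :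
      PartialLex f → PartialLex (consMap σ f)
  | entry (e : P.lexicon) {Y Z : Strand P.signature} {f : Y ⟶ Z} :
      PartialLex f → PartialLex (consMap ((P.rules (.inl e)).a, 2 * 0 + (P.rules (.inl e)).c) f ≫
        (P.rules (.inl e)).emit 0 Z)

/-- An emission can only be the lexical entry of a word that is still present. -/
theorem PartialLex.comp_emit (hP : P.Terminal) {Y Z W : Strand P.signature} {f : Y ⟶ Z} {e : Z ⟶ W}
    (hf : PartialLex P f) (he : Emit P.rules e) : PartialLex P (f ≫ e) := by
  induction hf generalizing W with
  | nil => cases he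
  | @word a σ hσ Y Z f hf ih =>
    cases he with
    | head r k =>
      obtain r | r := r
      · obtain rfl : k = 0 := by
          have := congrArg Prod.snd hσ
          simp only [rules] at this
          omega
        exact .entry r hf
      · exact absurd (congrArg Prod.fst hσ) (by simp [rules])
    | cons _ he =>
      rw [← consMap_comp]
      exact .word a σ hσ (ih he)
  | @entry r Y Z f hf ih =>
    refine (Emit.typeSeq_inv (S := P.signature) _ (hP.allAtoms_lexicon r) 0 Z).1
      (fun {W} e => PartialLex P ((consMap _ f ≫ (P.rules (.inl r)).emit 0 Z) ≫ e))
      (fun e he => ?_) he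
    have := (P.rules (.inl r)).emit_naturality 0 e
    have h := PartialLex.entry r (ih he)
    rw [consMap_comp, Category.assoc, this, ← Category.assoc] at h
    exact h

theorem _root_.RC.Strand.Path.cup_mem {X : Type u} {S : RigidSignature.{u, w} X} {p : X → Prop}
    {Y Z : Strand S} {u : Y ⟶ Z} (hu : Path (Cup p) u) {σ : X × ℤ} (hσ : σ ∈ Z.list) :
    σ ∈ Y.list := by
  induction hu with
  | id => exact hσ
  | step h _ ih =>
    obtain ⟨l, l', a, z, e, e'⟩ := h.list
    have := ih hσ
    rw [e'] at this
    rw [e]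
    simp only [List.mem_append, List.mem_cons] at this ⊢
    tauto

/-- A simple type of degree `0` whose atom has no other adjoint in the sequence is not removed by
cups. -/
theorem _root_.RC.Strand.Path.cup_mem_of_isolated {X : Type u} {S : RigidSignature.{u, w} X}
    {p : X → Prop} {Y Z : Strand S} {u : Y ⟶ Z} (hu : Path (Cup p) u) {a : X}
    (ha : ∀ z, (a, z) ∈ Y.list → z = 0) (h : (a, 0) ∈ Y.list) : (a, 0) ∈ Z.list := by
  induction hu with
  | id => exact h
  | @step Y Z _ f _ h' _ ih =>
    obtain ⟨l, l', b, z, e, e'⟩ := h'.list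
    refine ih (fun z hz => ha z ((Path.single (Q := @Cup X S p) h').cup_mem hz)) ?_
    rw [e] at h ha
    rw [e']
    have hne : a ≠ b := by
      rintro rfl
      have h1 := ha z (by simp)
      have h2 := ha (z + 1) (by simp)
      omega
    simpa [hne] using h

/-- Words occur without adjoints. -/
theorem PartialLex.degree (hP : P.Terminal) {Y Z : Strand P.signature} {f : Y ⟶ Z}
    (hf : PartialLex P f) (a : V) (z : ℤ) (h : (.inr a, z) ∈ Z.list) : z = 0 := by
  induction hf with
  | nil => simp [Strand.list] at h
  | word a σ hσ _ ih =>
    obtain h | h := List.mem_cons.1 h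
    · rw [hσ] at h
      exact congrArg Prod.snd h
    · exact ih h
  | @entry e Y Z f _ ih =>
    obtain h | h := (mem_list_typeSeq (S := P.signature) _ (PType.allAtoms_map
      (q := fun c => ∀ a, c ≠ .inr a) (fun b (_ : b ≠ P.sentence) => by simp) _
        (hP.lexicon _ e.2)) 0 Z _).1 h
    · exact absurd rfl (h a)
    · exact ih h

theorem PartialLex.sentence_notMem (hP : P.Terminal) {Y Z : Strand P.signature} {f : Y ⟶ Z}
    (hf : PartialLex P f) (z : ℤ) : (.inl P.sentence, z) ∉ Z.list := by
  induction hf with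
  | nil => simp [Strand.list]
  | word a σ hσ _ ih =>
    intro h
    obtain h | h := List.mem_cons.1 h
    · rw [hσ] at h
      simp at h
    · exact ih h
  | @entry e Y Z f _ ih =>
    intro h
    obtain h | h := (mem_list_typeSeq (S := P.signature) _ (PType.allAtoms_map
      (q := fun c => c ≠ .inl P.sentence) (fun b (hb : b ≠ P.sentence) => by simpa using hb) _
        (hP.lexicon _ e.2)) 0 Z _).1 h
    · exact h rfl
    · exact ih h

/-- The morphisms that consist of lexical entries, followed by cups. -/
def LexCups {A Y : Strand P.signature} (g : A ⟶ Y) : Prop :=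
  ∃ (Z : Strand P.signature) (f : A ⟶ Z) (u : Z ⟶ Y),
    PartialLex P f ∧ Path (Cup fun _ => True) u ∧ g = f ≫ u

theorem LexCups.sentence_notMem (hP : P.Terminal) {A Y : Strand P.signature} {g : A ⟶ Y}
    (hg : LexCups g) (z : ℤ) : (.inl P.sentence, z) ∉ Y.list := by
  obtain ⟨Z, f, u, hf, hu, -⟩ := hg
  exact fun h => hf.sentence_notMem hP z (hu.cup_mem h)

theorem LexCups.comp_cup {A Y Z : Strand P.signature} {g : A ⟶ Y} {u : Y ⟶ Z}
    (hg : LexCups g) (hu : Cup (fun _ => True) u) : LexCups (g ≫ u) := by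
  obtain ⟨W, f, u', hf, hu', rfl⟩ := hg
  exact ⟨W, f, u' ≫ u, hf, hu'.comp (.single hu), by simp⟩

theorem LexCups.comp_emit (hP : P.Terminal) {A Y Z : Strand P.signature} {g : A ⟶ Y} {e : Y ⟶ Z}
    (hg : LexCups g) (he : Emit P.rules e) : LexCups (g ≫ e) := by
  obtain ⟨W, f, u, hf, hu, rfl⟩ := hg
  obtain ⟨W', e', u', he', hu', h⟩ := hu.cup_emit he
  exact ⟨W', f ≫ e', u', hf.comp_emit hP he', hu', by simp [h]⟩

/-- No caps are left in the normal form of a morphism to a single simple type. -/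
theorem lexCups_of_capForm {A : Strand P.signature} {σ : (B ⊕ V) × ℤ} {C : P.Cat}
    {g : A ⟶ cons σ (tail C)} (hg : CapForm (LexCups (P := P)) g) : LexCups g := by
  generalize hY : cons σ (tail C) = Y at g
  cases hg with
  | base h => exact h
  | cap _ hc =>
    cases hc with
    | head => cases hY
    | cons σ' hc =>
      cases hY
      cases hc

/-- A morphism to a basic type other than the sentence type ends neither with a collapse nor with a
cap. -/
theorem normalForm_source (hP : P.Terminal) {A : Strand P.signature} {σ : (B ⊕ V) × ℤ} {C : P.Cat}
    (b : B) (hb : b ≠ P.sentence) (hσ : σ.1 = .inl b)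
    {g : A ⟶ cons σ (tail C)} (hg : NormalForm P.rules (LexCups (P := P)) g) : LexCups g := by
  generalize hY : cons σ (tail C) = Y at g
  cases hg with
  | base h =>
    subst hY
    exact lexCups_of_capForm h
  | col _ hk =>
    cases hk with
    | head r k =>
      cases hY
      exact absurd hσ.symm (hP.ordinary_inl b hb r)
    | cons _ hk =>
      cases hY
      cases hk

/-- The last step of the normal form of a morphism to the sentence type is an induced step. -/
theorem normalForm_sentence (hP : P.Terminal) {A : Strand P.signature} {σ : (B ⊕ V) × ℤ}
    {C : P.Cat} (hσ : σ = (.inl P.sentence, 0))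
    {g : A ⟶ cons σ (tail C)} (hg : NormalForm P.rules (LexCups (P := P)) g)
    (Q : ∀ {Y : Strand P.signature}, (A ⟶ Y) → Prop)
    (hQ : ∀ (x : B) (h : (x, P.sentence) ∈ P.induced)
      (g : A ⟶ ((typeSeq P.signature (.atom (.inl x))).E 0).obj (tail C)), LexCups g →
        Q (g ≫ genMor (S := P.signature) (.inr ⟨(x, P.sentence), h⟩) (tail C))) : Q g := by
  generalize hY : cons σ (tail C) = Y at g
  cases hg with
  | base h =>
    subst hY
    refine absurd ?_ ((lexCups_of_capForm h).sentence_notMem hP 0)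
    rw [hσ]
    exact List.mem_cons_self
  | @col _ _ g k hg hk =>
    cases hk with
    | head r k =>
      obtain r | ⟨⟨x, y⟩, r⟩ := r
      · cases hY
        exact absurd (congrArg Prod.fst hσ) (by simp [rules])
      · cases hY
        obtain rfl : k = 0 := by
          have := congrArg Prod.snd hσ
          simp only [rules] at this
          omega
        obtain ⟨hx, rfl : y = P.sentence⟩ := hP.induced _ r
        have := hQ x r g (normalForm_source hP x hx rfl hg)
        rw [← rules_col] at this
        exact this
    | cons _ hk =>
      cases hY
      cases hk

variable {ι : Type} (w : ι → V)

variable (P) in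
/-- The string of words at a list of positions. -/
def words (js : List ι) : Strand P.signature :=
  ((typeSeq P.signature (.tensorList (js.map fun j => .atom (.inr (w j))))).E 0).obj
    (tail (𝟙_ P.Cat))

variable (P) in
/-- The lexical entries of the word at a position. -/
abbrev Entry (j : ι) : Type v := {t : PType B // (w j, t) ∈ P.lexicon}

variable {w}

/-- The simple types of the lexical entries chosen for a list of positions. -/
def entries : ∀ js : List ι, (∀ j ∈ js, P.Entry w j) → Strand P.signature
  | [], _ => tail (𝟙_ P.Cat)
  | j :: js, t => ((typeSeq P.signature ((t j List.mem_cons_self).1.map .inl)).E 0).obj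
      (entries js fun i hi => t i (List.mem_cons_of_mem j hi))

/-- The application of the lexical entries chosen for a list of positions. -/
def applyEntries : ∀ (js : List ι) (t : ∀ j ∈ js, P.Entry w j), P.words w js ⟶ entries js t
  | [], _ => 𝟙 (tail (𝟙_ P.Cat))
  | j :: js, t =>
      consMap (.inr (w j), 2 * 0 + 0)
          (applyEntries js fun i hi => t i (List.mem_cons_of_mem j hi)) ≫
        genMor (S := P.signature) (.inl ⟨(w j, (t j List.mem_cons_self).1),
          (t j List.mem_cons_self).2⟩) (entries js fun i hi => t i (List.mem_cons_of_mem j hi))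

theorem partialLex_id (js : List ι) : PartialLex P (𝟙 (P.words w js)) := by
  induction js with
  | nil => exact .nil _
  | cons j js ih => exact cast (congrArg _ (consMap_id _ _)) (PartialLex.word (w j) _ rfl ih)

/-- If no word is left, then a lexical entry has been applied to every word. The equation between
morphisms is one of dependent pairs, because the targets agree only after the entries are found. -/
theorem PartialLex.word_notMem {Y Z : Strand P.signature} {f : Y ⟶ Z} (hf : PartialLex P f)
    (js : List ι) (hjs : js.Nodup) (hY : Y = P.words w js) (hZ : ∀ a, (.inr a, 0) ∉ Z.list) :
    ∃ t : ∀ j ∈ js, P.Entry w j,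
      (⟨Y, Z, f⟩ : Σ Y Z : Strand P.signature, Y ⟶ Z) = ⟨_, _, applyEntries js t⟩ := by
  induction hf generalizing js with
  | nil A =>
    cases js with
    | nil =>
      cases hY
      exact ⟨fun _ h => absurd h (List.not_mem_nil), rfl⟩
    | cons => cases hY
  | word a σ hσ _ _ => exact absurd (hσ ▸ List.mem_cons_self) (hZ a)
  | @entry e Y Z f hf ih =>
    cases js with
    | nil => cases hY
    | cons j js =>
      obtain ⟨h1, h2⟩ := Strand.cons.inj hY
      obtain ⟨⟨a, t₀⟩, ht₀⟩ := e
      obtain rfl : a = w j := Sum.inr_injective (congrArg Prod.fst h1)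
      obtain ⟨hj, hjs⟩ := List.nodup_cons.1 hjs
      obtain ⟨t, ht⟩ := ih js hjs h2 fun a ha => hZ a ((list_subset_typeSeq _ _ _).1 ha)
      classical
      obtain ⟨t', h', rfl⟩ : ∃ t' : ∀ i ∈ j :: js, P.Entry w i,
          t' j List.mem_cons_self = ⟨t₀, ht₀⟩ ∧
            (fun i hi => t' i (List.mem_cons_of_mem j hi)) = t := by
        refine ⟨fun i hi => if h : i = j then h ▸ ⟨t₀, ht₀⟩ else
          t i ((List.mem_cons.1 hi).resolve_left h), by simp, ?_⟩
        funext i hi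
        have : i ≠ j := fun h => hj (h ▸ hi)
        simp [this]
      obtain rfl : (t' j List.mem_cons_self).1 = t₀ := congrArg Subtype.val h'
      refine ⟨t', ?_⟩
      have := congrArg (fun f : Σ Y Z : Strand P.signature, Y ⟶ Z =>
        (⟨cons (.inr (w j), 2 * 0 + 0) f.1, _, consMap (.inr (w j), 2 * 0 + 0) f.2.2 ≫
          genMor (S := P.signature) (.inl ⟨(w j, (t' j List.mem_cons_self).1),
          (t' j List.mem_cons_self).2⟩) f.2.1⟩ : Σ Y Z : Strand P.signature, Y ⟶ Z)) ht
      exact this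

/-- Every composite of elementary steps from a string to the sentence type consists of lexical
entries for all words, followed by cups and one induced step. -/
theorem exists_normalForm (hP : P.Terminal) (js : List ι) (hjs : js.Nodup)
    (f : P.words w js ⟶ ((typeSeq P.signature (.atom (.inl P.sentence))).E 0).obj (tail (𝟙_ P.Cat)))
    (hf : Path Step f) :
    ∃ (t : ∀ j ∈ js, P.Entry w j) (x : B) (h : (x, P.sentence) ∈ P.induced)
      (u : entries js t ⟶ ((typeSeq P.signature (.atom (.inl x))).E 0).obj (tail (𝟙_ P.Cat))),
      Path (Cup fun _ => True) u ∧ f = applyEntries js t ≫ u ≫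
        genMor (S := P.signature) (.inr ⟨(x, P.sentence), h⟩) (tail (𝟙_ P.Cat)) := by
  have h := NormalForm.comp_path (ρ := P.rules) (D := LexCups (P := P)) P.rules_coherent hP.allAtoms
    genMor_emit_or_col (fun h h' => h.comp_emit hP h') (fun h h' => h.comp_cup h')
    (.base (.base ⟨_, _, _, partialLex_id (P := P) (w := w) js, .id _,
      (Category.comp_id _).symm⟩)) hf
  rw [Category.id_comp] at h
  suffices H : ∀ (σ : (B ⊕ V) × ℤ), σ = (.inl P.sentence, 0) →
      ∀ f : P.words w js ⟶ cons σ (tail (𝟙_ P.Cat)), NormalForm P.rules (LexCups (P := P)) f →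
      ∃ (t : ∀ j ∈ js, P.Entry w j) (x : B) (h : (x, P.sentence) ∈ P.induced)
      (u : entries js t ⟶ ((typeSeq P.signature (.atom (.inl x))).E 0).obj (tail (𝟙_ P.Cat))),
      Path (Cup fun _ => True) u ∧ HEq f (applyEntries js t ≫ u ≫
        genMor (S := P.signature) (.inr ⟨(x, P.sentence), h⟩) (tail (𝟙_ P.Cat))) by
    obtain ⟨t, x, h, u, hu, e⟩ := H _ rfl f h
    exact ⟨t, x, h, u, hu, eq_of_heq e⟩
  intro σ hσ f hf
  refine normalForm_sentence hP hσ hf (fun {Y} f => ∃ (t : ∀ j ∈ js, P.Entry w j) (x : B)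
      (h : (x, P.sentence) ∈ P.induced)
      (u : entries js t ⟶ ((typeSeq P.signature (.atom (.inl x))).E 0).obj (tail (𝟙_ P.Cat))),
      Path (Cup fun _ => True) u ∧ HEq f (applyEntries js t ≫ u ≫
        genMor (S := P.signature) (.inr ⟨(x, P.sentence), h⟩) (tail (𝟙_ P.Cat)))) ?_
  rintro x h g ⟨Z, f, u, hf, hu, rfl⟩
  have hZ (a : V) : (.inr a, 0) ∉ Z.list := by
    intro ha
    have := hu.cup_mem_of_isolated (hf.degree hP a) ha
    obtain h | h := List.mem_cons.1 this
    · cases h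
    · simp [Strand.list] at h
  obtain ⟨t, e⟩ := hf.word_notMem js hjs rfl hZ
  obtain ⟨rfl, e⟩ := Sigma.mk.inj (eq_of_heq (Sigma.mk.inj e).2)
  obtain rfl := eq_of_heq e
  exact ⟨t, x, h, u, hu, heq_of_eq (Category.assoc _ _ _)⟩

end PregroupGrammar

/-! ### Sequences of wires -/

section

variable {C D : Type*} [Category C] [Category D]

/-- An endomorphism of a right adjoint's value that is compatible with the counit is the
identity. -/
theorem eq_id_of_map_comp_counit {L : C ⥤ D} {R : D ⥤ C} (adj : L ⊣ R) (Y : D)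
    (f : R.obj Y ⟶ R.obj Y) (h : L.map f ≫ adj.counit.app Y = adj.counit.app Y) : f = 𝟙 _ := by
  refine (adj.homEquiv _ _).symm.injective ?_
  rw [Adjunction.homEquiv_counit, Adjunction.homEquiv_counit, h, L.map_id, Category.id_comp]

/-- An endomorphism of a left adjoint's value that is compatible with the unit is the identity. -/
theorem eq_id_of_unit_comp_map {L : C ⥤ D} {R : D ⥤ C} (adj : L ⊣ R) (Y : C)
    (f : L.obj Y ⟶ L.obj Y) (h : adj.unit.app Y ≫ R.map f = adj.unit.app Y) : f = 𝟙 _ := by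
  refine (adj.homEquiv _ _).injective ?_
  rw [Adjunction.homEquiv_unit, Adjunction.homEquiv_unit, h, R.map_id]
  exact (Category.comp_id _).symm

variable [MonoidalCategory C]

theorem rightUnitor_inv_comp_associator (A T : C) {U : C} (f : T ⊗ 𝟙_ C ⟶ U) :
    (ρ_ (A ⊗ T)).inv ≫ ((α_ A T (𝟙_ C)).hom ≫ A ◁ f ≫ 𝟙 _) = A ◁ ((ρ_ T).inv ≫ f) := by
  have h : (ρ_ (A ⊗ T)).inv ≫ (α_ A T (𝟙_ C)).hom = A ◁ (ρ_ T).inv := by monoidal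
  rw [Category.comp_id, MonoidalCategory.whiskerLeft_comp, ← h, Category.assoc]

/-- Removal of the unit at the end of a sequence from a decomposed morphism. This and the following
computations are stated in arbitrary categories, because the objects of `RC S` on which they are
used agree only up to unfolding of definitions. -/
theorem eq_of_whiskerRight_unit {T Y Z x s : C} {g : T ⟶ s} {F : T ⊗ 𝟙_ C ⟶ Y} {a : Y ⟶ Z}
    {u : Z ⟶ x ⊗ 𝟙_ C} {m : x ⊗ 𝟙_ C ⟶ s ⊗ 𝟙_ C} {i : x ⟶ s} (e : F ≫ a ≫ u ≫ m = g ▷ 𝟙_ C)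
    (hm : m ≫ (ρ_ s).hom = (ρ_ x).hom ≫ i) :
    g = ((ρ_ T).inv ≫ F) ≫ a ≫ u ≫ (ρ_ x).hom ≫ i := by
  have h := congrArg (fun f => (ρ_ T).inv ≫ f ≫ (ρ_ s).hom) e
  simp only [rightUnitor_naturality, Iso.inv_hom_id_assoc, Category.assoc, hm] at h
  rw [← h, Category.assoc]

end

namespace RC.Strand

variable {X : Type u} {S : RigidSignature.{u, w} X}

/-- The underlying morphism in the free rigid category. -/
abbrev hom {Y Z : Strand S} (u : Y ⟶ Z) : ob Y ⟶ ob Z := u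

theorem flat_atom_app (a : X) (Y : Strand S) :
    (flat S (.atom a)).hom.app Y = 𝟙 (cons (a, 0) Y) := rfl

/-- Both sides of the isomorphism are the same object, and its compatibility with the counits forces
it to be the identity. -/
theorem flat_radj_atom_app (a : X) (Y : Strand S) :
    (flat S (.radj (.atom a))).hom.app Y = 𝟙 (cons (a, 1) Y) := by
  have h := Adjunction.rightAdjointUniq_hom_app_counit
    ((@tensorAdj X S (RC.radj (S := S) (.atom a)) (of S (.atom a))
      (exactPairingRadj (S := S) (.atom a))).ofNatIsoLeft (flat S (.atom a)))
    ((typeSeq S (.atom a)).EO 0 0 rfl) Y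
  have h' : ((@tensorAdj X S (RC.radj (S := S) (.atom a)) (of S (.atom a))
      (exactPairingRadj (S := S) (.atom a))).ofNatIsoLeft (flat S (.atom a))).counit.app Y =
        ((typeSeq S (.atom a)).EO 0 0 rfl).counit.app Y := by
    rw [Adjunction.ofNatIsoLeft_counit]
    exact Category.id_comp (obj := RC S) _
  exact eq_id_of_map_comp_counit ((typeSeq S (.atom a)).EO 0 0 rfl) Y
    ((flat S (.radj (.atom a))).hom.app Y) (h.trans h')

/-- Both sides of the isomorphism are the same object, and its compatibility with the units forces
it to be the identity. -/
theorem flat_ladj_atom_app (a : X) (Y : Strand S) :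
    (flat S (.ladj (.atom a))).hom.app Y = 𝟙 (cons (a, -1) Y) := by
  have h := Adjunction.unit_leftAdjointUniq_hom_app
    ((tensorAdj (of S (.atom a)) (RC.ladj (S := S) (.atom a))).ofNatIsoRight (flat S (.atom a)))
    ((typeSeq S (.atom a)).OE (0 - 1) 0 (by omega)) Y
  have h' : ((tensorAdj (of S (.atom a)) (RC.ladj (S := S) (.atom a))).ofNatIsoRight
      (flat S (.atom a))).unit.app Y =
        ((typeSeq S (.atom a)).OE (0 - 1) 0 (by omega)).unit.app Y := by
    rw [Adjunction.ofNatIsoRight_unit]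
    exact Category.comp_id (obj := RC S) _
  let f : cons (a, -1) Y ⟶ cons (a, -1) Y := (flat S (.ladj (.atom a))).hom.app Y
  let f' : ((typeSeq S (.atom a)).O (0 - 1)).obj Y ⟶ ((typeSeq S (.atom a)).O (0 - 1)).obj Y := f
  have h0 : (0 : ℤ) = 0 - 1 + 1 := by omega
  exact eq_id_of_unit_comp_map ((typeSeq S (.atom a)).OE (0 - 1) 0 h0) Y f'
    ((congrArg (fun f => f ≫ _) h'.symm).trans h)

end RC.Strand

namespace PregroupGrammar

open RC RC.Strand

variable {V : Type u} {B : Type v} {P : PregroupGrammar V B} {ι : Type} {w : ι → V}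

variable (P w) in
/-- The canonical morphism from a tensor product of words to the sequence of words. -/
def wordsHom (js : List ι) :
    (of P.signature (.tensorList (js.map fun j => .atom (.inr (w j))))) ⟶ ob (P.words w js) :=
  (ρ_ _).inv ≫ (flat P.signature (.tensorList (js.map fun j => .atom (.inr (w j))))).hom.app
    (tail (𝟙_ P.Cat))

theorem wordsHom_cons (j : ι) (js : List ι) :
    P.wordsHom w (j :: js) = (of P.signature (.atom (.inr (w j)))) ◁ P.wordsHom w js := by
  exact rightUnitor_inv_comp_associator (C := P.Cat) _ _ _

theorem genMor_induced {x y : B} (h : (x, y) ∈ P.induced) :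
    hom (genMor (S := P.signature) (.inr ⟨(x, y), h⟩) (tail (𝟙_ P.Cat))) ≫
      (ρ_ (P.ofType (.atom y))).hom = (ρ_ (P.ofType (.atom x))).hom ≫ P.inducedStep x y h := by
  have : hom (genMor (S := P.signature) (.inr ⟨(x, y), h⟩) (tail (𝟙_ P.Cat))) =
      P.inducedStep x y h ▷ (𝟙_ P.Cat) :=
    (Category.id_comp (obj := P.Cat) _).trans (Category.comp_id (obj := P.Cat) _)
  rw [this]
  exact rightUnitor_naturality _

/-- The normal form of a reduction. -/
theorem exists_entries (hP : P.Terminal) {n : ℕ} {w : Fin n → V} (g : P.Reduction w) :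
    ∃ (t : ∀ j, P.Entry w j) (x : B) (h : (x, P.sentence) ∈ P.induced)
      (u : entries (List.finRange n) (fun j _ => t j) ⟶
        ((typeSeq P.signature (.atom (.inl x))).E 0).obj (tail (𝟙_ P.Cat))),
      Path (Cup fun _ => True) u ∧
        g = P.wordsHom w (List.finRange n) ≫ hom (applyEntries (List.finRange n) fun j _ => t j) ≫
          hom u ≫ (ρ_ (P.ofType (.atom x))).hom ≫ P.inducedStep x P.sentence h := by
  obtain ⟨f, rfl⟩ := Quotient.exists_rep g
  obtain ⟨s, hs, e⟩ := decomposes f (tail (𝟙_ P.Cat))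
  obtain ⟨t, x, h, u, hu, rfl⟩ := exists_normalForm hP (List.finRange n)
    (List.nodup_finRange n) s hs
  refine ⟨fun j => t j (List.mem_finRange j), x, h, u, hu, ?_⟩
  exact eq_of_whiskerRight_unit (C := P.Cat) (e.trans (Category.comp_id (obj := P.Cat) _))
    (genMor_induced h)

end PregroupGrammar

namespace PregroupGrammar

open RC RC.Strand

variable {V : Type u} {B : Type v} (P : PregroupGrammar V B) {ι : Type} (x : ι → B)

/-- The canonical isomorphism between the tensor product of a sequence of wires and a sequence of
simple types. -/
inductive Rep : ∀ (W : List (Wire ι)) (Y : Strand P.signature), (Wire.obj P x W ⟶ ob Y) → Prop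
  | nil : Rep [] (tail (𝟙_ P.Cat)) (𝟙 (𝟙_ P.Cat))
  | base (i : ι) {W : List (Wire ι)} {Y : Strand P.signature} {k : Wire.obj P x W ⟶ ob Y} :
      Rep W Y k → Rep (.base i :: W) (cons (.inl (x i), 0) Y) (P.ofType (.atom (x i)) ◁ k)
  | right (i : ι) {W : List (Wire ι)} {Y : Strand P.signature} {k : Wire.obj P x W ⟶ ob Y} :
      Rep W Y k → Rep (.right i :: W) (cons (.inl (x i), 1) Y) (P.ofType (.radj (.atom (x i))) ◁ k)
  | left (i : ι) {W : List (Wire ι)} {Y : Strand P.signature} {k : Wire.obj P x W ⟶ ob Y} :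
      Rep W Y k → Rep (.left i :: W) (cons (.inl (x i), .negSucc 0) Y)
        (P.ofType (.ladj (.atom (x i))) ◁ k)

variable {P x}

theorem Rep.unique {W : List (Wire ι)} {Y : Strand P.signature} {k k' : Wire.obj P x W ⟶ ob Y}
    (h : P.Rep x W Y k) (h' : P.Rep x W Y k') : k = k' := by
  induction h with
  | nil => cases h'; rfl
  | base i h ih => cases h' with | base _ h' => rw [ih h']
  | right i h ih => cases h' with | right _ h' => rw [ih h']
  | left i h ih => cases h' with | left _ h' => rw [ih h']

theorem _root_.append_step {C : Type*} [Category C] [MonoidalCategory C] (A : C)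
    {T U W Y Z : C} {k' : U ⟶ Y} {f : T ⊗ Y ⟶ Z} {a : T ⊗ U ⟶ W} {k : W ⟶ Z}
    (e : T ◁ k' ≫ f = a ≫ k) {f' : A ⊗ Z ⟶ A ⊗ Z} (hf' : f' = 𝟙 _) :
    (A ⊗ T) ◁ k' ≫ ((α_ A T Y).hom ≫ A ◁ f ≫ f') = ((α_ A T U).hom ≫ A ◁ a) ≫ A ◁ k := by
  rw [hf', Category.comp_id, associator_naturality_right_assoc, Category.assoc,
    ← MonoidalCategory.whiskerLeft_comp, ← MonoidalCategory.whiskerLeft_comp, e]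

/-- A type given by wires, put in front of a sequence of simple types that is given by wires. -/
theorem Rep.append {W' : List (Wire ι)} {Y : Strand P.signature} {k' : Wire.obj P x W' ⟶ ob Y}
    (h : P.Rep x W' Y k') (W : List (Wire ι)) :
    ∃ k, P.Rep x (W ++ W')
        (((typeSeq P.signature ((Wire.listType x W).map .inl)).E 0).obj Y) k ∧
      Wire.obj P x W ◁ k' ≫ hom ((flat P.signature ((Wire.listType x W).map .inl)).hom.app Y) =
        (Wire.append P x W W').hom ≫ k := by
  induction W with
  | nil => exact ⟨k', h, leftUnitor_naturality k'⟩
  | cons a W ih =>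
    obtain ⟨k, hk, e⟩ := ih
    cases a with
    | base i => exact ⟨_, .base i hk, append_step (C := P.Cat) _ e (flat_atom_app _ _)⟩
    | right i => exact ⟨_, .right i hk, append_step (C := P.Cat) _ e (flat_radj_atom_app _ _)⟩
    | left i => exact ⟨_, .left i hk, append_step (C := P.Cat) _ e (flat_ladj_atom_app _ _)⟩

theorem _root_.lexical_step {C : Type*} [Category C] [MonoidalCategory C] {a T J Y U Z W L : C}
    {F : J ⟶ U} {f : U ⟶ Y} {l : a ⟶ T} {d : J ⟶ L} {k : L ⟶ Y} {φ : T ⊗ Y ⟶ Z}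
    {p : T ⊗ L ⟶ W} {k₂ : W ⟶ Z}
    (h : F ≫ f = d ≫ k) (h' : T ◁ k ≫ φ = p ≫ k₂) :
    (a ◁ F) ≫ (a ◁ f ≫ 𝟙 _ ≫ l ▷ Y ≫ φ) = ((l ⊗ₘ d) ≫ p) ≫ k₂ := by
  rw [Category.assoc, ← h', Category.id_comp, ← whiskerLeft_comp_assoc, h, tensorHom_def',
    whisker_exchange_assoc, whiskerLeft_comp_assoc, Category.assoc, ← whisker_exchange_assoc]

end PregroupGrammar

namespace DependencyGrammar.DependencyRelation

open RC RC.Strand PregroupGrammar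

variable {V : Type u} {B : Type v} {G : DependencyGrammar V B} {n : ℕ} {w : Fin n → V}

/-- The lexical entries that a dependency relation assigns to the words. -/
noncomputable def entry (D : DependencyRelation G w) (j : Fin n) : G.toPregroup.Entry w j :=
  ⟨_, D.mem_lexicon j⟩

/-- The application of the lexical entries of a dependency relation to sequences of simple types is
the morphism `lexical`, up to the canonical isomorphisms. -/
theorem lexical_eq (D : DependencyRelation G w) (js : List (Fin n)) :
    ∃ k, G.toPregroup.Rep D.x (js.flatMap D.wires) (entries js fun j _ => D.entry j) k ∧
      G.toPregroup.wordsHom w js ≫ hom (applyEntries js fun j _ => D.entry j) =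
        D.lexical js ≫ k := by
  induction js with
  | nil =>
    refine ⟨_, .nil, ?_⟩
    have : (ρ_ (𝟙_ G.toPregroup.Cat)).inv ≫ (λ_ (𝟙_ G.toPregroup.Cat)).hom = 𝟙 _ := by monoidal
    exact congrArg (fun f => f ≫ 𝟙 (𝟙_ G.toPregroup.Cat)) this
  | cons j js ih =>
    obtain ⟨k, hk, e⟩ := ih
    obtain ⟨k₂, hk₂, e₂⟩ := hk.append (D.wires j)
    refine ⟨k₂, hk₂, ?_⟩
    rw [wordsHom_cons]
    exact lexical_step (C := G.toPregroup.Cat) e e₂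

end DependencyGrammar.DependencyRelation

/-! ### Labelling the cups -/

namespace PregroupGrammar

open RC RC.Strand

variable {V : Type u} {B : Type v} {P : PregroupGrammar V B} {ι : Type} {x : ι → B}

/-- A wire of a lexical entry, where only the wire of the assigned symbol is labelled. -/
inductive Slot (ι : Type) (B : Type v)
  | base : ι → Slot ι B
  | right : B → Slot ι B
  | left : B → Slot ι B

namespace Slot

/-- The simple type of a slot. -/
def simple (x : ι → B) : Slot ι B → (B ⊕ V) × ℤ
  | base i => (.inl (x i), 0)
  | right b => (.inl b, 1)
  | left b => (.inl b, .negSucc 0)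

/-- The slot of a wire. -/
def erase (x : ι → B) : Wire ι → Slot ι B
  | .base i => base i
  | .right i => right (x i)
  | .left i => left (x i)

variable (P x) in
/-- The simple types of a list of slots. -/
def strand : List (Slot ι B) → Strand P.signature
  | [] => tail (𝟙_ P.Cat)
  | q :: Q => cons (q.simple x) (strand Q)

end Slot

open Slot

/-- A cup contracts a labelled slot with an unlabelled one, which can be given the same label. The
labels of the other slots are those found for the target of the cup. -/
theorem exists_cup_label {Y Z : Strand P.signature} {u : Y ⟶ Z} (hu : Cup (fun _ => True) u)
    (Q : List (Slot ι B)) (hY : Y = strand P x Q) :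
    ∃ Q', Z = strand P x Q' ∧ ∀ W' k', W'.map (erase x) = Q' → P.Rep x W' Z k' →
      ∃ W k c, W.map (erase x) = Q ∧ P.Rep x W Y k ∧ Wire.Cup P x W W' c ∧ k ≫ hom u = c ≫ k' := by
  induction hu generalizing Q with
  | head a z z' h Y =>
    match Q, hY with
    | q :: q' :: Q, hY =>
      obtain ⟨h1, hY⟩ := Strand.cons.inj hY
      obtain ⟨h2, rfl⟩ := Strand.cons.inj hY
      refine ⟨Q, rfl, fun W' k' hW' hk' => ?_⟩
      match q, q', h1, h2 with
      | .base i, .right b, h1, h2 =>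
        obtain ⟨rfl, rfl⟩ := Prod.mk.inj h1
        obtain ⟨hb, rfl⟩ := Prod.mk.inj h2
        obtain rfl := Sum.inl_injective hb
        exact ⟨_, _, _, by simp [erase, hW'], .base i (.right i hk'), .right i W',
          contract_naturality (C := P.Cat) (RC.radj (S := P.signature) (P.ofType (.atom (x i))))
            (P.ofType (.atom (x i))) k'⟩
      | .left b, .base i, h1, h2 =>
        obtain ⟨hb, rfl⟩ := Prod.mk.inj h2
        obtain ⟨rfl, rfl⟩ := Prod.mk.inj h1
        obtain rfl := Sum.inl_injective hb
        exact ⟨_, _, _, by simp [erase, hW'], .left i (.base i hk'), .left i W',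
          contract_naturality (C := P.Cat) (P.ofType (.atom (x i)))
            (RC.ladj (S := P.signature) (P.ofType (.atom (x i)))) k'⟩
      -- The degrees of the other pairs of slots are not consecutive.
      | .base i, .base b, h1, h2 | .base i, .left b, h1, h2 | .right i, .base b, h1, h2
      | .right i, .right b, h1, h2 | .right i, .left b, h1, h2 | .left i, .right b, h1, h2
      | .left i, .left b, h1, h2 =>
        have h1 := congrArg Prod.snd h1
        have h2 := congrArg Prod.snd h2
        simp only [Slot.simple] at h1 h2
        omega
    | [], hY => cases hY
    | [q], hY => cases (Strand.cons.inj hY).2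
  | @cons σ Y Z u hu ih =>
    match Q, hY with
    | q :: Q, hY =>
      obtain ⟨rfl, h'⟩ := Strand.cons.inj hY
      obtain ⟨Q', rfl, H⟩ := ih Q h'
      refine ⟨q :: Q', rfl, fun W' k' hW' hk' => ?_⟩
      match W', hW' with
      | a :: W', hW' =>
        obtain ⟨rfl, h''⟩ := List.cons.inj hW'
        cases a with
        | base i =>
          cases hk' with | base _ hk' =>
          obtain ⟨W, k, c, hW, hk, hc, e⟩ := H _ _ h'' hk'
          refine ⟨_, _, _, by simp [erase, hW], .base i hk, .cons (.base i) hc, ?_⟩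
          exact (whiskerLeft_comp (C := P.Cat) _ _ _).symm.trans
            ((congrArg (fun f => _ ◁ f) e).trans (whiskerLeft_comp (C := P.Cat) _ _ _))
        | right i =>
          cases hk' with | right _ hk' =>
          obtain ⟨W, k, c, hW, hk, hc, e⟩ := H _ _ h'' hk'
          refine ⟨_, _, _, by simp [erase, hW], .right i hk, .cons (.right i) hc, ?_⟩
          exact (whiskerLeft_comp (C := P.Cat) _ _ _).symm.trans
            ((congrArg (fun f => _ ◁ f) e).trans (whiskerLeft_comp (C := P.Cat) _ _ _))
        | left i =>
          cases hk' with | left _ hk' =>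
          obtain ⟨W, k, c, hW, hk, hc, e⟩ := H _ _ h'' hk'
          refine ⟨_, _, _, by simp [erase, hW], .left i hk, .cons (.left i) hc, ?_⟩
          exact (whiskerLeft_comp (C := P.Cat) _ _ _).symm.trans
            ((congrArg (fun f => _ ◁ f) e).trans (whiskerLeft_comp (C := P.Cat) _ _ _))
    | [], hY => cases hY

/-- The cups of a reduction to a single symbol determine labels of all wires. -/
theorem exists_cups_label {Y Z : Strand P.signature} {u : Y ⟶ Z}
    (hu : Path (Cup fun _ => True) u) {b : B}
    (hZ : Z = cons (.inl b, 0) (tail (𝟙_ P.Cat))) (Q : List (Slot ι B)) (hY : Y = strand P x Q) :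
    ∃ h W k c, x h = b ∧ W.map (erase x) = Q ∧ P.Rep x W Y k ∧ Wire.Cups P x W [.base h] c ∧
      ∃ k', P.Rep x [.base h] Z k' ∧ k ≫ hom u = c ≫ k' := by
  induction hu generalizing Q with
  | id Y =>
    match Q, hY with
    | q :: Q, hY =>
      obtain ⟨h1, h2⟩ := Strand.cons.inj (hZ.symm.trans hY)
      match q, h1 with
      | .base i, h1 =>
        match Q, h2 with
        | [], h2 =>
          obtain rfl : b = x i := Sum.inl_injective (Prod.mk.inj h1).1
          subst hZ
          exact ⟨i, [.base i], _, 𝟙 _, rfl, rfl, .base i .nil, .id _, _, .base i .nil,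
            (Category.comp_id (obj := P.Cat) _).trans (Category.id_comp (obj := P.Cat) _).symm⟩
        | q :: Q, h2 => cases h2
      | .right c, h1 => exact absurd (Prod.mk.inj h1).2 (by norm_num)
      | .left c, h1 => exact absurd (Prod.mk.inj h1).2 (by norm_num)
    | [], hY => cases hZ.symm.trans hY
  | step h _ ih =>
    obtain ⟨Q', hZ', H⟩ := exists_cup_label h Q hY
    obtain ⟨i, W', k', c', hi, hW', hk', hc', k₂, hk₂, e'⟩ := ih hZ Q' hZ'
    obtain ⟨W, k, c, hW, hk, hc, e⟩ := H W' k' hW' hk'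
    refine ⟨i, W, k, c ≫ c', hi, hW, hk, .comp hc hc', k₂, hk₂, ?_⟩
    exact (Category.assoc (obj := P.Cat) _ _ _).symm.trans
      ((congrArg (fun f => f ≫ _) e).trans ((Category.assoc (obj := P.Cat) _ _ _).trans
        ((congrArg (fun f => _ ≫ f) e').trans (Category.assoc (obj := P.Cat) _ _ _).symm)))

end PregroupGrammar

/-! ### Planar matchings -/

namespace Wire

variable {V : Type u} {B : Type v} {ι : Type}

/-- Removal of a matched pair of adjacent wires. -/
inductive Contract : List (Wire ι) → List (Wire ι) → Prop
  | right (i : ι) (W W' : List (Wire ι)) : Contract (W ++ .base i :: .right i :: W') (W ++ W')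
  | left (i : ι) (W W' : List (Wire ι)) : Contract (W ++ .left i :: .base i :: W') (W ++ W')

/-- Repeated removal of matched pairs of adjacent wires. -/
inductive Contracts : List (Wire ι) → List (Wire ι) → Prop
  | refl (W : List (Wire ι)) : Contracts W W
  | step {W W' W'' : List (Wire ι)} : Contract W W' → Contracts W' W'' → Contracts W W''

theorem Contract.cons (a : Wire ι) {W W' : List (Wire ι)} (h : Contract W W') :
    Contract (a :: W) (a :: W') := by
  cases h with
  | right i W W' => exact .right i (a :: W) W'
  | left i W W' => exact .left i (a :: W) W'

theorem Cup.contract {P : PregroupGrammar V B} {x : ι → B} {W W' : List (Wire ι)}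
    {f : obj P x W ⟶ obj P x W'} (h : Cup P x W W' f) : Contract W W' := by
  induction h with
  | right i W => exact .right i [] W
  | left i W => exact .left i [] W
  | cons a _ ih => exact ih.cons a

theorem Cups.contracts {P : PregroupGrammar V B} {x : ι → B} {W W' : List (Wire ι)}
    {f : obj P x W ⟶ obj P x W'} (h : Cups P x W W' f) : Contracts W W' := by
  induction h with
  | id => exact .refl _
  | comp h _ ih => exact .step h.contract ih

/-- Two wires that can be joined by a cup, in this order. -/
inductive Match : Wire ι → Wire ι → Prop
  | right (i : ι) : Match (.base i) (.right i)
  | left (i : ι) : Match (.left i) (.base i)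

theorem Contract.exists_match {W W' : List (Wire ι)} (h : Contract W W') :
    ∃ a b L R, Match a b ∧ W = L ++ a :: b :: R ∧ W' = L ++ R := by
  cases h with
  | right i L R => exact ⟨_, _, L, R, .right i, rfl, rfl⟩
  | left i L R => exact ⟨_, _, L, R, .left i, rfl, rfl⟩

theorem Match.contract {a b : Wire ι} (h : Match a b) (L R : List (Wire ι)) :
    Contract (L ++ a :: b :: R) (L ++ R) := by
  cases h with
  | right i => exact .right i L R
  | left i => exact .left i L R

/-- The wires between two matched wires can be contracted among each other. -/
def Encloses (W : List (Wire ι)) (a b : Wire ι) : Prop :=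
  ∃ L M R, W = L ++ a :: (M ++ b :: R) ∧ Contracts M []

theorem Encloses.of_contract {W W' : List (Wire ι)} (h : Contract W W') {a b : Wire ι}
    (h' : Encloses W' a b) : Encloses W a b := by
  obtain ⟨c, d, L₀, R₀, hm, rfl, rfl⟩ := h.exists_match
  obtain ⟨L, M, R, e, hM⟩ := h'
  obtain ⟨K, rfl, rfl⟩ | ⟨K, rfl, e₁⟩ := List.append_eq_append_iff.1 e
  · exact ⟨L₀ ++ c :: d :: K, M, R, by simp, hM⟩
  · obtain ⟨rfl, rfl⟩ | ⟨K, rfl, e₂⟩ := List.cons_eq_append_iff.1 e₁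
    · exact ⟨L ++ [c, d], M, R, by simp, hM⟩
    · obtain ⟨K', rfl, e₃⟩ | ⟨K', rfl, rfl⟩ := List.append_eq_append_iff.1 e₂
      · obtain ⟨rfl, rfl⟩ | ⟨K, rfl, rfl⟩ := List.cons_eq_append_iff.1 e₃
        · exact ⟨L, M ++ [c, d], R, by simp,
            .step (by simpa using hm.contract M []) (by simpa using hM)⟩
        · exact ⟨L, M, K ++ c :: d :: R₀, by simp, hM⟩
      · exact ⟨L, K ++ c :: d :: K', R, by simp, .step (hm.contract K K') hM⟩

/-- If the dependent's wire of `j` is contracted away, then it is matched with `base j`. -/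
theorem Contracts.encloses {W W' : List (Wire ι)} (hW : Contracts W W') (j : ι) :
    (.right j ∈ W → .right j ∉ W' → Encloses W (.base j) (.right j)) ∧
      (.left j ∈ W → .left j ∉ W' → Encloses W (.left j) (.base j)) := by
  induction hW with
  | refl => exact ⟨fun h h' => absurd h h', fun h h' => absurd h h'⟩
  | @step W W' W'' h _ ih =>
    refine ⟨fun hj hj' => ?_, fun hj hj' => ?_⟩
    · by_cases hW' : .right j ∈ W'
      · exact (ih.1 hW' hj').of_contract h
      · cases h with
        | right i L R =>
          obtain rfl : j = i := by simp_all
          exact ⟨L, [], R, rfl, .refl _⟩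
        | left i L R => simp_all
    · by_cases hW' : .left j ∈ W'
      · exact (ih.2 hW' hj').of_contract h
      · cases h with
        | right i L R => simp_all
        | left i L R =>
          obtain rfl : j = i := by simp_all
          exact ⟨L, [], R, rfl, .refl _⟩

open Classical in
/-- Each contraction removes a wire `base j` together with a wire `right j` or `left j`. -/
theorem Contracts.count_base {W W' : List (Wire ι)} (hW : Contracts W W') (j : ι) :
    W.count (.base j) + (W'.count (.right j) + W'.count (.left j)) =
      W'.count (.base j) + (W.count (.right j) + W.count (.left j)) := by
  induction hW with
  | refl => rfl
  | step h _ ih =>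
    cases h with
    | right i L R =>
      simp only [List.count_append, List.count_cons, beq_iff_eq, Wire.base.injEq,
        Wire.right.injEq, reduceCtorEq, if_false] at ih ⊢
      omega
    | left i L R =>
      simp only [List.count_append, List.count_cons, beq_iff_eq, Wire.base.injEq,
        Wire.left.injEq, reduceCtorEq, if_false] at ih ⊢
      omega

open Classical in
/-- The position of the first occurrence of a wire. -/
noncomputable def pos (W : List (Wire ι)) (a : Wire ι) : ℕ := W.idxOf a

theorem pos_lt_of_sublist {W : List (Wire ι)} (hW : W.Nodup) {a b : Wire ι}
    (h : [a, b].Sublist W) : pos W a < pos W b := by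
  classical
  induction W with
  | nil => cases h
  | cons c W ih =>
    obtain ⟨hc, hW⟩ := List.nodup_cons.1 hW
    have hs : [a, b].Sublist W ∨ c = a ∧ b ∈ W := by
      cases h with
      | cons _ h => exact .inl h
      | cons_cons _ h => exact .inr ⟨rfl, List.singleton_sublist.1 h⟩
    simp only [pos, List.idxOf_cons, Bool.cond_eq_ite, beq_iff_eq] at ih ⊢
    obtain h | ⟨rfl, hb⟩ := hs
    · have ha : c ≠ a := fun e => hc (e ▸ h.subset (by simp))
      have hb : c ≠ b := fun e => hc (e ▸ h.subset (by simp))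
      simpa [ha, hb] using ih hW h
    · have hb : c ≠ b := fun e => hc (e ▸ hb)
      simp [hb]

/-- The wire `c` lies strictly between `a` and `b`. -/
def Between (W : List (Wire ι)) (a b c : Wire ι) : Prop :=
  c ∈ W ∧ pos W a < pos W c ∧ pos W c < pos W b

/-- The wires between two matched wires are matched with each other. -/
theorem Encloses.between {W : List (Wire ι)} (hW : W.Nodup) {a b : Wire ι} (h : Encloses W a b) :
    pos W a < pos W b ∧ ∀ k, Between W a b (.base k) ↔
      Between W a b (.right k) ∨ Between W a b (.left k) := by
  classical
  obtain ⟨L, M, R, rfl, hM⟩ := h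
  have hab : pos (L ++ a :: (M ++ b :: R)) a < pos (L ++ a :: (M ++ b :: R)) b :=
    pos_lt_of_sublist hW (((List.singleton_sublist.2 (by simp)).cons_cons a).trans
      (List.sublist_append_right _ _))
  have key (c : Wire ι) : Between (L ++ a :: (M ++ b :: R)) a b c ↔ c ∈ M := by
    constructor
    · rintro ⟨hc, h1, h2⟩
      simp only [List.mem_append, List.mem_cons] at hc
      obtain hc | rfl | hc | rfl | hc := hc
      · have := pos_lt_of_sublist hW (a := c) (b := a)
          ((List.singleton_sublist.2 hc).append (List.singleton_sublist.2 (by simp)))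
        omega
      · omega
      · exact hc
      · omega
      · have := pos_lt_of_sublist hW (a := b) (b := c)
          ((((List.singleton_sublist.2 hc).cons_cons b).trans
            (List.sublist_append_right M _)).trans
              ((List.sublist_cons_self a _).trans (List.sublist_append_right L _)))
        omega
    · intro hc
      refine ⟨by simp [hc], pos_lt_of_sublist hW ?_, pos_lt_of_sublist hW ?_⟩
      · exact ((List.singleton_sublist.2 (by simp [hc])).cons_cons a).trans
          (List.sublist_append_right _ _)
      · exact (((List.singleton_sublist.2 hc).append (List.singleton_sublist.2 (by simp))).trans
            ((List.sublist_cons_self a (M ++ b :: R)).trans (List.sublist_append_right L _)))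
  refine ⟨hab, fun k => ?_⟩
  have := hM.count_base k
  simp only [List.count_nil, Nat.zero_add, Nat.add_zero] at this
  rw [key, key, key, ← List.count_pos_iff, ← List.count_pos_iff, ← List.count_pos_iff]
  omega

end Wire

/-! ### Dependency relations from nested arcs -/

section Arcs

variable {n : ℕ}

/-- The vertex `k` lies strictly between `j` and `i`. -/
def Amid (j i k : Fin n) : Prop := (j < k ∧ k < i) ∨ (i < k ∧ k < j)

/-- A relation on a linearly ordered finite set that gives every element at most one head, in such a
way that no arc leaves the space below another arc: by `head`, the head of a vertex strictly below
the arc from `j` to `i` is below this arc or at one of its ends; by `dependent`, the dependents of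
this vertex are below the arc; by `dependent_left`, so are the dependents of `j` on the side of `i`.
-/
structure Nested (d : Fin n → Fin n → Prop) : Prop where
  ne : ∀ {j i}, d j i → j ≠ i
  functional : ∀ {j i i'}, d j i → d j i' → i = i'
  head : ∀ {j i}, d j i → ∀ {k}, Amid j i k → ∃ k', d k k' ∧ (Amid j i k' ∨ k' = j ∨ k' = i)
  dependent : ∀ {j i}, d j i → ∀ {k}, Amid j i k → ∀ {q}, d q k → Amid j i q
  dependent_left : ∀ {j i q}, d j i → d q j → (j < q ↔ j < i) → Amid j i q

namespace Nested

variable {d : Fin n → Fin n → Prop} (hd : Nested d)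

include hd

/-- The leftmost vertex `m` of a cycle has its head `k` on the right. Going backwards along the
cycle from `m`, one never leaves the space below the arc from `m` to `k`, so one never returns to
`m`. -/
theorem acyclic (i : Fin n) : ¬ Relation.TransGen d i i := by
  intro hi
  obtain ⟨m, hm, hmin⟩ := wellFounded_lt.has_min {p : Fin n | Relation.TransGen d p p} ⟨i, hi⟩
  obtain ⟨k, hk⟩ : ∃ k, d m k := by
    cases Relation.TransGen.head'_iff.1 hm with | intro k h => exact ⟨k, h.1⟩
  have hkm : Relation.ReflTransGen d k m := by
    obtain ⟨k', h, h'⟩ := Relation.TransGen.head'_iff.1 hm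
    exact hd.functional hk h ▸ h'
  have hle (x : Fin n) (h : Relation.TransGen d m x) (h' : Relation.TransGen d x m) : m ≤ x :=
    not_lt.1 (hmin x (h'.trans h))
  have hmk : m < k := lt_of_le_of_ne (hle k (.single hk)
    (hkm.cases_head.elim (fun e => absurd e.symm (hd.ne hk)) fun ⟨c, h, h'⟩ => .head' h h'))
    (hd.ne hk)
  have key (x : Fin n) (h : Relation.TransGen d x m) :
      Relation.TransGen d m x → Amid m k x := by
    induction h using Relation.TransGen.head_induction_on with
    | single h =>
      intro hx
      have := lt_of_le_of_ne (hle _ hx (.single h)) (hd.ne h).symm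
      exact hd.dependent_left hk h ⟨fun _ => hmk, fun _ => this⟩
    | head h h' ih =>
      intro hx
      exact hd.dependent hk (ih (hx.tail h)) h
  have := key m hm hm
  simp [Amid] at this

/-- Following the heads from below an arc, one arrives at one of the two ends of the arc. -/
theorem reach {j i : Fin n} (h : d j i) (k : Fin n) :
    Amid j i k → Relation.ReflTransGen d k j ∨ Relation.ReflTransGen d k i := by
  have : IsTrans (Fin n) (fun a b => Relation.TransGen d b a) := ⟨fun a b c h h' => h'.trans h⟩
  have : Std.Irrefl (fun a b => Relation.TransGen d b a) := ⟨fun a => hd.acyclic a⟩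
  have wf := Finite.wellFounded_of_trans_of_irrefl (fun a b : Fin n => Relation.TransGen d b a)
  induction k using wf.induction with
  | _ k ih =>
    intro hk
    obtain ⟨k', h', hk' | rfl | rfl⟩ := hd.head h hk
    · exact (ih k' (.single h') hk').imp (.head h') (.head h')
    · exact .inl (.single h')
    · exact .inr (.single h')

theorem planar (i j k : Fin n) (h : (i ≤ j ∧ j ≤ k) ∨ (k ≤ j ∧ j ≤ i))
    (h' : Relation.ReflTransGen d i k) : Relation.ReflTransGen d j k := by
  induction h' using Relation.ReflTransGen.head_induction_on with
  | refl =>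
    obtain rfl : j = k := by omega
    exact .refl
  | @head i i' hi hk ih =>
    by_cases hj : (i' ≤ j ∧ j ≤ k) ∨ (k ≤ j ∧ j ≤ i')
    · exact ih hj
    · by_cases hji : j = i
      · exact hji ▸ .head hi hk
      · obtain h | h := hd.reach hi j (by simp only [Amid]; omega)
        · exact h.trans (.head hi hk)
        · exact h.trans hk

end Nested

end Arcs

namespace Wire

variable {n : ℕ}

/-- The wires of a lexical entry. -/
def block (ls rs : Fin n → List (Fin n)) (i : Fin n) : List (Wire (Fin n)) :=
  (ls i).map .right ++ .base i :: (rs i).map .left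

variable {ls rs : Fin n → List (Fin n)}

theorem base_mem_block {i j : Fin n} : .base j ∈ block ls rs i ↔ j = i := by simp [block]

theorem right_mem_block {i j : Fin n} : .right j ∈ block ls rs i ↔ j ∈ ls i := by simp [block]

theorem left_mem_block {i j : Fin n} : .left j ∈ block ls rs i ↔ j ∈ rs i := by simp [block]

variable (ls rs) in
/-- The wires of all lexical entries. -/
abbrev allBlocks : List (Wire (Fin n)) := (List.finRange n).flatMap (block ls rs)

theorem mem_allBlocks {i : Fin n} {a : Wire (Fin n)} (h : a ∈ block ls rs i) :
    a ∈ allBlocks ls rs := List.mem_flatMap.2 ⟨i, List.mem_finRange i, h⟩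

theorem mem_allBlocks_iff {a : Wire (Fin n)} : a ∈ allBlocks ls rs ↔ ∃ i, a ∈ block ls rs i := by
  simp [List.mem_flatMap]

open Classical in
theorem count_base_allBlocks (j : Fin n) : (allBlocks ls rs).count (.base j) = 1 := by
  have (i : Fin n) : (block ls rs i).count (.base j) = if i = j then 1 else 0 := by
    have h1 : (.base j) ∉ (ls i).map Wire.right := by simp
    have h2 : (.base j) ∉ (rs i).map Wire.left := by simp
    simp [block, List.count_cons, List.count_eq_zero_of_not_mem h1,
      List.count_eq_zero_of_not_mem h2]
  rw [allBlocks, List.count_flatMap, ← Fin.sum_univ_def]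
  simp [this]

section

variable {h : Fin n} (hW : Contracts (allBlocks ls rs) [.base h])

include hW

open Classical in
/-- Every symbol but the root occurs exactly once as a dependent. -/
theorem count_allBlocks (j : Fin n) :
    (allBlocks ls rs).count (.right j) + (allBlocks ls rs).count (.left j) =
      if j = h then 0 else 1 := by
  have := hW.count_base j
  rw [count_base_allBlocks] at this
  simp only [List.count_cons, List.count_nil, beq_iff_eq, Wire.base.injEq, reduceCtorEq,
    if_false, eq_comm (a := h)] at this
  split_ifs at this ⊢ <;> omega

theorem nodup_allBlocks : (allBlocks ls rs).Nodup := by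
  classical
  rw [List.nodup_iff_count_le_one]
  rintro (j | j | j)
  · exact (count_base_allBlocks j).le
  all_goals
    have := count_allBlocks hW j
    split_ifs at this <;> omega

theorem not_mem_rs_of_mem_ls {i k j : Fin n} (hj : j ∈ ls i) : j ∉ rs k := by
  classical
  intro hj'
  have h1 := List.count_pos_iff.2 (mem_allBlocks (right_mem_block (rs := rs).2 hj))
  have h2 := List.count_pos_iff.2 (mem_allBlocks (left_mem_block (ls := ls).2 hj'))
  have := count_allBlocks hW j
  split_ifs at this <;> omega

theorem root_not_mem (i : Fin n) : h ∉ ls i ∧ h ∉ rs i := by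
  classical
  have := count_allBlocks hW h
  rw [if_pos rfl] at this
  refine ⟨fun hj => ?_, fun hj => ?_⟩
  · have := List.count_pos_iff.2 (mem_allBlocks (right_mem_block (rs := rs).2 hj))
    omega
  · have := List.count_pos_iff.2 (mem_allBlocks (left_mem_block (ls := ls).2 hj))
    omega

theorem exists_head {j : Fin n} (hj : j ≠ h) : ∃ i, j ∈ ls i ∨ j ∈ rs i := by
  classical
  have := count_allBlocks hW j
  rw [if_neg hj] at this
  by_cases h0 : (.right j) ∈ allBlocks ls rs
  · obtain ⟨i, hi⟩ := mem_allBlocks_iff.1 h0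
    exact ⟨i, .inl (right_mem_block.1 hi)⟩
  · have h1 : (.left j) ∈ allBlocks ls rs := by
      rw [← List.count_pos_iff]
      rw [← List.count_pos_iff] at h0
      omega
    obtain ⟨i, hi⟩ := mem_allBlocks_iff.1 h1
    exact ⟨i, .inr (left_mem_block.1 hi)⟩

theorem pos_lt_of_lt {i k : Fin n} (hik : i < k) {a b : Wire (Fin n)} (ha : a ∈ block ls rs i)
    (hb : b ∈ block ls rs k) : pos (allBlocks ls rs) a < pos (allBlocks ls rs) b := by
  refine pos_lt_of_sublist (nodup_allBlocks hW) ?_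
  have h1 : [i, k].Sublist (List.finRange n) :=
    List.sublist_of_subperm_of_sortedLE (List.Nodup.subperm (by simp [hik.ne]) (by simp))
      (by simp [List.sortedLE_iff_pairwise, hik.le]) (List.sortedLT_finRange n).sortedLE
  have h2 := h1.flatMap (block ls rs)
  refine List.Sublist.trans ?_ h2
  simpa using (List.singleton_sublist.2 ha).append (List.singleton_sublist.2 hb)

theorem le_of_pos_lt {i k : Fin n} {a b : Wire (Fin n)} (ha : a ∈ block ls rs i)
    (hb : b ∈ block ls rs k) (hab : pos (allBlocks ls rs) a < pos (allBlocks ls rs) b) : i ≤ k := by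
  by_contra! hki
  have := pos_lt_of_lt hW hki hb ha
  omega

theorem pos_lt_of_sublist_block {i : Fin n} {a b : Wire (Fin n)}
    (hab : [a, b].Sublist (block ls rs i)) :
    pos (allBlocks ls rs) a < pos (allBlocks ls rs) b :=
  pos_lt_of_sublist (nodup_allBlocks hW)
    (hab.trans (List.sublist_flatten_of_mem (List.mem_map_of_mem (List.mem_finRange i))))

theorem pos_right_lt_base {i j : Fin n} (hj : j ∈ ls i) :
    pos (allBlocks ls rs) (.right j) < pos (allBlocks ls rs) (.base i) := by
  refine pos_lt_of_sublist_block hW (i := i) ?_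
  exact (List.singleton_sublist.2 (List.mem_map_of_mem hj)).append
    (List.singleton_sublist.2 List.mem_cons_self)

theorem pos_base_lt_left {i j : Fin n} (hj : j ∈ rs i) :
    pos (allBlocks ls rs) (.base i) < pos (allBlocks ls rs) (.left j) := by
  refine pos_lt_of_sublist_block hW (i := i) ?_
  exact ((List.singleton_sublist.2 (List.mem_map_of_mem hj)).cons_cons _).trans
    (List.sublist_append_right _ _)

theorem eq_of_mem_ls {i k j : Fin n} (hi : j ∈ ls i) (hk : j ∈ ls k) : i = k := by
  by_contra hik
  obtain hik | hik := lt_or_gt_of_ne hik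
  · exact (pos_lt_of_lt hW hik (right_mem_block.2 hi) (right_mem_block.2 hk)).false
  · exact (pos_lt_of_lt hW hik (right_mem_block.2 hk) (right_mem_block.2 hi)).false

theorem eq_of_mem_rs {i k j : Fin n} (hi : j ∈ rs i) (hk : j ∈ rs k) : i = k := by
  by_contra hik
  obtain hik | hik := lt_or_gt_of_ne hik
  · exact (pos_lt_of_lt hW hik (left_mem_block.2 hi) (left_mem_block.2 hk)).false
  · exact (pos_lt_of_lt hW hik (left_mem_block.2 hk) (left_mem_block.2 hi)).false

theorem right_between {i j : Fin n} (hj : j ∈ ls i) :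
    pos (allBlocks ls rs) (.base j) < pos (allBlocks ls rs) (.right j) ∧
      ∀ k, Between (allBlocks ls rs) (.base j) (.right j) (.base k) ↔
        Between (allBlocks ls rs) (.base j) (.right j) (.right k) ∨
          Between (allBlocks ls rs) (.base j) (.right j) (.left k) :=
  ((hW.encloses j).1 (mem_allBlocks (right_mem_block.2 hj)) (by simp)).between (nodup_allBlocks hW)

theorem left_between {i j : Fin n} (hj : j ∈ rs i) :
    pos (allBlocks ls rs) (.left j) < pos (allBlocks ls rs) (.base j) ∧
      ∀ k, Between (allBlocks ls rs) (.left j) (.base j) (.base k) ↔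
        Between (allBlocks ls rs) (.left j) (.base j) (.right k) ∨
          Between (allBlocks ls rs) (.left j) (.base j) (.left k) :=
  ((hW.encloses j).2 (mem_allBlocks (left_mem_block.2 hj)) (by simp)).between (nodup_allBlocks hW)

theorem lt_of_mem_ls {i j : Fin n} (hj : j ∈ ls i) : j < i := by
  have h1 := (right_between hW hj).1
  have h2 := pos_right_lt_base hW hj
  refine lt_of_le_of_ne (le_of_pos_lt hW (base_mem_block.2 rfl) (right_mem_block.2 hj) h1) ?_
  rintro rfl
  omega

theorem lt_of_mem_rs {i j : Fin n} (hj : j ∈ rs i) : i < j := by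
  have h1 := (left_between hW hj).1
  have h2 := pos_base_lt_left hW hj
  refine lt_of_le_of_ne (le_of_pos_lt hW (left_mem_block.2 hj) (base_mem_block.2 rfl) h1) ?_
  rintro rfl
  omega

theorem right_between_block {i j k : Fin n} (hj : j ∈ ls i) (hjk : j < k) (hki : k < i)
    {c : Wire (Fin n)} (hc : c ∈ block ls rs k) :
    Between (allBlocks ls rs) (.base j) (.right j) c :=
  ⟨mem_allBlocks hc, pos_lt_of_lt hW hjk (base_mem_block.2 rfl) hc,
    pos_lt_of_lt hW hki hc (right_mem_block.2 hj)⟩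

theorem left_between_block {i j k : Fin n} (hj : j ∈ rs i) (hik : i < k) (hkj : k < j)
    {c : Wire (Fin n)} (hc : c ∈ block ls rs k) :
    Between (allBlocks ls rs) (.left j) (.base j) c :=
  ⟨mem_allBlocks hc, pos_lt_of_lt hW hik (left_mem_block.2 hj) hc,
    pos_lt_of_lt hW hkj hc (base_mem_block.2 rfl)⟩

theorem lt_lt_of_right_between {i j k : Fin n} (hj : j ∈ ls i)
    (hk : Between (allBlocks ls rs) (.base j) (.right j) (.base k)) : j < k ∧ k < i := by
  obtain ⟨-, h1, h2⟩ := hk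
  have h3 := pos_right_lt_base hW hj
  refine ⟨lt_of_le_of_ne (le_of_pos_lt hW (base_mem_block.2 rfl) (base_mem_block.2 rfl) h1) ?_,
    lt_of_le_of_ne (le_of_pos_lt hW (base_mem_block.2 rfl) (right_mem_block.2 hj) h2) ?_⟩
  · rintro rfl
    omega
  · rintro rfl
    omega

theorem lt_lt_of_left_between {i j k : Fin n} (hj : j ∈ rs i)
    (hk : Between (allBlocks ls rs) (.left j) (.base j) (.base k)) : i < k ∧ k < j := by
  obtain ⟨-, h1, h2⟩ := hk
  have h3 := pos_base_lt_left hW hj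
  refine ⟨lt_of_le_of_ne (le_of_pos_lt hW (left_mem_block.2 hj) (base_mem_block.2 rfl) h1) ?_,
    lt_of_le_of_ne (le_of_pos_lt hW (base_mem_block.2 rfl) (base_mem_block.2 rfl) h2) ?_⟩
  · rintro rfl
    omega
  · rintro rfl
    omega

/-- The arcs that join matched wires are nested. -/
theorem nested : Nested fun j i => j ∈ ls i ∨ j ∈ rs i where
  ne {j i} h := h.elim (fun h => (lt_of_mem_ls hW h).ne) fun h => (lt_of_mem_rs hW h).ne'
  functional {j i i'} h h' := by
    obtain h | h := h <;> obtain h' | h' := h'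
    · exact eq_of_mem_ls hW h h'
    · exact absurd h' (not_mem_rs_of_mem_ls hW h)
    · exact absurd h (not_mem_rs_of_mem_ls hW h')
    · exact eq_of_mem_rs hW h h'
  head {j i} h k hk := by
    obtain h | h := h
    · have hji := lt_of_mem_ls hW h
      obtain ⟨h1, h2⟩ : j < k ∧ k < i := hk.resolve_right (by omega)
      obtain hb | hb := ((right_between hW h).2 k).1
        (right_between_block hW h h1 h2 (base_mem_block.2 rfl))
      all_goals
        obtain ⟨k', hk'⟩ := mem_allBlocks_iff.1 hb.1
        have h3 := le_of_pos_lt hW (base_mem_block.2 rfl) hk' hb.2.1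
        have h4 := le_of_pos_lt hW hk' (right_mem_block.2 h) hb.2.2
        refine ⟨k', by simp only [right_mem_block, left_mem_block] at hk'; simp [hk'], ?_⟩
        simp only [Amid]
        omega
    · have hji := lt_of_mem_rs hW h
      obtain ⟨h1, h2⟩ : i < k ∧ k < j := hk.resolve_left (by omega)
      obtain hb | hb := ((left_between hW h).2 k).1
        (left_between_block hW h h1 h2 (base_mem_block.2 rfl))
      all_goals
        obtain ⟨k', hk'⟩ := mem_allBlocks_iff.1 hb.1
        have h3 := le_of_pos_lt hW (left_mem_block.2 h) hk' hb.2.1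
        have h4 := le_of_pos_lt hW hk' (base_mem_block.2 rfl) hb.2.2
        refine ⟨k', by simp only [right_mem_block, left_mem_block] at hk'; simp [hk'], ?_⟩
        simp only [Amid]
        omega
  dependent {j i} h k hk q hq := by
    obtain h | h := h
    · have hji := lt_of_mem_ls hW h
      obtain ⟨h1, h2⟩ : j < k ∧ k < i := hk.resolve_right (by omega)
      exact .inl (lt_lt_of_right_between hW h (((right_between hW h).2 q).2
        (hq.imp (fun hq => right_between_block hW h h1 h2 (right_mem_block.2 hq))
          fun hq => right_between_block hW h h1 h2 (left_mem_block.2 hq))))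
    · have hji := lt_of_mem_rs hW h
      obtain ⟨h1, h2⟩ : i < k ∧ k < j := hk.resolve_left (by omega)
      exact .inr (lt_lt_of_left_between hW h (((left_between hW h).2 q).2
        (hq.imp (fun hq => left_between_block hW h h1 h2 (right_mem_block.2 hq))
          fun hq => left_between_block hW h h1 h2 (left_mem_block.2 hq))))
  dependent_left {j i q} h hq hqi := by
    obtain h | h := h
    · have hji := lt_of_mem_ls hW h
      have hjq := hqi.2 hji
      have hq := hq.resolve_left fun hq => (lt_of_mem_ls hW hq).not_gt hjq
      exact .inl (lt_lt_of_right_between hW h (((right_between hW h).2 q).2 (.inr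
        ⟨mem_allBlocks (left_mem_block.2 hq), pos_base_lt_left hW hq,
          pos_lt_of_lt hW hji (left_mem_block.2 hq) (right_mem_block.2 h)⟩)))
    · have hji := lt_of_mem_rs hW h
      have hjq : ¬ j < q := fun hjq => (hqi.1 hjq).not_gt hji
      have hq := hq.resolve_right fun hq => hjq (lt_of_mem_rs hW hq)
      exact .inr (lt_lt_of_left_between hW h (((left_between hW h).2 q).2 (.inl
        ⟨mem_allBlocks (right_mem_block.2 hq),
          pos_lt_of_lt hW hji (left_mem_block.2 h) (right_mem_block.2 hq),
          pos_right_lt_base hW hq⟩)))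

/-- If `j < j'` occurred in this order among the left dependents of `i`, then `base j'`, but not
`right j'`, would lie between the matched wires `base j` and `right j`. -/
theorem sorted_ls (i : Fin n) : (ls i).SortedGT := by
  rw [List.sortedGT_iff_pairwise, List.pairwise_iff_forall_sublist]
  intro j j' hjj
  have hj : j ∈ ls i := hjj.subset (by simp)
  have hj' : j' ∈ ls i := hjj.subset (by simp)
  have h1 : pos (allBlocks ls rs) (.right j) < pos (allBlocks ls rs) (.right j') :=
    pos_lt_of_sublist_block hW ((hjj.map Wire.right).trans (List.sublist_append_left _ _))
  by_contra! hlt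
  obtain rfl | hlt := hlt.eq_or_lt
  · omega
  obtain hb | hb := ((right_between hW hj).2 j').1
    (right_between_block hW hj hlt (lt_of_mem_ls hW hj') (base_mem_block.2 rfl))
  · have := hb.2.2
    omega
  · obtain ⟨k, hk⟩ := mem_allBlocks_iff.1 hb.1
    exact not_mem_rs_of_mem_ls hW hj' (left_mem_block.1 hk)

/-- If `j < j'` occurred in this order among the right dependents of `i`, then `base j`, but not
`left j`, would lie between the matched wires `left j'` and `base j'`. -/
theorem sorted_rs (i : Fin n) : (rs i).SortedGT := by
  rw [List.sortedGT_iff_pairwise, List.pairwise_iff_forall_sublist]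
  intro j j' hjj
  have hj : j ∈ rs i := hjj.subset (by simp)
  have hj' : j' ∈ rs i := hjj.subset (by simp)
  have h1 : pos (allBlocks ls rs) (.left j) < pos (allBlocks ls rs) (.left j') :=
    pos_lt_of_sublist_block hW (((hjj.map Wire.left).trans (List.sublist_cons_self _ _)).trans
      (List.sublist_append_right _ _))
  by_contra! hlt
  obtain rfl | hlt := hlt.eq_or_lt
  · omega
  obtain hb | hb := ((left_between hW hj').2 j).1
    (left_between_block hW hj' (lt_of_mem_rs hW hj) hlt (base_mem_block.2 rfl))
  · obtain ⟨k, hk⟩ := mem_allBlocks_iff.1 hb.1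
    exact not_mem_rs_of_mem_ls hW (right_mem_block.1 hk) hj
  · have := hb.2.1
    omega

theorem leftDeps_eq (i : Fin n) :
    DependencyGrammar.leftDeps (fun j i => j ∈ ls i ∨ j ∈ rs i) i = ls i := by
  refine List.SortedGT.eq_of_mem_iff ?_ (sorted_ls hW i) fun j => ?_
  · exact ((List.sortedLT_finRange n).reverse.pairwise.filter _).sortedGT
  · simp only [DependencyGrammar.leftDeps, List.mem_filter, List.mem_reverse, List.mem_finRange,
      true_and, decide_eq_true_eq]
    exact ⟨fun h => h.1.resolve_right fun h' => (lt_of_mem_rs hW h').not_gt h.2,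
      fun h => ⟨.inl h, lt_of_mem_ls hW h⟩⟩

theorem rightDeps_eq (i : Fin n) :
    DependencyGrammar.rightDeps (fun j i => j ∈ ls i ∨ j ∈ rs i) i = rs i := by
  refine List.SortedGT.eq_of_mem_iff ?_ (sorted_rs hW i) fun j => ?_
  · exact ((List.sortedLT_finRange n).reverse.pairwise.filter _).sortedGT
  · simp only [DependencyGrammar.rightDeps, List.mem_filter, List.mem_reverse, List.mem_finRange,
      true_and, decide_eq_true_eq]
    exact ⟨fun h => h.1.resolve_left fun h' => (lt_of_mem_ls hW h').not_gt h.2,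
      fun h => ⟨.inr h, lt_of_mem_rs hW h⟩⟩

end

end Wire

/-! ### Every reduction is drawn by a dependency relation -/

theorem comp_comp_comp {C : Type*} [Category C] {X₁ X₂ X₃ X₄ X₅ : C} (f : X₁ ⟶ X₂) (g : X₂ ⟶ X₃)
    (h : X₃ ⟶ X₄) (k : X₄ ⟶ X₅) : (f ≫ g) ≫ h ≫ k = f ≫ (g ≫ h) ≫ k := by
  simp only [Category.assoc]

namespace DependencyGrammar

open RC RC.Strand PregroupGrammar

variable {V : Type u} {B : Type v} {G : DependencyGrammar V B}

theorem _root_.PType.allAtoms_tensorList {X : Type*} {p : X → Prop} (l : List (PType X))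
    (h : ∀ t ∈ l, t.AllAtoms p) : (PType.tensorList l).AllAtoms p := by
  induction l with
  | nil => exact trivial
  | cons t l ih => exact ⟨h t (by simp), ih fun t ht => h t (by simp [ht])⟩

theorem SentenceReserved.terminal (hG : G.SentenceReserved) : G.toPregroup.Terminal where
  lexicon := by
    rintro ⟨a, _⟩ ⟨x, y, z, ht, hr, rfl⟩
    refine PType.allAtoms_tensorList _ fun t h => ?_
    simp only [List.mem_append, List.mem_map, List.mem_cons] at h
    obtain ⟨b, hb, rfl⟩ | rfl | ⟨b, hb, rfl⟩ := h
    · exact fun e : b = G.sentence => (hG.not_dependent x y z hr).1 (e ▸ hb)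
    · exact fun e : x = G.sentence => hG.not_typing a (e ▸ ht)
    · exact fun e : b = G.sentence => (hG.not_dependent x y z hr).2 (e ▸ hb)
  induced := fun e he => ⟨fun h : e.1 = G.sentence => hG.not_governs (h ▸ he.1), he.2⟩

/-- The slots of the lexical entry of an operadic type. -/
def slots {ι : Type} (y z : ι → List B) (j : ι) : List (Slot ι B) :=
  (y j).map .right ++ .base j :: (z j).map .left

/-- The simple types of operadic lexical entries are the simple types of their slots. -/
theorem entries_eq {ι : Type} {w : ι → V} {P : PregroupGrammar V B} {t : ∀ j, P.Entry w j}
    {x : ι → B} {y z : ι → List B} (h : ∀ j, (t j).1 = PType.operadic (x j) (y j) (z j))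
    (js : List ι) :
    entries js (fun j _ => t j) = Slot.strand P x (js.flatMap (slots y z)) := by
  have key (Q : List (Slot ι B)) (l : List (Slot ι B)) (l' : List (PType B))
      (hl : List.Forall₂ (fun q t => ∀ Y : Strand P.signature,
        ((typeSeq P.signature (t.map .inl)).E 0).obj Y = Strand.cons (q.simple x) Y) l l') :
      ((typeSeq P.signature ((PType.tensorList l').map .inl)).E 0).obj (Slot.strand P x Q) =
        Slot.strand P x (l ++ Q) := by
    induction hl with
    | nil => rfl
    | cons h _ ih => exact (h _).trans (congrArg (Strand.cons _) ih)
  induction js with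
  | nil => rfl
  | cons j js ih =>
    have h1 : ((typeSeq P.signature ((PType.operadic (x j) (y j) (z j)).map .inl)).E 0).obj
        (Slot.strand P x (js.flatMap (slots y z))) =
          Slot.strand P x (slots y z j ++ js.flatMap (slots y z)) := by
      refine key _ _ _ ?_
      refine List.rel_append (R := fun (q : Slot ι B) (t : PType B) => ∀ Y : Strand P.signature,
        ((typeSeq P.signature (t.map .inl)).E 0).obj Y = Strand.cons (q.simple x) Y) ?_
        (.cons (fun Y => rfl) ?_)
      · rw [List.forall₂_map_left_iff, List.forall₂_map_right_iff, List.forall₂_same]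
        exact fun b _ Y => rfl
      · rw [List.forall₂_map_left_iff, List.forall₂_map_right_iff, List.forall₂_same]
        exact fun b _ Y => rfl
    rw [List.flatMap_cons, ← h1, ← h j, ← ih]
    rfl

/-- A list whose image is a concatenation of blocks is itself a concatenation of blocks. -/
theorem _root_.List.exists_of_map_eq_flatMap {ι α β : Type*} [DecidableEq ι] {f : α → β}
    {g : ι → List β} (js : List ι) (hjs : js.Nodup) (W : List α) (h : W.map f = js.flatMap g) :
    ∃ W' : ι → List α, W = js.flatMap W' ∧ ∀ j ∈ js, (W' j).map f = g j := by
  induction js generalizing W with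
  | nil => exact ⟨fun _ => [], by simpa using h, by simp⟩
  | cons j js ih =>
    obtain ⟨hj, hjs⟩ := List.nodup_cons.1 hjs
    obtain ⟨L, R, rfl, hL, hR⟩ := List.map_eq_append_iff.1 (h.trans List.flatMap_cons)
    obtain ⟨W', rfl, h'⟩ := ih hjs R hR
    refine ⟨Function.update W' j L, ?_, fun i hi => ?_⟩
    · rw [List.flatMap_cons, Function.update_self]
      congr 1
      refine List.flatMap_congr fun i hi => ?_
      rw [Function.update_of_ne (fun e : i = j => hj (e ▸ hi))]
    · by_cases e : i = j
      · subst e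
        rwa [Function.update_self]
      · rw [Function.update_of_ne e]
        exact h' i ((List.mem_cons.1 hi).resolve_left e)

/-- A labelling of the slots of all lexical entries consists of lists of dependents. -/
theorem exists_block {n : ℕ} {x : Fin n → B} {y z : Fin n → List B} {W : List (Wire (Fin n))}
    (h : W.map (Slot.erase x) = (List.finRange n).flatMap (slots y z)) :
    ∃ ls rs : Fin n → List (Fin n), W = Wire.allBlocks ls rs ∧
      (∀ i, (ls i).map x = y i) ∧ ∀ i, (rs i).map x = z i := by
  obtain ⟨W', rfl, h'⟩ := List.exists_of_map_eq_flatMap _ (List.nodup_finRange n) W h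
  have hr (L : List (Wire (Fin n))) (y : List B) (e : L.map (Slot.erase x) = y.map .right) :
      ∃ l : List (Fin n), L = l.map .right ∧ l.map x = y := by
    induction L generalizing y with
    | nil => exact ⟨[], rfl, by simpa using e.symm⟩
    | cons a L ih =>
      cases y with
      | nil => cases e
      | cons b y =>
        obtain ⟨e1, e2⟩ := List.cons.inj e
        obtain ⟨l, rfl, rfl⟩ := ih y e2
        cases a with
        | right i =>
          cases e1
          exact ⟨i :: l, rfl, rfl⟩
        | base => cases e1
        | left => cases e1
  have hl (L : List (Wire (Fin n))) (y : List B) (e : L.map (Slot.erase x) = y.map .left) :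
      ∃ l : List (Fin n), L = l.map .left ∧ l.map x = y := by
    induction L generalizing y with
    | nil => exact ⟨[], rfl, by simpa using e.symm⟩
    | cons a L ih =>
      cases y with
      | nil => cases e
      | cons b y =>
        obtain ⟨e1, e2⟩ := List.cons.inj e
        obtain ⟨l, rfl, rfl⟩ := ih y e2
        cases a with
        | left i =>
          cases e1
          exact ⟨i :: l, rfl, rfl⟩
        | base => cases e1
        | right => cases e1
  have key (i : Fin n) : ∃ l r : List (Fin n), W' i = l.map .right ++ .base i :: r.map .left ∧
      l.map x = y i ∧ r.map x = z i := by
    obtain ⟨L, R, e, hL, hR⟩ := List.map_eq_append_iff.1 (h' i (List.mem_finRange i))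
    obtain ⟨a, R, rfl, ha, hR⟩ := List.map_eq_cons_iff.1 hR
    obtain ⟨l, rfl, h1⟩ := hr L _ hL
    obtain ⟨r, rfl, h2⟩ := hl R _ hR
    cases a with
    | base j =>
      cases ha
      exact ⟨l, r, e, h1, h2⟩
    | right => cases ha
    | left => cases ha
  choose ls rs e h1 h2 using key
  exact ⟨ls, rs, List.flatMap_congr fun i _ => e i, h1, h2⟩

/-- A matching of wires that reduces them to one symbol comes from a dependency relation. -/
theorem exists_wires_eq {n : ℕ} {w : Fin n → V} {x : Fin n → B} {ls rs : Fin n → List (Fin n)}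
    {h : Fin n} (hx : ∀ i, G.typing (w i) (x i))
    (hr : ∀ i, G.rule (x i) ((ls i).map x) ((rs i).map x)) (hh : G.governs (x h))
    (hW : Wire.Contracts (Wire.allBlocks ls rs) [.base h]) :
    ∃ D : G.DependencyRelation w, D.x = x ∧ D.wires = Wire.block ls rs ∧ ∀ j, ¬ D.d h j := by
  have hd := Wire.nested hW
  have hroot (j : Fin n) : ¬ (h ∈ ls j ∨ h ∈ rs j) :=
    fun hj => hj.elim (Wire.root_not_mem hW j).1 (Wire.root_not_mem hW j).2
  refine ⟨{ x := x
            d := fun j i => j ∈ ls i ∨ j ∈ rs i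
            typing := hx
            acyclic := hd.acyclic
            monogamous := fun i j k h h' => hd.functional h h'
            planar := hd.planar
            rooted := ⟨h, hroot, hh, fun h' hh' => ?_⟩
            allowed := fun i => ?_ }, rfl, ?_, hroot⟩
  · by_contra hne
    obtain ⟨i, hi⟩ := Wire.exists_head hW hne
    exact hh' i hi
  · rw [Wire.leftDeps_eq hW, Wire.rightDeps_eq hW]
    exact hr i
  · funext i
    simp only [DependencyRelation.wires, Wire.block, Wire.leftDeps_eq hW, Wire.rightDeps_eq hW]

/-- Every reduction has a normal form, whose cups determine the dependency relation that draws
it. -/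
theorem exists_draws (hG : G.SentenceReserved) {n : ℕ} {w : Fin n → V}
    (g : G.toPregroup.Reduction w) : ∃ D : G.DependencyRelation w, D.Draws g := by
  obtain ⟨t, b, hb, u, hu, hg⟩ := exists_entries hG.terminal g
  choose x y z hx hr ht using fun j => (t j).2
  obtain ⟨h, W, k, c, rfl, hW, hk, hc, k', hk', e⟩ :=
    exists_cups_label (x := x) hu rfl _ (entries_eq ht (List.finRange n))
  obtain ⟨ls, rs, hWb, hls, hrs⟩ := exists_block hW
  obtain ⟨D, rfl, hD, hroot⟩ := exists_wires_eq (w := w) hx (fun i => by rw [hls, hrs]; exact hr i)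
    hb.1 (hWb ▸ hc.contracts)
  obtain rfl : t = D.entry := by
    funext i
    refine Subtype.ext ((ht i).trans ?_)
    simp [DependencyRelation.entry, hD, Wire.listType, Wire.block, PType.operadic, ← hls, ← hrs,
      Wire.type, Function.comp_def]
  obtain rfl : W = (List.finRange n).flatMap D.wires := by rw [hWb, hD]
  obtain ⟨k₂, hk₂, e₂⟩ := D.lexical_eq (List.finRange n)
  obtain rfl := hk.unique hk₂
  refine ⟨D, h, hb.1, c, hroot, hc, ?_⟩
  cases hk' with | base _ hk' =>
  cases hk'
  have e' : k ≫ hom u = c := e.trans ((congrArg (fun f => c ≫ f)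
    (whiskerLeft_id (C := G.toPregroup.Cat) _ _)).trans
      (Category.comp_id (obj := G.toPregroup.Cat) _))
  rw [hg, ← e', reassoc_of% e₂]
  exact comp_comp_comp (C := G.toPregroup.Cat) _ _ _ _

end DependencyGrammar

/-! ### Every dependency relation draws exactly one reduction -/

namespace Wire

variable {V : Type u} {B : Type v} {ι : Type} {P : PregroupGrammar V B} {x : ι → B}

/-- No symbol occurs as a dependent both from the left and from the right. Then no
two cups compete for the same wire. -/
def Linear (W : List (Wire ι)) : Prop := ∀ i, .right i ∈ W → .left i ∉ W

theorem Cup.subset {W W' : List (Wire ι)} {f : obj P x W ⟶ obj P x W'} (h : Cup P x W W' f) :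
    W' ⊆ W := by
  induction h with
  | right i W => exact List.Subset.trans (List.subset_cons_self _ _) (List.subset_cons_self _ _)
  | left i W => exact List.Subset.trans (List.subset_cons_self _ _) (List.subset_cons_self _ _)
  | cons a _ ih => exact List.cons_subset_cons a ih

theorem Linear.mono {W W' : List (Wire ι)} (h : Linear W) (hW : W' ⊆ W) : Linear W' :=
  fun i hi hi' => h i (hW hi) (hW hi')

/-- Two different cups on a sequence of wires commute. -/
theorem Cup.diamond {W W₁ W₂ : List (Wire ι)} {f : obj P x W ⟶ obj P x W₁}
    {g : obj P x W ⟶ obj P x W₂} (hW : Linear W) (hf : Cup P x W W₁ f) (hg : Cup P x W W₂ g) :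
    (⟨W₁, f⟩ : Σ W', obj P x W ⟶ obj P x W') = ⟨W₂, g⟩ ∨
      ∃ W₃ f' g', Cup P x W₁ W₃ f' ∧ Cup P x W₂ W₃ g' ∧ f ≫ f' = g ≫ g' := by
  induction hf generalizing W₂ with
  | right i W =>
    cases hg with
    | right => exact .inl rfl
    | cons _ hg =>
      cases hg with
      | cons _ hg =>
        exact .inr ⟨_, _, _, hg, .right i _, (contract_naturality (C := P.Cat)
          (RC.radj (S := P.signature) (P.ofType (.atom (x i)))) (P.ofType (.atom (x i))) _).symm⟩
  | left i W =>
    cases hg with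
    | left => exact .inl rfl
    | cons _ hg =>
      cases hg with
      | right => exact absurd (List.mem_cons_self) (hW i (by simp))
      | cons _ hg =>
        exact .inr ⟨_, _, _, hg, .left i _, (contract_naturality (C := P.Cat)
          (P.ofType (.atom (x i))) (RC.ladj (S := P.signature) (P.ofType (.atom (x i)))) _).symm⟩
  | @cons a W W₁ f hf ih =>
    cases hg with
    | right i W =>
      cases hf with
      | cons _ hf =>
        exact .inr ⟨_, _, _, .right i _, hf, contract_naturality (C := P.Cat)
          (RC.radj (S := P.signature) (P.ofType (.atom (x i)))) (P.ofType (.atom (x i))) _⟩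
    | left i W =>
      cases hf with
      | right => exact absurd (List.mem_cons_self) (hW i (by simp))
      | cons _ hf =>
        exact .inr ⟨_, _, _, .left i _, hf, contract_naturality (C := P.Cat)
          (P.ofType (.atom (x i))) (RC.ladj (S := P.signature) (P.ofType (.atom (x i)))) _⟩
    | cons _ hg =>
      obtain h | ⟨W₃, f', g', hf', hg', e⟩ := ih (hW.mono (List.subset_cons_self _ _)) hg
      · obtain ⟨rfl, h⟩ := Sigma.mk.inj h
        obtain rfl := eq_of_heq h
        exact .inl rfl
      · refine .inr ⟨_, _, _, hf'.cons a, hg'.cons a, ?_⟩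
        exact (whiskerLeft_comp (C := P.Cat) _ _ _).symm.trans
          ((congrArg (fun f => _ ◁ f) e).trans (whiskerLeft_comp (C := P.Cat) _ _ _))

theorem not_cup_singleton {a : Wire ι} {W : List (Wire ι)} {f : obj P x [a] ⟶ obj P x W} :
    ¬ Cup P x [a] W f := by
  intro h
  cases h with
  | cons _ h => cases h

/-- Any cup can be applied first. -/
theorem Cups.factor {W W₂ T : List (Wire ι)} {c : obj P x W ⟶ obj P x T}
    {g : obj P x W ⟶ obj P x W₂} (hW : Linear W) (hc : Cups P x W T c) {a : Wire ι} (hT : T = [a])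
    (hg : Cup P x W W₂ g) : ∃ c₂, Cups P x W₂ T c₂ ∧ c = g ≫ c₂ := by
  induction hc generalizing W₂ with
  | id T =>
    subst hT
    exact absurd hg not_cup_singleton
  | @comp W W₁ T f c hf hc ih =>
    obtain h | ⟨W₃, f', g', hf', hg', e⟩ := hf.diamond hW hg
    · obtain ⟨rfl, h⟩ := Sigma.mk.inj h
      obtain rfl := eq_of_heq h
      exact ⟨c, hc, rfl⟩
    · obtain ⟨c₃, hc₃, rfl⟩ := ih (hW.mono hf.subset) hT hf'
      exact ⟨g' ≫ c₃, .comp hg' hc₃, by rw [reassoc_of% e]⟩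

/-- The composite of cups does not depend on the order in which they are applied. -/
theorem Cups.unique {W T : List (Wire ι)} {c c' : obj P x W ⟶ obj P x T} (hW : Linear W)
    {a : Wire ι} (hT : T = [a]) (hc : Cups P x W T c) (hc' : Cups P x W T c') : c = c' := by
  induction hc with
  | id T =>
    subst hT
    cases hc' with
    | id => rfl
    | comp h _ => exact absurd h not_cup_singleton
  | @comp W W₁ T f c hf hc ih =>
    obtain ⟨c₂, hc₂, rfl⟩ := hc'.factor hW hT hf
    rw [ih (hW.mono hf.subset) hT hc₂]

variable (P x) in
theorem Contract.exists_cup {W W' : List (Wire ι)} (h : Contract W W') :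
    ∃ f, Cup P x W W' f := by
  cases h with
  | right i L R =>
    induction L with
    | nil => exact ⟨_, .right i R⟩
    | cons a L ih =>
      obtain ⟨f, hf⟩ := ih
      exact ⟨_, hf.cons a⟩
  | left i L R =>
    induction L with
    | nil => exact ⟨_, .left i R⟩
    | cons a L ih =>
      obtain ⟨f, hf⟩ := ih
      exact ⟨_, hf.cons a⟩

variable (P x) in
theorem Contracts.exists_cups {W W' : List (Wire ι)} (h : Contracts W W') :
    ∃ c, Cups P x W W' c := by
  induction h with
  | refl W => exact ⟨_, .id W⟩
  | step h _ ih =>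
    obtain ⟨f, hf⟩ := h.exists_cup P x
    obtain ⟨c, hc⟩ := ih
    exact ⟨_, .comp hf hc⟩

/-- The label of a wire. -/
def label : Wire ι → ι
  | base i => i
  | right i => i
  | left i => i

/-- Two matched wires are adjacent once the wires between them are removed. -/
theorem Match.contract_filter [DecidableEq ι] {a b : Wire ι} (hab : Match a b) {j : ι}
    (ha : a.label = j) (hb : b.label = j)
    (A : Finset ι) (hj : j ∈ A) (L M R : List (Wire ι)) (hL : ∀ c ∈ L, c.label ≠ j)
    (hM : ∀ c ∈ M, c.label ∉ A) (hR : ∀ c ∈ R, c.label ≠ j) :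
    Contract ((L ++ a :: (M ++ b :: R)).filter fun c => c.label ∈ A)
      ((L ++ a :: (M ++ b :: R)).filter fun c => c.label ∈ A.erase j) := by
  have hM' : ∀ c ∈ M, c.label ∉ A.erase j := fun c hc h => hM c hc (Finset.mem_of_mem_erase h)
  have h1 : M.filter (fun c => c.label ∈ A) = [] := by simpa using hM
  have h2 : M.filter (fun c => c.label ∈ A.erase j) = [] :=
    List.filter_eq_nil_iff.2 fun c hc => by simpa using hM' c hc
  have h3 : L.filter (fun c => c.label ∈ A.erase j) = L.filter fun c => c.label ∈ A :=
    List.filter_congr fun c hc => by simp [hL c hc]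
  have h4 : R.filter (fun c => c.label ∈ A.erase j) = R.filter fun c => c.label ∈ A :=
    List.filter_congr fun c hc => by simp [hR c hc]
  rw [List.filter_append, List.filter_append, List.filter_cons_of_pos (by simpa [ha] using hj),
    List.filter_cons_of_neg (by simp [ha]), List.filter_append, List.filter_append,
    List.filter_cons_of_pos (by simpa [hb] using hj), List.filter_cons_of_neg (by simp [hb]),
    h1, h2, h3, h4]
  exact hab.contract _ _

end Wire

namespace DependencyGrammar

variable {V : Type u} {B : Type v} {G : DependencyGrammar V B} {n : ℕ} {w : Fin n → V}

theorem mem_leftDeps {d : Fin n → Fin n → Prop} {i j : Fin n} :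
    j ∈ leftDeps d i ↔ d j i ∧ j < i := by simp [leftDeps]

theorem mem_rightDeps {d : Fin n → Fin n → Prop} {i j : Fin n} :
    j ∈ rightDeps d i ↔ d j i ∧ i < j := by simp [rightDeps]

theorem sortedGT_leftDeps (d : Fin n → Fin n → Prop) (i : Fin n) : (leftDeps d i).SortedGT :=
  ((List.sortedLT_finRange n).reverse.pairwise.filter _).sortedGT

theorem sortedGT_rightDeps (d : Fin n → Fin n → Prop) (i : Fin n) : (rightDeps d i).SortedGT :=
  ((List.sortedLT_finRange n).reverse.pairwise.filter _).sortedGT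

namespace DependencyRelation

variable (D : G.DependencyRelation w)

/-- Acyclicity, in terms of the reflexive transitive closure. -/
theorem antisymm {i j : Fin n} (h : Relation.ReflTransGen D.d i j)
    (h' : Relation.ReflTransGen D.d j i) : i = j := by
  obtain rfl | h := Relation.reflTransGen_iff_eq_or_transGen.1 h
  · rfl
  · exact absurd (h.trans_left h') (D.acyclic i)

/-- Planarity forbids arcs that leave the space below another arc, since they would create a
cycle. -/
theorem nested : Nested D.d where
  ne := by
    rintro j _ h rfl
    exact D.acyclic j (.single h)
  functional h h' := D.monogamous _ _ _ h h'
  head {j i} h k hk := by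
    have hki := D.planar j k i (by simp only [Amid] at hk; omega) (.single h)
    obtain rfl | ⟨k', hkk, hki'⟩ := hki.cases_head
    · simp [Amid] at hk
    refine ⟨k', hkk, ?_⟩
    by_contra hn
    have hc : ((k ≤ i ∧ i ≤ k') ∨ (k' ≤ i ∧ i ≤ k)) ∨ ((k ≤ j ∧ j ≤ k') ∨ (k' ≤ j ∧ j ≤ k)) := by
      simp only [Amid] at hn hk
      omega
    obtain hc | hc := hc
    · have := D.antisymm (D.planar _ _ _ hc (.single hkk)) hki'
      exact hn (.inr (.inr this.symm))
    · obtain rfl | ⟨i', hi', hik⟩ := (D.planar _ _ _ hc (.single hkk)).cases_head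
      · exact hn (.inr (.inl rfl))
      · obtain rfl := D.monogamous _ _ _ h hi'
        exact hn (.inr (.inr (D.antisymm hik hki').symm))
  dependent {j i} h k hk q hq := by
    have hki := D.planar j k i (by simp only [Amid] at hk; omega) (.single h)
    have hne : k ≠ i := by
      rintro rfl
      simp [Amid] at hk
    by_contra hn
    have hc : ((q ≤ i ∧ i ≤ k) ∨ (k ≤ i ∧ i ≤ q)) ∨ ((q ≤ j ∧ j ≤ k) ∨ (k ≤ j ∧ j ≤ q)) := by
      simp only [Amid] at hn hk
      omega
    obtain hc | hc := hc
    · exact hne (D.antisymm hki (D.planar _ _ _ hc (.single hq)))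
    · obtain rfl | ⟨i', hi', hik⟩ := (D.planar _ _ _ hc (.single hq)).cases_head
      · simp [Amid] at hk
      · obtain rfl := D.monogamous _ _ _ h hi'
        exact hne (D.antisymm hki hik)
  dependent_left {j i q} h hq hqi := by
    by_contra hn
    have hqj : q ≠ j := by
      rintro rfl
      exact D.acyclic q (.single hq)
    have hc : (q ≤ i ∧ i ≤ j) ∨ (j ≤ i ∧ i ≤ q) := by
      simp only [Amid] at hn
      omega
    have := D.antisymm (.single h) (D.planar _ _ _ hc (.single hq))
    exact D.acyclic j (.single (this ▸ h))

/-- All wires of the lexical entries. -/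
noncomputable abbrev allWires : List (Wire (Fin n)) := (List.finRange n).flatMap D.wires

theorem linear : Wire.Linear D.allWires := by
  intro j hj hj'
  simp only [List.mem_flatMap, List.mem_finRange, true_and, wires, List.mem_append, List.mem_map,
    List.mem_cons, mem_leftDeps, mem_rightDeps] at hj hj'
  obtain ⟨i, hi⟩ := hj
  obtain ⟨k, hk⟩ := hj'
  simp at hi hk
  have := D.monogamous _ _ _ hi.1 hk.1
  omega

theorem label_wires {k j : Fin n} {a : Wire (Fin n)} (ha : a ∈ D.wires k) (hj : a.label = j) :
    j = k ∨ D.d j k := by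
  simp only [wires, List.mem_append, List.mem_map, List.mem_cons, mem_leftDeps, mem_rightDeps] at ha
  obtain ⟨q, hq, rfl⟩ | rfl | ⟨q, hq, rfl⟩ := ha
  · exact .inr (hj ▸ hq.1)
  · exact .inl hj.symm
  · exact .inr (hj ▸ hq.1)

theorem _root_.List.exists_eq_append_of_mem_pairwise {α : Type*} {r : α → α → Prop} {l : List α}
    (hl : l.Pairwise r) {a : α} (ha : a ∈ l) :
    ∃ L R, l = L ++ a :: R ∧ (∀ b ∈ L, r b a) ∧ ∀ b ∈ R, r a b := by
  obtain ⟨L, R, rfl⟩ := List.append_of_mem ha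
  obtain ⟨-, h1, h2⟩ := List.pairwise_append.1 hl
  exact ⟨L, R, rfl, fun b hb => h2 b hb a (by simp), (List.pairwise_cons.1 h1).1⟩

theorem _root_.List.finRange_eq_of_lt {i j : Fin n} (h : i < j) :
    ∃ L M R, List.finRange n = L ++ i :: (M ++ j :: R) ∧ (∀ k ∈ L, k < i) ∧
      (∀ k ∈ M, i < k ∧ k < j) ∧ ∀ k ∈ R, j < k := by
  have hs := (List.sortedLT_finRange n).pairwise
  obtain ⟨L, R, e, hL, hR⟩ := List.exists_eq_append_of_mem_pairwise hs (List.mem_finRange i)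
  have hj : j ∈ R := by
    have := List.mem_finRange j
    rw [e, List.mem_append, List.mem_cons] at this
    obtain h' | rfl | h' := this
    · exact absurd (hL j h') h.not_gt
    · exact absurd h (lt_irrefl _)
    · exact h'
  rw [e] at hs
  obtain ⟨M, R, rfl, hM, hR'⟩ := List.exists_eq_append_of_mem_pairwise
    (List.pairwise_cons.1 (List.pairwise_append.1 hs).2.1).2 hj
  exact ⟨L, M, R, e, hL, fun k hk => ⟨hR k (by simp [hk]), hM k hk⟩, hR'⟩

/-- An arc can be contracted if the symbols below it are already contracted. -/
theorem contract_arc {j i : Fin n} (hd : D.d j i) (A : Finset (Fin n)) (hj : j ∈ A)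
    (hA : ∀ q, Amid j i q → q ∉ A) :
    Wire.Contract (D.allWires.filter fun a => a.label ∈ A)
      (D.allWires.filter fun a => a.label ∈ A.erase j) := by
  have hN := D.nested
  have hother {k : Fin n} (hk : k ≠ i) (hk' : k ≠ j) : ∀ a ∈ D.wires k, a.label ≠ j := by
    intro a ha e
    obtain rfl | h := D.label_wires ha e
    · exact hk' rfl
    · exact hk (D.monogamous _ _ _ h hd)
  have hamid {k : Fin n} (hk : Amid j i k) : ∀ a ∈ D.wires k, a.label ∉ A := by
    intro a ha
    obtain h | h := D.label_wires ha rfl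
    · exact h ▸ hA k hk
    · exact hA _ (hN.dependent hd hk h)
  have hself (q : Fin n) (hq : D.d q j) : q ≠ j := hN.ne hq
  have hdl {q : Fin n} (h : D.d q j) (hq : j < q ↔ j < i) := hA q (hN.dependent_left hd h hq)
  obtain hji | hij := lt_or_gt_of_ne (hN.ne hd)
  · obtain ⟨L, M, R, e, hL, hM, hR⟩ := List.finRange_eq_of_lt hji
    obtain ⟨l, l', el, hl, hl'⟩ := List.exists_eq_append_of_mem_pairwise
      (sortedGT_leftDeps D.d i).pairwise (mem_leftDeps.2 ⟨hd, hji⟩)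
    have hw : D.allWires = (L.flatMap D.wires ++ (leftDeps D.d j).map .right) ++ .base j ::
        (((rightDeps D.d j).map .left ++ (M.flatMap D.wires ++ l.map .right)) ++
          .right j :: (l'.map .right ++ .base i :: ((rightDeps D.d i).map .left ++
            R.flatMap D.wires))) := by
      simp [allWires, e, wires, el]
    rw [hw]
    refine (Wire.Match.right j).contract_filter rfl rfl A hj _ _ _ ?_ ?_ ?_
    · intro a ha
      simp only [List.mem_append, List.mem_flatMap, List.mem_map] at ha
      obtain ⟨k, hk, ha⟩ | ⟨q, hq, rfl⟩ := ha
      · exact hother ((hL k hk).trans hji).ne (hL k hk).ne a ha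
      · exact hself q (mem_leftDeps.1 hq).1
    · intro a ha
      simp only [List.mem_append, List.mem_flatMap, List.mem_map] at ha
      obtain ⟨q, hq, rfl⟩ | ⟨k, hk, ha⟩ | ⟨q, hq, rfl⟩ := ha
      · obtain ⟨hq, hjq⟩ := mem_rightDeps.1 hq
        exact hdl hq (iff_of_true hjq hji)
      · exact hamid (.inl (hM k hk)) a ha
      · have : q ∈ leftDeps D.d i := by simp [el, hq]
        exact hA q (.inl ⟨hl q hq, (mem_leftDeps.1 this).2⟩)
    · intro a ha
      simp only [List.mem_append, List.mem_flatMap, List.mem_map, List.mem_cons] at ha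
      obtain ⟨q, hq, rfl⟩ | rfl | ⟨q, hq, rfl⟩ | ⟨k, hk, ha⟩ := ha
      · exact (hl' q hq).ne
      · exact hji.ne'
      · exact (hji.trans (mem_rightDeps.1 hq).2).ne'
      · exact hother (hR k hk).ne' (hji.trans (hR k hk)).ne' a ha
  · obtain ⟨L, M, R, e, hL, hM, hR⟩ := List.finRange_eq_of_lt hij
    obtain ⟨l, l', el, hl, hl'⟩ := List.exists_eq_append_of_mem_pairwise
      (sortedGT_rightDeps D.d i).pairwise (mem_rightDeps.2 ⟨hd, hij⟩)
    have hw : D.allWires = (L.flatMap D.wires ++ ((leftDeps D.d i).map .right ++ .base i ::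
        l.map .left)) ++ .left j :: ((l'.map .left ++ (M.flatMap D.wires ++
          (leftDeps D.d j).map .right)) ++ .base j :: ((rightDeps D.d j).map .left ++
            R.flatMap D.wires)) := by
      simp [allWires, e, wires, el]
    rw [hw]
    refine (Wire.Match.left j).contract_filter rfl rfl A hj _ _ _ ?_ ?_ ?_
    · intro a ha
      simp only [List.mem_append, List.mem_flatMap, List.mem_map, List.mem_cons] at ha
      obtain ⟨k, hk, ha⟩ | ⟨q, hq, rfl⟩ | rfl | ⟨q, hq, rfl⟩ := ha
      · exact hother (hL k hk).ne ((hL k hk).trans hij).ne a ha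
      · exact ((mem_leftDeps.1 hq).2.trans hij).ne
      · exact hij.ne
      · exact (hl q hq).ne'
    · intro a ha
      simp only [List.mem_append, List.mem_flatMap, List.mem_map] at ha
      obtain ⟨q, hq, rfl⟩ | ⟨k, hk, ha⟩ | ⟨q, hq, rfl⟩ := ha
      · have : q ∈ rightDeps D.d i := by simp [el, hq]
        exact hA q (.inr ⟨(mem_rightDeps.1 this).2, hl' q hq⟩)
      · exact hamid (.inr (hM k hk)) a ha
      · obtain ⟨hq, hqj⟩ := mem_leftDeps.1 hq
        exact hdl hq (iff_of_false hqj.not_gt hij.not_gt)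
    · intro a ha
      simp only [List.mem_append, List.mem_flatMap, List.mem_map] at ha
      obtain ⟨q, hq, rfl⟩ | ⟨k, hk, ha⟩ := ha
      · exact hself q (mem_rightDeps.1 hq).1
      · exact hother (hij.trans (hR k hk)).ne' (hR k hk).ne' a ha

theorem filter_root {h : Fin n} (hh : ∀ j, ¬ D.d h j) :
    (D.allWires.filter fun a => a.label ∈ ({h} : Finset (Fin n))) = [.base h] := by
  obtain ⟨L, R, e, hL, hR⟩ := List.exists_eq_append_of_mem_pairwise
    (List.sortedLT_finRange n).pairwise (List.mem_finRange h)
  have hother {l : List (Fin n)} (hl : ∀ k ∈ l, k ≠ h) :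
      ((l.flatMap D.wires).filter fun a => a.label ∈ ({h} : Finset (Fin n))) = [] := by
    simp only [List.filter_eq_nil_iff, List.mem_flatMap, decide_eq_true_eq, Finset.mem_singleton]
    rintro a ⟨k, hk, ha⟩ e
    obtain rfl | h' := D.label_wires ha e
    · exact hl _ hk rfl
    · exact hh k h'
  have h1 : ((leftDeps D.d h).map Wire.right).filter
      (fun a => a.label ∈ ({h} : Finset (Fin n))) = [] := by
    simp only [List.filter_eq_nil_iff, List.mem_map, decide_eq_true_eq, Finset.mem_singleton]
    rintro a ⟨q, hq, rfl⟩
    exact (mem_leftDeps.1 hq).2.ne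
  have h2 : ((rightDeps D.d h).map Wire.left).filter
      (fun a => a.label ∈ ({h} : Finset (Fin n))) = [] := by
    simp only [List.filter_eq_nil_iff, List.mem_map, decide_eq_true_eq, Finset.mem_singleton]
    rintro a ⟨q, hq, rfl⟩
    exact (mem_rightDeps.1 hq).2.ne'
  rw [allWires, e, List.flatMap_append, List.flatMap_cons, List.filter_append, List.filter_append,
    wires, List.filter_append, List.filter_cons_of_pos (by simp [Wire.label]), h1, h2,
    hother fun k hk => (hL k hk).ne, hother fun k hk => (hR k hk).ne']
  rfl

/-- The cups can be applied in the order of the lengths of the arcs: all arcs below a given arc are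
shorter than it. The set `A` holds the symbols that are not contracted yet. -/
theorem contracts {h : Fin n} (hh : ∀ j, ¬ D.d h j) : Wire.Contracts D.allWires [.base h] := by
  have hhead (j : Fin n) : ∃ i, j ≠ h → D.d j i := by
    by_contra! hj
    obtain ⟨r, -, -, hr⟩ := D.rooted
    exact (hj h).1 ((hr j fun i => (hj i).2).trans (hr h hh).symm)
  choose f hf using hhead
  suffices H : ∀ (m : ℕ) (A : Finset (Fin n)), h ∈ A → A.card = m + 1 →
      Wire.Contracts (D.allWires.filter fun a => a.label ∈ A) [.base h] by
    have := H (n - 1) Finset.univ (Finset.mem_univ h) (by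
      rw [Finset.card_univ, Fintype.card_fin]
      have := h.pos
      omega)
    simpa using this
  intro m
  induction m with
  | zero =>
    intro A hA hm
    obtain ⟨a, rfl⟩ := Finset.card_eq_one.1 hm
    obtain rfl := Finset.mem_singleton.1 hA
    rw [D.filter_root hh]
    exact .refl _
  | succ m ih =>
    intro A hA hm
    have hne : (A.erase h).Nonempty := by
      rw [← Finset.card_pos, Finset.card_erase_of_mem hA]
      omega
    obtain ⟨j, hj, hmin⟩ := Finset.exists_min_image (A.erase h)
      (fun j => (j.1 - (f j).1) + ((f j).1 - j.1)) hne
    obtain ⟨hjh, hjA⟩ := Finset.mem_erase.1 hj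
    refine .step (D.contract_arc (hf j hjh) A hjA fun q hq hqA => ?_)
      (ih (A.erase j) (Finset.mem_erase.2 ⟨hjh.symm, hA⟩) (by
        rw [Finset.card_erase_of_mem hjA]
        omega))
    obtain ⟨k, hk, hk'⟩ := D.nested.head (hf j hjh) hq
    have hqh : q ≠ h := by
      rintro rfl
      exact hh k hk
    obtain rfl := D.monogamous _ _ _ hk (hf q hqh)
    have := hmin q (Finset.mem_erase.2 ⟨hqh, hqA⟩)
    have hkq := D.nested.ne hk
    simp only [Amid, Fin.lt_def, Fin.ext_iff, ne_eq] at hq hk' hkq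
    omega

theorem Draws.unique {D : G.DependencyRelation w} {g g' : G.toPregroup.Reduction w}
    (h : D.Draws g) (h' : D.Draws g') : g = g' := by
  obtain ⟨h, hg, c, hh, hc, rfl⟩ := h
  obtain ⟨h', hg', c', hh', hc', rfl⟩ := h'
  obtain ⟨r, -, -, hr⟩ := D.rooted
  obtain rfl := (hr h hh).trans (hr h' hh').symm
  obtain rfl := hc.unique D.linear rfl hc'
  rfl

theorem exists_draws_reduction (D : G.DependencyRelation w) :
    ∃ g : G.toPregroup.Reduction w, D.Draws g := by
  obtain ⟨h, hh, hg, -⟩ := D.rooted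
  obtain ⟨c, hc⟩ := (D.contracts hh).exists_cups G.toPregroup D.x
  exact ⟨_, h, hg, c, hh, hc, rfl⟩

end DependencyRelation

end DependencyGrammar

/-! ### Relational semantics -/

namespace RC

variable {X : Type u} {S : RigidSignature.{u, w} X} (I : X → Type)

/-- The set of values of a type. A type and its adjoints have the same values. -/
def Val : PType X → Type
  | .atom a => I a
  | .unit => Unit
  | .tensor t u => Val t × Val u
  | .ladj t => Val t
  | .radj t => Val t

variable {I} (R : ∀ e : S.Edge, Val I (S.dom e) → Val I (S.cod e) → Prop)

/-- The interpretation of formal morphisms as relations, given the relations `R` for the generating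
arrows. Cups and caps are equality. -/
def eval : ∀ {t t' : PType X}, Hom S t t' → Val I t → Val I t' → Prop
  | _, _, .gen e => R e
  | _, _, .id _ => fun p q => p = q
  | _, _, .comp f g => fun p q => ∃ r, eval f p r ∧ eval g r q
  | _, _, .tensor f g => fun p q => eval f p.1 q.1 ∧ eval g p.2 q.2
  | _, _, .α_hom _ _ _ => fun p q => p.1.1 = q.1 ∧ p.1.2 = q.2.1 ∧ p.2 = q.2.2
  | _, _, .α_inv _ _ _ => fun p q => p.1 = q.1.1 ∧ p.2.1 = q.1.2 ∧ p.2.2 = q.2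
  | _, _, .l_hom _ => fun p q => p.2 = q
  | _, _, .l_inv _ => fun p q => p = q.2
  | _, _, .ρ_hom _ => fun p q => p.1 = q
  | _, _, .ρ_inv _ => fun p q => p = q.1
  | _, _, .cupL _ => fun p _ => p.1 = p.2
  | _, _, .capL _ => fun _ q => q.1 = q.2
  | _, _, .cupR _ => fun p _ => p.1 = p.2
  | _, _, .capR _ => fun _ q => q.1 = q.2

theorem Val.exists_tensor {t t' : PType X} {p : Val I (t.tensor t') → Prop} :
    (∃ r, p r) ↔ ∃ (a : Val I t) (b : Val I t'), p (a, b) := Prod.exists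

theorem Val.exists_unit {p : Val I (.unit : PType X) → Prop} : (∃ r, p r) ↔ p () :=
  ⟨fun ⟨_, h⟩ => h, fun h => ⟨_, h⟩⟩

theorem Val.ext_tensor {t t' : PType X} {p q : Val I (t.tensor t')} :
    p = q ↔ p.1 = q.1 ∧ p.2 = q.2 := Prod.ext_iff

theorem Val.ext_unit {p q : Val I (.unit : PType X)} : p = q ↔ True := iff_true_intro rfl

/-- The axioms of rigid categories hold for relations. -/
theorem eval_respects {t t' : PType X} {f g : Hom S t t'} (h : HomEquiv S f g) :
    eval R f = eval R g := by
  induction h with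
  | refl => rfl
  | symm _ ih => exact ih.symm
  | trans _ _ ih ih' => exact ih.trans ih'
  | comp _ _ ih ih' => funext p q; simp only [eval, ih, ih']
  | tensor _ _ ih ih' => funext p q; simp only [eval, ih, ih']
  | snakeL₁ | snakeR₁ =>
    funext p q
    simp only [eval, eq_iff_iff, Val.exists_tensor]
    refine ⟨?_, fun ⟨a, h, h'⟩ => ⟨a, _, _, ⟨h, rfl⟩, a, a, _, ⟨rfl, rfl, rfl⟩, rfl, h'⟩⟩
    rintro ⟨_, _, _, ⟨h₁, h₂⟩, _, _, _, ⟨h₃, h₄, h₅⟩, h₆, h₇⟩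
    exact ⟨_, h₁, h₃.trans (h₆.trans (h₄.symm.trans (h₂.trans (h₅.trans h₇))))⟩
  | snakeL₂ | snakeR₂ =>
    funext p q
    simp only [eval, eq_iff_iff, Val.exists_tensor]
    refine ⟨?_, fun ⟨a, h, h'⟩ => ⟨a, a, _, ⟨rfl, h⟩, _, _, a, ⟨rfl, rfl, rfl⟩, h', rfl⟩⟩
    rintro ⟨_, _, _, ⟨h₁, h₂⟩, _, _, _, ⟨h₃, h₄, h₅⟩, h₆, h₇⟩
    exact ⟨_, h₂, h₅.trans (h₇.symm.trans (h₄.symm.trans (h₁.symm.trans (h₃.trans h₆))))⟩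
  | _ =>
    funext p q
    simp only [eval, eq_iff_iff, Val.exists_tensor, Val.ext_tensor, Val.exists_unit, Val.ext_unit]
    try grind

/-- The interpretation of the morphisms of `RC(S)` as relations. -/
def rel {a b : RC S} (f : a ⟶ b) : Val I a → Val I b → Prop :=
  Quotient.lift (eval R) (fun _ _ h => eval_respects R h) f

theorem rel_id {a : RC S} {p q : Val I a} : rel R (𝟙 a) p q ↔ p = q := Iff.rfl

theorem rel_comp {a b c : RC S} {f : a ⟶ b} {g : b ⟶ c} {p : Val I a} {q : Val I c} :
    rel R (f ≫ g) p q ↔ ∃ r, rel R f p r ∧ rel R g r q := by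
  obtain ⟨f⟩ := f
  obtain ⟨g⟩ := g
  rfl

theorem rel_tensor {a b c d : RC S} {f : a ⟶ b} {g : c ⟶ d} {p : Val I a × Val I c}
    {q : Val I b × Val I d} :
    rel R (f ⊗ₘ g) p q ↔ rel R f p.1 q.1 ∧ rel R g p.2 q.2 := by
  obtain ⟨f⟩ := f
  obtain ⟨g⟩ := g
  rfl

theorem rel_whiskerLeft {a b c : RC S} {f : b ⟶ c} {p : Val I a × Val I b}
    {q : Val I a × Val I c} : rel R (a ◁ f) p q ↔ p.1 = q.1 ∧ rel R f p.2 q.2 := by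
  obtain ⟨f⟩ := f
  rfl

theorem rel_contractR {a c : RC S} {p : Val I a × Val I a × Val I c} {q : Val I c} :
    rel R (contractR a c) p q ↔ p.1 = p.2.1 ∧ p.2.2 = q := by
  change eval R ((Hom.α_inv _ _ _).comp (((Hom.cupR a).tensor (.id c)).comp (.l_hom c))) p q ↔ _
  refine ⟨?_, fun h => ⟨((p.1, p.2.1), p.2.2), ⟨rfl, rfl, rfl⟩, ((), p.2.2), ⟨h.1, rfl⟩, h.2⟩⟩
  rintro ⟨r, ⟨h₁, h₂, h₃⟩, r', ⟨h₄, h₅⟩, h₆⟩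
  exact ⟨h₁.trans (h₄.trans h₂.symm), h₃.trans (h₅.trans h₆)⟩

theorem rel_contractL {a c : RC S} {p : Val I a × Val I a × Val I c} {q : Val I c} :
    rel R (contractL a c) p q ↔ p.1 = p.2.1 ∧ p.2.2 = q := by
  change eval R ((Hom.α_inv _ _ _).comp (((Hom.cupL a).tensor (.id c)).comp (.l_hom c))) p q ↔ _
  refine ⟨?_, fun h => ⟨((p.1, p.2.1), p.2.2), ⟨rfl, rfl, rfl⟩, ((), p.2.2), ⟨h.1, rfl⟩, h.2⟩⟩
  rintro ⟨r, ⟨h₁, h₂, h₃⟩, r', ⟨h₄, h₅⟩, h₆⟩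
  exact ⟨h₁.trans (h₄.trans h₂.symm), h₃.trans (h₅.trans h₆)⟩

end RC

namespace Wire

variable {V : Type u} {B : Type v} {ι : Type}

open RC

/-- Values of the generating objects: a symbol takes an occurrence as its value, a word takes the
sequence of wires of its lexical entry. -/
def Values (V : Type u) (B : Type v) (ι : Type) : B ⊕ V → Type
  | .inl _ => ι
  | .inr _ => List (Wire ι)

/-- The sequence of wires read off from a value of a type. Iterated adjoints, which do not occur in
operadic types, are read as simple adjoints. -/
def ofVal : ∀ t : PType B, Val (Values V B ι) (t.map .inl) → List (Wire ι)
  | .atom _, i => [.base i]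
  | .unit, _ => []
  | .tensor t t', p => ofVal t p.1 ++ ofVal t' p.2
  | .radj t, p => (ofVal t p).map fun a => .right a.label
  | .ladj t, p => (ofVal t p).map fun a => .left a.label

/-- The interpretation of the generating arrows, given the symbols `xᵢ`: a word with a sequence of
wires as its value is related to the values of a lexical entry from which these wires are read off,
provided that the entry is their type. Induced steps are equality. -/
def interp (P : PregroupGrammar V B) (x : ι → B) :
    ∀ e : P.signature.Edge, Val (Values V B ι) (P.signature.dom e) →
      Val (Values V B ι) (P.signature.cod e) → Prop
  | .inl e => fun (l : List (Wire ι)) q => e.1.2 = listType x l ∧ ofVal e.1.2 q = l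
  | .inr _ => fun (i j : ι) => i = j

/-- The value of a wire given by its own label. -/
def val (y : ι → B) : ∀ a : Wire ι, Val (Values V B ι) ((a.type y).map .inl)
  | .base i => i
  | .right i => i
  | .left i => i

/-- The value of a sequence of wires given by their own labels. -/
def listVal (y : ι → B) : ∀ W : List (Wire ι), Val (Values V B ι) ((listType y W).map .inl)
  | [] => ()
  | a :: W => (val y a, listVal y W)

theorem ofVal_listVal (y : ι → B) (W : List (Wire ι)) :
    ofVal (V := V) (listType y W) (listVal y W) = W := by
  induction W with
  | nil => rfl
  | cons a W ih => cases a <;> exact congrArg (List.cons _) ih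

/-- The wire with a new label. -/
def relabel (y : ι → B) : ∀ a : Wire ι, Val (Values V B ι) ((a.type y).map .inl) → Wire ι
  | .base _, j => .base j
  | .right _, j => .right j
  | .left _, j => .left j

/-- The wires of a sequence, each paired with its relabelling by a value of the sequence. -/
def pairs (y : ι → B) : ∀ W : List (Wire ι),
    Val (Values V B ι) ((listType y W).map .inl) → List (Wire ι × Wire ι)
  | [], _ => []
  | a :: W, p => (a, relabel y a p.1) :: pairs y W p.2

theorem map_fst_pairs (y : ι → B) (W : List (Wire ι))
    (p : Val (Values V B ι) ((listType y W).map .inl)) : (pairs y W p).map Prod.fst = W := by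
  induction W with
  | nil => rfl
  | cons a W ih => exact congrArg (List.cons a) (ih p.2)

theorem map_snd_pairs (y : ι → B) (W : List (Wire ι))
    (p : Val (Values V B ι) ((listType y W).map .inl)) :
    (pairs y W p).map Prod.snd = ofVal (listType y W) p := by
  induction W with
  | nil => rfl
  | cons a W ih => cases a <;> exact congrArg (List.cons _) (ih p.2)

theorem pairs_eq_zip (y : ι → B) (W : List (Wire ι))
    (p : Val (Values V B ι) ((listType y W).map .inl)) :
    pairs y W p = W.zip (ofVal (listType y W) p) :=
  List.zip_of_prod (map_fst_pairs y W p) (map_snd_pairs y W p)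

variable {P : PregroupGrammar V B} {x y : ι → B}

/-- Concatenation preserves the labels of wires. -/
theorem rel_append_listVal (W W' : List (Wire ι)) :
    rel (interp P x) (append P y W W').hom (listVal y W, listVal y W') (listVal y (W ++ W')) := by
  induction W with
  | nil => exact rfl
  | cons a W ih =>
    exact (rel_comp _).2 ⟨(val y a, (listVal y W, listVal y W')), ⟨rfl, rfl, rfl⟩,
      (rel_whiskerLeft _).2 ⟨rfl, ih⟩⟩

/-- Concatenation is compatible with relabelling. -/
theorem pairs_of_rel_append (W W' : List (Wire ι))
    {p : Val (Values V B ι) ((listType y W).map .inl)}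
    {p' : Val (Values V B ι) ((listType y W').map .inl)}
    {q : Val (Values V B ι) ((listType y (W ++ W')).map .inl)}
    (h : rel (interp P x) (append P y W W').hom (p, p') q) :
    pairs y (W ++ W') q = pairs y W p ++ pairs y W' p' := by
  induction W with
  | nil => exact congrArg (pairs y W') (Eq.symm h)
  | cons a W ih =>
    obtain ⟨r, ⟨h₁, h₂, h₃⟩, h'⟩ := (rel_comp _).1 h
    obtain ⟨h₄, h₅⟩ := (rel_whiskerLeft _).1 h'
    exact congrArg₂ (fun b l => (a, relabel y a b) :: l) (h₁.trans h₄).symm (ih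
      (by
        have e : (p.2, p') = r.2 := Prod.ext h₂ h₃
        exact e ▸ h₅))

/-- Cups relate the wires with their own labels to each other. -/
theorem Cups.rel_listVal {W W' : List (Wire ι)} {c : obj P y W ⟶ obj P y W'}
    (h : Cups P y W W' c) : rel (interp P x) c (listVal y W) (listVal y W') := by
  have key : ∀ {W W' : List (Wire ι)} {f : obj P y W ⟶ obj P y W'}, Cup P y W W' f →
      rel (interp P x) f (listVal y W) (listVal y W') := by
    intro W W' f h
    induction h with
    | right i W => exact (rel_contractR _).2 ⟨rfl, rfl⟩
    | left i W => exact (rel_contractL _).2 ⟨rfl, rfl⟩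
    | cons a _ ih => exact (rel_whiskerLeft _).2 ⟨rfl, ih⟩
  induction h with
  | id W => exact (rel_id _).2 rfl
  | comp h _ ih => exact (rel_comp _).2 ⟨_, key h, ih⟩

/-- A cup removes two wires with equal new labels. -/
theorem Cup.pairs_eq {W W' : List (Wire ι)} {f : obj P y W ⟶ obj P y W'} (h : Cup P y W W' f)
    {q : Val (Values V B ι) ((listType y W).map .inl)}
    {q' : Val (Values V B ι) ((listType y W').map .inl)}
    (hq : rel (interp P x) f q q') :
    ∃ L R j k, pairs y W' q' = L ++ R ∧
      (pairs y W q = L ++ (.base j, .base k) :: (.right j, .right k) :: R ∨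
        pairs y W q = L ++ (.left j, .left k) :: (.base j, .base k) :: R) := by
  induction h with
  | right i W =>
    obtain ⟨h₁, h₂⟩ := (rel_contractR _).1 hq
    refine ⟨[], pairs y W q', i, q.1, rfl, .inl ?_⟩
    subst h₂
    exact congrArg (fun k => (Wire.base i, Wire.base q.1) :: (Wire.right i, Wire.right k) ::
      pairs y W q.2.2) (Eq.symm h₁)
  | left i W =>
    obtain ⟨h₁, h₂⟩ := (rel_contractL _).1 hq
    refine ⟨[], pairs y W q', i, q.1, rfl, .inr ?_⟩
    subst h₂
    exact congrArg (fun k => (Wire.left i, Wire.left q.1) :: (Wire.base i, Wire.base k) ::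
      pairs y W q.2.2) (Eq.symm h₁)
  | cons a _ ih =>
    obtain ⟨h₁, h₂⟩ := (rel_whiskerLeft _).1 hq
    obtain ⟨L, R, j, k, e, e'⟩ := ih h₂
    refine ⟨(a, relabel y a q.1) :: L, R, j, k,
      congrArg₂ (fun b l => (a, relabel y a b) :: l) (Eq.symm h₁) e,
      e'.imp (congrArg (List.cons _)) (congrArg (List.cons _))⟩

/-- Whatever labels are transported along cups, the label of a dependent's wire in the lexical
entry of its head is the label of the dependent itself. -/
theorem Cups.base_mem_pairs {W T : List (Wire ι)} {c : obj P y W ⟶ obj P y T}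
    (h : Cups P y W T c) {i : ι} (hT : T = [.base i])
    {q : Val (Values V B ι) ((listType y W).map .inl)}
    {q' : Val (Values V B ι) ((listType y T).map .inl)}
    (hq : rel (interp P x) c q q') (j k : ι)
    (hjk : (.right j, .right k) ∈ pairs y W q ∨ (.left j, .left k) ∈ pairs y W q) :
    (.base j, .base k) ∈ pairs y W q := by
  induction h with
  | id W =>
    subst hT
    simp [pairs] at hjk
  | comp h _ ih =>
    obtain ⟨r, h₁, h₂⟩ := (rel_comp _).1 hq
    obtain ⟨L, R, j', k', e, e'⟩ := h.pairs_eq h₁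
    have := ih hT h₂
    rw [e] at this
    obtain e' | e' := e' <;> rw [e'] at hjk ⊢ <;> simp_all <;> grind

end Wire

/-! ### A reduction is drawn by one dependency relation only -/

theorem PType.tensorList_injective {X : Type u} :
    Function.Injective (PType.tensorList (X := X)) := by
  intro l l' h
  induction l generalizing l' with
  | nil => cases l' <;> simp_all [PType.tensorList]
  | cons a l ih =>
    cases l' with
    | nil => simp [PType.tensorList] at h
    | cons b l' =>
      simp only [PType.tensorList, PType.tensor.injEq] at h
      rw [h.1, ih h.2]

namespace DependencyGrammar.DependencyRelation

variable {V : Type u} {B : Type v} {G : DependencyGrammar V B} {n : ℕ} {w : Fin n → V}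

open RC Wire

/-- The value of a string of words given by the wires of the lexical entries. -/
noncomputable def wordsVal (D : DependencyRelation G w) : ∀ js : List (Fin n),
    Val (Values V B (Fin n)) (G.toPregroup.wordsObj w js)
  | [] => ()
  | j :: js => (D.wires j, D.wordsVal js)

/-- The lexical entries of `D` produce the wires of `D` with their own labels. -/
theorem rel_lexical (D : DependencyRelation G w) (js : List (Fin n)) :
    rel (interp G.toPregroup D.x) (D.lexical js) (D.wordsVal js)
      (listVal D.x (js.flatMap D.wires)) := by
  induction js with
  | nil => exact rfl
  | cons j js ih =>
    exact (rel_comp _).2 ⟨(listVal D.x (D.wires j), listVal D.x (js.flatMap D.wires)),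
      (rel_tensor _).2 ⟨⟨rfl, ofVal_listVal D.x (D.wires j)⟩, ih⟩,
      rel_append_listVal (D.wires j) (js.flatMap D.wires)⟩

/-- The lexical entries of `D'`, applied to words that carry the wires of `D`, relabel the wires of
`D'` by those of `D`. -/
theorem pairs_of_rel_lexical (D D' : DependencyRelation G w) (js : List (Fin n))
    {q : Val (Values V B (Fin n)) ((listType D'.x (js.flatMap D'.wires)).map .inl)}
    (h : rel (interp G.toPregroup D.x) (D'.lexical js) (D.wordsVal js) q) :
    pairs D'.x (js.flatMap D'.wires) q = js.flatMap (fun j => (D'.wires j).zip (D.wires j)) ∧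
      ∀ j ∈ js, listType D'.x (D'.wires j) = listType D.x (D.wires j) := by
  induction js with
  | nil => exact ⟨rfl, by simp⟩
  | cons j js ih =>
    obtain ⟨r, h₁, h₂⟩ := (rel_comp _).1 h
    obtain ⟨⟨h₃, h₄⟩, h₅⟩ := (rel_tensor _).1 h₁
    obtain ⟨e, e'⟩ := ih h₅
    refine ⟨?_, List.forall_mem_cons.2 ⟨h₃, e'⟩⟩
    exact (pairs_of_rel_append (D'.wires j) (js.flatMap D'.wires) h₂).trans
      (congrArg₂ (· ++ ·) ((pairs_eq_zip D'.x (D'.wires j) r.1).trans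
        (congrArg (List.zip (D'.wires j)) h₄)) e)

theorem base_mem_wires (D : DependencyRelation G w) {i j : Fin n} :
    .base j ∈ D.wires i ↔ j = i := by
  simp [wires]

/-- A reduction determines the dependency relation by which it is drawn. -/
theorem eq_of_draws {D D' : DependencyRelation G w} {g : G.toPregroup.Reduction w}
    (h : D.Draws g) (h' : D'.Draws g) : D = D' := by
  obtain ⟨i, hi, c, -, hc, rfl⟩ := h
  obtain ⟨i', hi', c', -, hc', e⟩ := h'
  have hrel : rel (interp G.toPregroup D.x) (D.lexical (List.finRange n) ≫ c ≫
      (ρ_ (G.toPregroup.ofType (.atom (D.x i)))).hom ≫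
        G.toPregroup.inducedStep (D.x i) G.sentence ⟨hi, rfl⟩)
      (D.wordsVal (List.finRange n)) (show Fin n from i) :=
    (rel_comp _).2 ⟨_, D.rel_lexical _, (rel_comp _).2 ⟨_, hc.rel_listVal,
      (rel_comp _).2 ⟨(show Fin n from i), rfl, rfl⟩⟩⟩
  -- The same relation holds for the diagram drawn by `D'`. It relabels the wires of `D'`.
  rw [e] at hrel
  obtain ⟨q, h₁, h₂⟩ := (rel_comp _).1 hrel
  obtain ⟨q', h₂, -⟩ := (rel_comp _).1 h₂
  obtain ⟨hpairs, htype⟩ := D.pairs_of_rel_lexical D' _ h₁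
  have hbase := hc'.base_mem_pairs rfl h₂
  rw [hpairs] at hbase
  replace htype : ∀ j, (D'.wires j).map (type D'.x) = (D.wires j).map (type D.x) := fun j =>
    PType.tensorList_injective (htype j (List.mem_finRange j))
  -- The symbol of a lexical entry is not relabelled; by the cups, neither are the dependents.
  have heq : ∀ j k, (Wire.base j, Wire.base k) ∈
      (List.finRange n).flatMap (fun j => (D'.wires j).zip (D.wires j)) → j = k := by
    intro j k h
    obtain ⟨l, -, h⟩ := List.mem_flatMap.1 h
    obtain ⟨h, h'⟩ := List.of_mem_zip h
    rw [D'.base_mem_wires.1 h, D.base_mem_wires.1 h']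
  have hwires : ∀ j, D'.wires j = D.wires j := by
    intro j
    rw [← List.forall₂_eq_eq_eq, List.forall₂_iff_zip]
    have hlen : (D'.wires j).length = (D.wires j).length := by
      simpa using congrArg List.length (htype j)
    refine ⟨hlen, fun {a b} hab => ?_⟩
    have hmem : (a, b) ∈ (List.finRange n).flatMap
        (fun j => (D'.wires j).zip (D.wires j)) :=
      List.mem_flatMap.2 ⟨j, List.mem_finRange j, hab⟩
    have ht : type D'.x a = type D.x b := by
      have := htype j
      rw [← List.forall₂_eq_eq_eq, List.forall₂_map_left_iff, List.forall₂_map_right_iff,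
        List.forall₂_iff_zip] at this
      exact this.2 hab
    cases a <;> cases b <;> simp only [type, reduceCtorEq] at ht
    · rw [heq _ _ hmem]
    · rw [heq _ _ (hbase _ _ (.inl hmem))]
    · rw [heq _ _ (hbase _ _ (.inr hmem))]
  have hx : D.x = D'.x := by
    funext j
    have := htype j
    rw [hwires j, List.map_inj_left] at this
    exact (PType.atom.inj (this _ (D.base_mem_wires.2 rfl))).symm
  have hd : ∀ (D : DependencyRelation G w) (j k : Fin n),
      D.d j k ↔ .right j ∈ D.wires k ∨ .left j ∈ D.wires k := by
    intro D j k
    simp only [wires, List.mem_append, List.mem_map, List.mem_cons, mem_leftDeps, mem_rightDeps,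
      reduceCtorEq, Wire.right.injEq, Wire.left.injEq, false_or, and_false, exists_false, or_false,
      exists_eq_right]
    refine ⟨fun h => ?_, fun h => h.elim And.left And.left⟩
    have hne : j ≠ k := by
      rintro rfl
      exact D.acyclic j (.single h)
    exact (lt_or_gt_of_ne hne).imp (⟨h, ·⟩) (⟨h, ·⟩)
  refine DependencyRelation.ext hx ?_
  funext j k
  rw [eq_iff_iff, hd, hd, hwires]

end DependencyGrammar.DependencyRelation

theorem mainTheorem2 {V : Type u} {B : Type v} (G : DependencyGrammar V B)
    (hG : G.SentenceReserved) :
    G.toPregroup.IsOperadic ∧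
      ∀ (n : ℕ) (w : Fin n → V),
        ∃ e : G.DependencyRelation w ≃ G.toPregroup.Reduction w,
          ∀ (D : G.DependencyRelation w) (g : G.toPregroup.Reduction w),
            D.Draws g ↔ g = e D := by
  refine ⟨fun _ ⟨x, y, z, _, _, h⟩ => ⟨x, y, z, h⟩, fun n w => ?_⟩
  choose f hf using fun D : G.DependencyRelation w => D.exists_draws_reduction
  refine ⟨.ofBijective f ⟨fun D D' h => DependencyGrammar.DependencyRelation.eq_of_draws (hf D)
    (h ▸ hf D'), fun g => ?_⟩,
    fun D g => ⟨fun h => h.unique (hf D), fun h => h ▸ hf D⟩⟩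
  obtain ⟨D, hD⟩ := G.exists_draws hG g
  exact ⟨D, (hf D).unique hD⟩
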